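/- **Setting.** Let $H_0$ be a (possibly unbounded) self-adjoint operator on a complex Hilbert space $\mathcal H$ with a complete orthonormal set of eigenvectors $H_0\psi_k=\lambda_k\psi_k$, $k$ in a countable (finite or infinite) index set $I$; let $\beta$ be a bounded self-adjoint operator with $\|\beta\|=1$; let $g_0\in L^2(\mathbb R)$ be real valued, supported in $[0,T]$, with $\|g_0\|_{L^1}=1$. Let $d_0,d_1,\dots\ge 0$ be independent identically distributed random variables with mean $M$ and finite third moment such that $\mathbb E\big(e^{i(\lambda_j-\lambda_k)d_l}\big)=0$ for all $l$ and all $j\ne k$. Put $t_n=(d_0+T)+\dots+(d_{n-1}+T)+d_n$ and $g(t)=\sum_{n\ge0}g_0(t-t_n)$. For $\varepsilon\in\mathbb R$ let $\phi=\phi_\varepsilon$ be the (weak) solution for $t\ge0$ of $$i\partial_t\phi=H_0\phi+\varepsilon\,g(t)\,\beta\phi,\qquad \phi(0)=\phi_0,$$ where $\phi_0$ does not depend on $\varepsilon$ and is either deterministic or random, independent of $(d_l)_l$, with $\mathbb E\|\phi_0\|^2<\infty$. Put $P_k(t)=P_{k,\varepsilon}(t)=\mathbb E\big(|\langle\psi_k,\phi(t)\rangle|^2\big)$.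 Let $\alpha_{kj}=\langle\psi_k,\beta\psi_j\rangle$, $\hat g_0(\xi)=\int e^{-i\xi t}g_0(t)\,dt$, and let $B=(b_{kj})$ be the matrix with $b_{kj}=-|\alpha_{kj}|^2|\hat g_0(\lambda_j-\lambda_k)|^2$ for $j\ne k$ and $b_{kk}=\sum_{l\ne k}|\alpha_{kl}|^2|\hat g_0(\lambda_l-\lambda_k)|^2$. Let $\emptyset\ne S\subseteq I$ be the index set of an irreducible subsystem: $b_{kj}=0$ for $k\in S$, $j\notin S$, and the block of $B$ on $S$ is irreducible. From now on $B$ denotes this block, a bounded operator on $\ell^1(S)$, $P(t)=(P_k(t))_{k\in S}$, and $E=\sum_{k\in S}P_k(0)$. **Corollary.** All expected powers $P_k(t)$, $t\ge 0$, are finite. Let $t=t(\varepsilon)\ge0$ be any function of $\varepsilon$; all limits are as $\varepsilon\to0$, $\varepsilon\neq0$. 0. (Conservation of the power.) If $t|\varepsilon|^3\to0$, then $\sum_{k\in S}P_k(t)\to E$. If $\beta$ does not couple $S$ to the other modes ($\alpha_{kj}=0$ for $k\in S$, $j\notin S$; for instance if $S=I$), then $\sum_{k\in S}P_k(t)=E$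 exactly, for all $t\ge0$ and all $\varepsilon$. 1. (No change.) If $t\ll\varepsilon^{-2}$, i.e. $\varepsilon^2t\to0$, then $P(t)\to P(0)$ in $\ell^1(S)$. 2. (Diffusion.) If $\varepsilon^2t\to\tau>0$ (for instance if $t=\tau\varepsilon^{-2}$), then $P(t)\to e^{-B\tau/(T+M)}P(0)$ in $\ell^1(S)$; equivalently, $P(t)\to e^{-B\tau}P(0)$ if $\varepsilon^2 t\to\tau(T+M)$. 3. Suppose that $\varepsilon^{-2}\ll t\ll|\varepsilon|^{-3}$, i.e. $\varepsilon^2t\to\infty$ and $|\varepsilon|^3t\to0$. - (Equidistribution.) If $S$ is finite with $m$ elements, then $P(t)\to\frac Em(1,1,\dots,1)'$. - (Loss to high modes.) If $S$ is infinite, then $P(t)\to0$ in $\ell^2(S)$; $P(t)$ does not converge in $\ell^1(S)$ if $E>0$; and for every finite $F\subset S$, $\sum_{k\in F}P_k(t)\to0$ and $\sum_{k\in S\setminus F}P_k(t)\to E$. -/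

import Mathlib

open MeasureTheory ProbabilityTheory Filter Topology
open scoped lp

/-- The Fourier transform `ĝ(ξ) = ∫ e^{-iξt} g(t) dt` of a real function. -/
noncomputable def fourierHat (g : ℝ → ℝ) (ξ : ℝ) : ℂ :=
  ∫ t : ℝ, Complex.exp (-(Complex.I * ξ * t)) * (g t : ℂ)

/-- A system with discrete frequencies together with a short-lived perturbation:
a (possibly unbounded) self-adjoint operator `H₀` with a complete orthonormal set of eigenvectors
`ψ k` and eigenvalues `lam k`, a bounded self-adjoint `β` of norm one, and a real profile
`g₀ ∈ L²(ℝ)` supported in `[0, T]` with `L¹` norm one. -/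
structure DefectSystem (ι H : Type*) [NormedAddCommGroup H] [InnerProductSpace ℂ H]
    [CompleteSpace H] where
  H₀ : H →ₗ.[ℂ] H
  H₀_selfAdjoint : IsSelfAdjoint H₀
  ψ : HilbertBasis ι ℂ H
  lam : ι → ℝ
  ψ_mem : ∀ k, ψ k ∈ H₀.domain
  eigen : ∀ k, H₀ ⟨ψ k, ψ_mem k⟩ = (lam k : ℂ) • ψ k
  β : H →L[ℂ] H
  β_selfAdjoint : IsSelfAdjoint β
  β_norm : ‖β‖ = 1
  g₀ : ℝ → ℝ
  T : ℝ
  g₀_memLp : MemLp g₀ 2 volume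
  g₀_support : ∀ s, s ∉ Set.Icc 0 T → g₀ s = 0
  g₀_norm : ∫ s, |g₀ s| = 1

namespace DefectSystem

section

variable {ι H : Type*} [NormedAddCommGroup H] [InnerProductSpace ℂ H] [CompleteSpace H]
  (sys : DefectSystem ι H)

/-- The matrix elements `α_{kj} = ⟨ψ_k, β ψ_j⟩`. -/
noncomputable def α (k j : ι) : ℂ := inner ℂ (sys.ψ k) (sys.β (sys.ψ j))

/-- `|α_{kj}|² |ĝ₀(-Δ_{kj})|²` with `Δ_{kj} = λ_k - λ_j`. -/
noncomputable def rate (k j : ι) : ℝ :=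
  ‖sys.α k j‖ ^ 2 * ‖fourierHat sys.g₀ (-(sys.lam k - sys.lam j))‖ ^ 2

open Classical in
/-- The entries `b_{kj}` of the power transmission matrix `B`: minus the rate off the diagonal,
and the sum of the rates of the row on the diagonal. -/
noncomputable def b (k j : ι) : ℝ :=
  if j = k then ∑' l : ι, (if l = k then 0 else sys.rate k l) else -sys.rate k j

lemma norm_fourierHat_le (ξ : ℝ) : ‖fourierHat sys.g₀ ξ‖ ≤ 1 := by
  unfold fourierHat
  refine (norm_integral_le_integral_norm _).trans ?_
  rw [← sys.g₀_norm]
  refine le_of_eq (integral_congr_ae (Eventually.of_forall fun t => ?_))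
  have : ‖Complex.exp (-(Complex.I * ξ * t))‖ = 1 := by
    rw [Complex.norm_exp]; simp
  simp [this]

lemma rate_nonneg (k j : ι) : 0 ≤ sys.rate k j := by unfold rate; positivity

lemma rate_le (k j : ι) : sys.rate k j ≤ ‖sys.α k j‖ ^ 2 := by
  have h := sys.norm_fourierHat_le (-(sys.lam k - sys.lam j))
  have h2 : ‖fourierHat sys.g₀ (-(sys.lam k - sys.lam j))‖ ^ 2 ≤ 1 :=
    pow_le_one₀ (norm_nonneg _) h
  exact mul_le_of_le_one_right (by positivity) h2

lemma norm_α_symm (k j : ι) : ‖sys.α k j‖ = ‖sys.α j k‖ := by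
  have h : sys.α k j = inner ℂ (sys.β (sys.ψ k)) (sys.ψ j) := by
    unfold α
    rw [← ContinuousLinearMap.adjoint_inner_left, sys.β_selfAdjoint.adjoint_eq]
  rw [h, norm_inner_symm]; rfl

lemma norm_βψ_le (j : ι) : ‖sys.β (sys.ψ j)‖ ^ 2 ≤ 1 := by
  refine pow_le_one₀ (norm_nonneg _) ?_
  have := sys.β.le_opNorm (sys.ψ j)
  rwa [sys.β_norm, sys.ψ.orthonormal.1 j, one_mul] at this

lemma hasRateCol (j : ι) : Summable (fun k => sys.rate k j) ∧ ∑' k, sys.rate k j ≤ 1 := by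
  have hs : Summable fun k => ‖sys.α k j‖ ^ 2 :=
    sys.ψ.orthonormal.inner_products_summable (sys.β (sys.ψ j))
  have hr : Summable fun k => sys.rate k j :=
    hs.of_nonneg_of_le (fun k => sys.rate_nonneg k j) fun k => sys.rate_le k j
  refine ⟨hr, (hr.tsum_le_tsum (fun k => sys.rate_le k j) hs).trans ?_⟩
  exact (sys.ψ.orthonormal.tsum_inner_products_le (sys.β (sys.ψ j))).trans (sys.norm_βψ_le j)

open Classical in
lemma hasDiag (k : ι) : 0 ≤ ∑' l : ι, (if l = k then 0 else sys.rate k l) ∧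
    ∑' l : ι, (if l = k then 0 else sys.rate k l) ≤ 1 := by
  have h0 : ∀ l, 0 ≤ (if l = k then 0 else sys.rate k l) := fun l => by
    split_ifs
    · exact le_rfl
    · exact sys.rate_nonneg k l
  have h1 : ∀ l, (if l = k then 0 else sys.rate k l) ≤ ‖sys.α l k‖ ^ 2 := fun l => by
    split_ifs
    · positivity
    · rw [sys.norm_α_symm l k]; exact sys.rate_le k l
  have hs : Summable fun l => ‖sys.α l k‖ ^ 2 :=
    sys.ψ.orthonormal.inner_products_summable (sys.β (sys.ψ k))
  refine ⟨tsum_nonneg h0, ((hs.of_nonneg_of_le h0 h1).tsum_le_tsum h1 hs).trans ?_⟩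
  exact (sys.ψ.orthonormal.tsum_inner_products_le (sys.β (sys.ψ k))).trans (sys.norm_βψ_le k)

open Classical in
lemma abs_b_le (k j : ι) : |sys.b k j| ≤ (if k = j then 1 else 0) + sys.rate k j := by
  unfold b
  by_cases h : j = k
  · subst h
    have := sys.hasDiag j
    have h2 := sys.rate_nonneg j j
    simp only [if_true]
    rw [abs_of_nonneg this.1]
    linarith [this.2]
  · rw [if_neg h, if_neg (Ne.symm h), abs_neg, abs_of_nonneg (sys.rate_nonneg k j), zero_add]

/-- The columns of `B` have `ℓ¹` norm at most two. -/
lemma sum_abs_b_le (S : Set ι) (j : ι) (s : Finset S) : ∑ k ∈ s, |sys.b k j| ≤ 2 := by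
  classical
  have h1 : ∑ k ∈ s, |sys.b k j| = ∑ k ∈ s.map (Function.Embedding.subtype _), |sys.b k j| := by
    simp
  rw [h1]
  refine (Finset.sum_le_sum fun k _ => sys.abs_b_le k j).trans ?_
  rw [Finset.sum_add_distrib]
  have h2 : ∑ k ∈ s.map (Function.Embedding.subtype _), (if k = j then (1 : ℝ) else 0) ≤ 1 := by
    rw [Finset.sum_ite_eq']; split_ifs <;> norm_num
  have h3 := (sys.hasRateCol j).1.sum_le_tsum (s.map (Function.Embedding.subtype _))
    (fun k _ => sys.rate_nonneg k j)
  linarith [(sys.hasRateCol j).2]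

/-- The `j`-th column of `B`, restricted to the modes in `S`, as an element of `ℓ¹(S)`. -/
noncomputable def col (S : Set ι) (j : S) : ℓ¹(S, ℝ) :=
  ⟨fun k : S => sys.b k j, memℓp_gen' (C := 2) fun s => by
    simpa using sys.sum_abs_b_le S j s⟩

lemma norm_col_le (S : Set ι) (j : S) : ‖sys.col S j‖ ≤ 2 :=
  lp.norm_le_of_forall_sum_le (by norm_num) (by norm_num) fun s => by
    simpa [col] using sys.sum_abs_b_le S j s

lemma summable_smul_col (S : Set ι) (v : ℓ¹(S, ℝ)) :
    Summable fun j : S => ‖(v j) • sys.col S j‖ := by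
  have hv : Summable fun j : S => ‖v j‖ := by simpa using v.2.summable (by norm_num)
  refine (hv.mul_right 2).of_nonneg_of_le (fun _ => norm_nonneg _) fun j => ?_
  rw [norm_smul]
  exact mul_le_mul_of_nonneg_left (sys.norm_col_le S j) (norm_nonneg _)

/-- The power transmission matrix `(b_{kj})_{k,j ∈ S}` as a bounded operator on `ℓ¹(S)`:
`v ↦ ∑_{j ∈ S} v_j · (j-th column)`; see `B_apply` for its components. -/
noncomputable def B (S : Set ι) : ℓ¹(S, ℝ) →L[ℝ] ℓ¹(S, ℝ) :=
  LinearMap.mkContinuous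
    { toFun := fun v => ∑' j : S, (v j) • sys.col S j
      map_add' := fun v w => by
        rw [← Summable.tsum_add (sys.summable_smul_col S v).of_norm
          (sys.summable_smul_col S w).of_norm]
        simp [add_smul]
      map_smul' := fun c v => by
        rw [RingHom.id_apply, ← Summable.tsum_const_smul c (sys.summable_smul_col S v).of_norm]
        simp [mul_smul] }
    2 (fun v => by
      have hv : Summable fun j : S => ‖v j‖ := by simpa using v.2.summable (by norm_num)
      refine (norm_tsum_le_tsum_norm (sys.summable_smul_col S v)).trans ?_
      have hn : ‖v‖ = ∑' j : S, ‖v j‖ := by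
        simpa using lp.norm_eq_tsum_rpow (p := 1) (by norm_num) v
      rw [hn, ← tsum_mul_left]
      refine (sys.summable_smul_col S v).tsum_le_tsum (fun j => ?_) (hv.mul_left 2)
      rw [norm_smul, mul_comm]
      exact mul_le_mul_of_nonneg_right (sys.norm_col_le S j) (norm_nonneg _))

lemma B_apply (S : Set ι) (v : ℓ¹(S, ℝ)) (k : S) :
    (sys.B S v) k = ∑' j : S, sys.b k j * v j := by
  have h := (lp.evalCLM (𝕜 := ℝ) (E := fun _ : S => ℝ) (p := 1) k).map_tsum
    (sys.summable_smul_col S v).of_norm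
  have h2 : (sys.B S v) k = ∑' j : S, ((v j) • sys.col S j) k := h
  rw [h2]
  refine tsum_congr fun j => ?_
  simp [col, mul_comm]

/-- `S` is the index set of an irreducible subsystem: `S` is nonempty, `B` does not couple
`S` to its complement, and the block of `B` on `S` is irreducible. -/
def IsIrreducibleSubsystem (S : Set ι) : Prop :=
  S.Nonempty ∧ (∀ k ∈ S, ∀ j ∉ S, sys.b k j = 0) ∧
    ∀ A ⊆ S, A.Nonempty → (S \ A).Nonempty → ∃ k ∈ A, ∃ j ∈ S \ A, sys.b k j ≠ 0

/-- The onset time `t_n = (d_0 + T) + ⋯ + (d_{n-1} + T) + d_n` of the `n`-th defect. -/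
noncomputable def onset (d : ℕ → ℝ) (n : ℕ) : ℝ :=
  (∑ i ∈ Finset.range n, (d i + sys.T)) + d n

/-- The train of defects `g(s) = ∑_n g₀(s - t_n)`. -/
noncomputable def train (d : ℕ → ℝ) (s : ℝ) : ℝ := ∑' n : ℕ, sys.g₀ (s - sys.onset d n)

/-- `u` is the (weak) solution on `t ≥ 0` of `i ∂_t u = H₀ u + ε g(t) β u`, `u(0) = u₀`, where
`g` is the train of defects with gaps `d`: `u` is continuous and, for each `v` in the domain of
`H₀`, the function `t ↦ ⟨v, u(t)⟩` solves the integrated equation. -/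
structure IsSolution (ε : ℝ) (d : ℕ → ℝ) (u₀ : H) (u : ℝ → H) : Prop where
  continuousOn : ContinuousOn u (Set.Ici 0)
  initial : u 0 = u₀
  weak : ∀ v : sys.H₀.domain, ∀ t : ℝ, 0 ≤ t →
    inner ℂ (v : H) (u t) = inner ℂ (v : H) u₀ - Complex.I * ∫ s in (0 : ℝ)..t,
      (inner ℂ (sys.H₀ v) (u s) + (ε * sys.train d s : ℝ) * inner ℂ (v : H) (sys.β (u s)))

variable {Ω : Type*} [MeasurableSpace Ω] (μ : Measure Ω)

/-- The expected power `E(|⟨ψ_k, X⟩|²)` of a random state `X` in the mode `k`. -/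
noncomputable def power (X : Ω → H) (k : ι) : ℝ := ∫ ω, ‖inner ℂ (sys.ψ k) (X ω)‖ ^ 2 ∂μ

open Classical in
/-- The vector of the expected powers in the modes of `S`, as an element of `ℓ¹(S)`. The default
value is not used for square integrable `X`; see `powerVec_apply`. -/
noncomputable def powerVec (X : Ω → H) (S : Set ι) : ℓ¹(S, ℝ) :=
  if h : Memℓp (fun k : S => sys.power μ X k) 1 then ⟨fun k : S => sys.power μ X k, h⟩ else 0

lemma memℓp_power {X : Ω → H} (hX : MemLp X 2 μ) (S : Set ι) :
    Memℓp (fun k : S => sys.power μ X k) 1 := by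
  have hX2 : Integrable (fun ω => ‖X ω‖ ^ 2) μ := hX.integrable_norm_pow (by norm_num)
  have hk : ∀ k, Integrable (fun ω => ‖inner ℂ (sys.ψ k) (X ω)‖ ^ 2) μ := fun k => by
    refine hX2.mono ((hX.1.const_inner).norm.pow 2) (Eventually.of_forall fun ω => ?_)
    rw [Real.norm_of_nonneg (by positivity), Real.norm_of_nonneg (by positivity)]
    have := norm_inner_le_norm (𝕜 := ℂ) (sys.ψ k) (X ω)
    rw [sys.ψ.orthonormal.1 k, one_mul] at this
    gcongr
  refine memℓp_gen' (C := ∫ ω, ‖X ω‖ ^ 2 ∂μ) fun s => ?_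
  have h0 : ∀ k : S, ‖sys.power μ X k‖ = sys.power μ X k := fun k =>
    Real.norm_of_nonneg (integral_nonneg fun ω => by positivity)
  simp only [ENNReal.toReal_one, Real.rpow_one, h0]
  unfold power
  rw [← integral_finsetSum s fun (k : S) _ => hk k]
  refine integral_mono (integrable_finsetSum s fun (k : S) _ => hk k) hX2 fun ω => ?_
  have := sys.ψ.orthonormal.sum_inner_products_le (X ω)
    (s := s.map (Function.Embedding.subtype _))
  simpa using this

lemma powerVec_apply {X : Ω → H} (hX : MemLp X 2 μ) (S : Set ι) (k : S) :
    sys.powerVec μ X S k = sys.power μ X k := by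
  simp [powerVec, sys.memℓp_power μ hX S]

end

end DefectSystem

/-! Between two defects the free evolution only turns the phases of the amplitudes. Since 𝔼
e^{i(λ_j-λ_k)d} = 0 for j ≠ k, a gap that is independent of the state at its start removes all
interference. The expected powers before a defect therefore determine those after it: they are
multiplied by the matrix |⟨ψ_k, Uψ_j⟩|² of the defect's propagator U
(`hasSum_integral_norm_sq_inner_comp`). To first order in ε the off-diagonal amplitudes are Fourier
transforms of g₀, so this matrix is 1 - ε²B up to O(|ε|³) in each column. The diagonal needs no
second-order expansion, because U is isometric and the columns sum to one (`sum_abs_transition_le`).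
Hence one period acts like e^{-ε²B} up to O(|ε|³), and the roughly t/(T+M) periods before t produce
a total error O(|ε|³t).

The number of periods before t is random and depends on the gaps; conditioning on it would destroy
the independence just used. Instead the state after n periods is multiplied by the indicator that
these periods are over by time t (`running`). This event involves only the gaps before the next one,
so the next gap stays independent. In each step the powers split into a part that continues and a
part whose current period contains t (`ending`). The recursion is solved by a discrete Duhamel
formula (`norm_sub_heat_le`). By Chebyshev's inequality the number of periods is within about κε⁻²
of t/(T+M) with high probability, which shifts the diffusion time by O(κ) only; κ is arbitrary. The
result is `tendsto_powerVec_sub_heat`: P(t) - e^{-ε²tB/(T+M)}P(0) → 0 in ℓ¹ if |ε|³t → 0.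

The rest concerns the semigroup e^{-sB}. The matrix W = 1 - B is symmetric and doubly stochastic, so
e^{-sB} contracts ℓ¹ and preserves sums, which gives the conservation of power. Symmetry and
positivity of B in ℓ² make every orbit converge in ℓ² (`exists_tendsto_heat`). The limit is fixed by
W, and the maximum principle with irreducibility makes it constant. On an infinite set the only
constant in ℓ² is 0; on a finite set the preserved sum fixes the constant.

Two further points: a weak solution is identified with an explicit product of propagators
(`isSolution_eq_stateAt`), which also yields measurability; and exact conservation holds because the
reflection across S commutes with the whole evolution. -/

/-! ### Sums and norms in ℓ¹, and its inclusion in ℓ². -/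

section EllOne

variable {σ : Type*}

lemma ellOne_norm_eq (v : ℓ¹(σ, ℝ)) : ‖v‖ = ∑' k, |v k| := by
  simpa using lp.norm_eq_tsum_rpow (p := 1) (by norm_num) v

lemma ellOne_summable_abs (v : ℓ¹(σ, ℝ)) : Summable fun k => |v k| := by
  simpa using v.2.summable (by norm_num)

lemma ellOne_summable (v : ℓ¹(σ, ℝ)) : Summable fun k => v k :=
  (ellOne_summable_abs v).of_abs

lemma ellOne_abs_le (v : ℓ¹(σ, ℝ)) (k : σ) : |v k| ≤ ‖v‖ := by
  simpa using lp.norm_apply_le_norm (p := 1) (by norm_num) v k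

lemma ellOne_norm_le {v : ℓ¹(σ, ℝ)} {C : ℝ} (hC : 0 ≤ C)
    (h : ∀ s : Finset σ, ∑ k ∈ s, |v k| ≤ C) : ‖v‖ ≤ C :=
  lp.norm_le_of_forall_sum_le (by norm_num) hC fun s => by simpa using h s

/-- The sum of the entries, as a continuous functional on `ℓ¹`. -/
noncomputable def ellOneSum (σ : Type*) : ℓ¹(σ, ℝ) →L[ℝ] ℝ :=
  LinearMap.mkContinuous
    { toFun := fun v => ∑' k, v k
      map_add' := fun v w => by
        simpa using (ellOne_summable v).tsum_add (ellOne_summable w)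
      map_smul' := fun c v => by simp [tsum_mul_left] }
    1 fun v => by
      rw [one_mul, ellOne_norm_eq]
      exact norm_tsum_le_tsum_norm (ellOne_summable_abs v)

@[simp] lemma ellOneSum_apply (v : ℓ¹(σ, ℝ)) : ellOneSum σ v = ∑' k, v k := rfl

lemma ellOne_summable_sq (v : ℓ¹(σ, ℝ)) : Summable fun k => v k ^ 2 := by
  refine ((ellOne_summable_abs v).mul_left ‖v‖).of_nonneg_of_le (fun _ => sq_nonneg _) fun k => ?_
  rw [← sq_abs, sq]
  exact mul_le_mul_of_nonneg_right (ellOne_abs_le v k) (abs_nonneg _)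

lemma ellOne_tsum_sq_le (v : ℓ¹(σ, ℝ)) : ∑' k, v k ^ 2 ≤ ‖v‖ ^ 2 := by
  have h : ∑' k, v k ^ 2 ≤ ∑' k, ‖v‖ * |v k| := by
    refine (ellOne_summable_sq v).tsum_le_tsum (fun k => ?_)
      ((ellOne_summable_abs v).mul_left ‖v‖)
    rw [← sq_abs, sq]
    exact mul_le_mul_of_nonneg_right (ellOne_abs_le v k) (abs_nonneg _)
  rwa [tsum_mul_left, ← ellOne_norm_eq, ← sq] at h

lemma ellTwo_norm_sq (v : ℓ²(σ, ℝ)) : ‖v‖ ^ 2 = ∑' k, v k ^ 2 := by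
  rw [← real_inner_self_eq_norm_sq, lp.inner_eq_tsum]
  exact tsum_congr fun k => by simp [sq]

/-- The inclusion of `ℓ¹` in `ℓ²`. -/
noncomputable def ellOneTwo (σ : Type*) : ℓ¹(σ, ℝ) →L[ℝ] ℓ²(σ, ℝ) :=
  LinearMap.mkContinuous (lp.linearMapOfLE ℝ (fun _ : σ => ℝ) (by norm_num)) 1 fun v => by
    rw [one_mul]
    refine le_of_sq_le_sq ?_ (norm_nonneg _)
    rw [ellTwo_norm_sq]
    simpa using ellOne_tsum_sq_le v

@[simp] lemma ellOneTwo_apply (v : ℓ¹(σ, ℝ)) (k : σ) : ellOneTwo σ v k = v k := rfl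

lemma ellOneTwo_inner (v w : ℓ¹(σ, ℝ)) :
    inner ℝ (ellOneTwo σ v) (ellOneTwo σ w) = ∑' k, v k * w k := by
  rw [lp.inner_eq_tsum]
  exact tsum_congr fun k => by simp [mul_comm]

lemma ellOneTwo_norm_sq (v : ℓ¹(σ, ℝ)) : ‖ellOneTwo σ v‖ ^ 2 = ∑' k, v k ^ 2 := by
  rw [ellTwo_norm_sq]; rfl

lemma ellOne_summable_abs_mul (v w : ℓ¹(σ, ℝ)) : Summable fun k => |v k * w k| := by
  refine ((ellOne_summable_abs v).mul_right ‖w‖).of_nonneg_of_le (fun k => abs_nonneg _)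
    fun k => ?_
  rw [abs_mul]
  exact mul_le_mul_of_nonneg_left (ellOne_abs_le w _) (abs_nonneg _)

end EllOne

/-- `B = 1 - W` on `ℓ¹` for a symmetric doubly stochastic matrix `W`. -/
structure IsDiffusion {σ : Type*} (B : ℓ¹(σ, ℝ) →L[ℝ] ℓ¹(σ, ℝ)) (W : σ → σ → ℝ) : Prop where
  nonneg : ∀ k j, 0 ≤ W k j
  symm : ∀ k j, W k j = W j k
  hasSum : ∀ j, HasSum (fun k => W k j) 1
  apply : ∀ v k, B v k = v k - ∑' j, W k j * v j

/-! ### Generators B = 1 - W of symmetric diffusions. -/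

namespace IsDiffusion

variable {σ : Type*} {B : ℓ¹(σ, ℝ) →L[ℝ] ℓ¹(σ, ℝ)} {W : σ → σ → ℝ} (hB : IsDiffusion B W)

include hB

lemma hasSum_row (k : σ) : HasSum (fun j => W k j) 1 := by
  simpa [hB.symm k] using hB.hasSum k

/-- Summing over the row index first gives ∑_j |a j|, as the columns of W sum to one. This joint
summability licenses the interchanges of sums below. -/
lemma summable_kernel {a : σ → ℝ} (ha : Summable fun k => |a k|) :
    Summable fun p : σ × σ => W p.1 p.2 * a p.2 := by
  refine Summable.of_abs ?_
  have h : Summable fun p : σ × σ => |W p.2 p.1 * a p.1| := by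
    have e : ∀ j k, |W k j * a j| = W k j * |a j| := fun j k => by
      rw [abs_mul, abs_of_nonneg (hB.nonneg k j)]
    refine (summable_prod_of_nonneg fun p => abs_nonneg _).2 ⟨fun j => ?_, ?_⟩
    · simp only [e]
      exact (hB.hasSum j).summable.mul_right _
    · simp only [e, tsum_mul_right, (hB.hasSum _).tsum_eq, one_mul]
      exact ha
  exact (Equiv.prodComm σ σ).summable_iff.1 h

lemma tsum_kernel {a : σ → ℝ} (ha : Summable fun k => |a k|) :
    ∑' k, ∑' j, W k j * a j = ∑' j, a j := by
  have h := hB.summable_kernel ha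
  have h2 : ∑' k, ∑' j, W k j * a j = ∑' j, ∑' k, W k j * a j :=
    (Summable.tsum_comm (f := fun k j => W k j * a j) h).symm
  rw [h2]
  exact tsum_congr fun j => by rw [tsum_mul_right, (hB.hasSum j).tsum_eq, one_mul]

lemma summable_row {a : σ → ℝ} (ha : Summable fun k => |a k|) (k : σ) :
    Summable fun j => W k j * a j :=
  (hB.summable_kernel ha).prod_factor k

/-- Entrywise |Wv| ≤ W|v|, and W preserves the sum of |v|. -/
lemma norm_one_sub_le : ‖1 - B‖ ≤ 1 := by
  refine ContinuousLinearMap.opNorm_le_bound _ zero_le_one fun v => ?_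
  rw [one_mul]
  have hv := ellOne_summable_abs v
  have hv' : Summable fun k => |(|v k|)| := by simpa using hv
  refine ellOne_norm_le (norm_nonneg _) fun s => ?_
  have h1 : ∀ k, |((1 - B) v) k| ≤ ∑' j, W k j * |v j| := fun k => by
    have : ((1 - B) v) k = ∑' j, W k j * v j := by
      have h : ((1 - B) v) k = v k - B v k := rfl
      rw [h, hB.apply]; ring
    rw [this, ← Real.norm_eq_abs]
    refine (norm_tsum_le_tsum_norm (hB.summable_row hv k).norm).trans (le_of_eq ?_)
    exact tsum_congr fun j => by
      rw [Real.norm_eq_abs, abs_mul, abs_of_nonneg (hB.nonneg k j)]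
  refine (Finset.sum_le_sum fun k _ => h1 k).trans ?_
  rw [ellOne_norm_eq, ← hB.tsum_kernel hv']
  exact (hB.summable_kernel hv').prod.sum_le_tsum s fun k _ =>
    tsum_nonneg fun j => mul_nonneg (hB.nonneg _ _) (abs_nonneg _)

lemma norm_le_two : ‖B‖ ≤ 2 := by
  have h : B = 1 - (1 - B) := by abel
  rw [h]
  refine (norm_sub_le _ _).trans ?_
  have h1 : ‖(1 : ℓ¹(σ, ℝ) →L[ℝ] ℓ¹(σ, ℝ))‖ ≤ 1 := ContinuousLinearMap.norm_id_le
  linarith [hB.norm_one_sub_le]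

lemma sum_comp : (ellOneSum σ).comp B = 0 := by
  ext v
  have hv := ellOne_summable_abs v
  have h : ∑' k, B v k = 0 := by
    simp only [hB.apply]
    rw [(ellOne_summable v).tsum_sub (hB.summable_kernel hv).prod, hB.tsum_kernel hv, sub_self]
  exact h

lemma summable_form (v w : ℓ¹(σ, ℝ)) :
    Summable fun p : σ × σ => W p.1 p.2 * v p.2 * w p.1 := by
  refine Summable.of_norm_bounded ((hB.summable_kernel (ellOne_summable_abs v)).abs.mul_right ‖w‖)
    fun p => ?_
  rw [Real.norm_eq_abs, abs_mul]
  exact mul_le_mul_of_nonneg_left (ellOne_abs_le w _) (abs_nonneg _)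

lemma inner_eq (v w : ℓ¹(σ, ℝ)) : inner ℝ (ellOneTwo σ (B v)) (ellOneTwo σ w) =
    ∑' k, v k * w k - ∑' k, ∑' j, W k j * v j * w k := by
  rw [ellOneTwo_inner]
  have h : ∀ k, B v k * w k = v k * w k - ∑' j, W k j * v j * w k := fun k => by
    rw [hB.apply, tsum_mul_right]; ring
  simp only [h]
  exact (ellOne_summable_abs_mul v w).of_abs.tsum_sub (hB.summable_form v w).prod

lemma inner_symm (v w : ℓ¹(σ, ℝ)) : inner ℝ (ellOneTwo σ (B v)) (ellOneTwo σ w) =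
    inner ℝ (ellOneTwo σ v) (ellOneTwo σ (B w)) := by
  rw [real_inner_comm (ellOneTwo σ (B w)), hB.inner_eq, hB.inner_eq]
  congr 1
  · exact tsum_congr fun k => mul_comm _ _
  · have h : ∑' k, ∑' j, W k j * v j * w k = ∑' j, ∑' k, W k j * v j * w k :=
      (Summable.tsum_comm (f := fun k j => W k j * v j * w k) (hB.summable_form v w)).symm
    rw [h]
    exact tsum_congr fun j => tsum_congr fun k => by rw [hB.symm k j]; ring

/-- By 2v_jv_k ≤ v_k² + v_j² the form of W is at most ½∑W_kj(v_k² + v_j²), which is ∑v_k² because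
rows and columns sum to one. -/
lemma inner_nonneg (v : ℓ¹(σ, ℝ)) : 0 ≤ inner ℝ (ellOneTwo σ (B v)) (ellOneTwo σ v) := by
  have hv : Summable fun k => |v k * v k| := ellOne_summable_abs_mul v v
  have h2 : Summable fun p : σ × σ => W p.1 p.2 * (v p.2 * v p.2) := hB.summable_kernel hv
  have h1 : Summable fun p : σ × σ => W p.1 p.2 * (v p.1 * v p.1) :=
    ((Equiv.prodComm σ σ).summable_iff.2 h2).congr fun p => by simp [hB.symm p.2 p.1]
  have e1 : ∑' k, ∑' j, W k j * (v k * v k) = ∑' k, v k * v k :=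
    tsum_congr fun j => by rw [tsum_mul_right, (hB.hasSum_row j).tsum_eq, one_mul]
  rw [hB.inner_eq, sub_nonneg]
  have h3 : ∑' k, ∑' j, W k j * v j * v k ≤
      ∑' k, ∑' j, (W k j * (v k * v k) + W k j * (v j * v j)) * 2⁻¹ := by
    have h4 := (h1.add h2).mul_right (2⁻¹ : ℝ)
    have := (hB.summable_form v v).tsum_le_tsum (fun p => ?_) h4
    · rwa [(hB.summable_form v v).tsum_prod, h4.tsum_prod] at this
    · nlinarith [mul_nonneg (hB.nonneg p.1 p.2) (sq_nonneg (v p.1 - v p.2))]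
  refine h3.trans (le_of_eq ?_)
  have h5 : ∑' k, ∑' j, (W k j * (v k * v k) + W k j * (v j * v j)) * 2⁻¹ =
      ∑' k, (∑' j, W k j * (v k * v k) + ∑' j, W k j * (v j * v j)) * 2⁻¹ :=
    tsum_congr fun k => by
      rw [tsum_mul_right, (h1.prod_factor k).tsum_add (h2.prod_factor k)]
  have h6 : ∑' k, (∑' j, W k j * (v k * v k) + ∑' j, W k j * (v j * v j)) =
      ∑' k, ∑' j, W k j * (v k * v k) + ∑' k, ∑' j, W k j * (v j * v j) :=
    h1.prod.tsum_add h2.prod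
  rw [h5, tsum_mul_right, h6, e1, hB.tsum_kernel hv]
  ring

end IsDiffusion

/-! ### Exponentials of bounded operators. -/

section ExpNorm

variable {X : Type*} [NormedAddCommGroup X] [NormedSpace ℝ X]

lemma ContinuousLinearMap.norm_pow_le_pow_norm (A : X →L[ℝ] X) (n : ℕ) : ‖A ^ n‖ ≤ ‖A‖ ^ n := by
  induction n with
  | zero =>
    rw [pow_zero, pow_zero]
    exact ContinuousLinearMap.norm_id_le
  | succ n ih =>
    rw [pow_succ, pow_succ]
    exact (norm_mul_le _ _).trans (mul_le_mul_of_nonneg_right ih (norm_nonneg _))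

lemma ContinuousLinearMap.norm_exp_le (A : X →L[ℝ] X) :
    ‖NormedSpace.exp A‖ ≤ Real.exp ‖A‖ := by
  have h1 : HasSum (fun n : ℕ => ((n.factorial : ℝ)⁻¹) • ‖A‖ ^ n) (Real.exp ‖A‖) := by
    rw [Real.exp_eq_exp_ℝ]
    exact NormedSpace.exp_series_hasSum_exp' ‖A‖
  rw [NormedSpace.exp_eq_tsum ℝ]
  refine tsum_of_norm_bounded h1 fun n => ?_
  rw [norm_smul, Real.norm_of_nonneg (by positivity), smul_eq_mul]
  exact mul_le_mul_of_nonneg_left (A.norm_pow_le_pow_norm n) (by positivity)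

lemma ContinuousLinearMap.exp_add_of_commute' [CompleteSpace X] {A C : X →L[ℝ] X} (h : Commute A C) :
    NormedSpace.exp (A + C) = NormedSpace.exp A * NormedSpace.exp C :=
  NormedSpace.exp_add_of_commute_of_mem_ball (𝕂 := ℝ) h
    ((NormedSpace.expSeries_radius_eq_top ℝ (X →L[ℝ] X)).symm ▸ edist_lt_top _ _)
    ((NormedSpace.expSeries_radius_eq_top ℝ (X →L[ℝ] X)).symm ▸ edist_lt_top _ _)

end ExpNorm

/-- A convergent function whose derivative converges has derivative tending to zero. -/
lemma eq_zero_of_tendsto_of_tendsto_deriv {f f' : ℝ → ℝ} {a c : ℝ}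
    (hf : ∀ x, HasDerivAt f (f' x) x) (ha : Tendsto f atTop (𝓝 a))
    (hc : Tendsto f' atTop (𝓝 c)) : c = 0 := by
  -- The mean value theorem on [n, n+1] gives points tending to infinity at which the derivative
  -- equals f(n+1) - f(n), and these differences tend to zero.
  have h : ∀ n : ℕ, ∃ ξ ∈ Set.Ioo (n : ℝ) (n + 1), f' ξ = f (n + 1) - f n := fun n => by
    obtain ⟨ξ, h1, h2⟩ := exists_hasDerivAt_eq_slope f f' (lt_add_one (n : ℝ))
      (fun x _ => (hf x).continuousAt.continuousWithinAt) (fun x _ => hf x)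
    exact ⟨ξ, h1, by rw [h2]; simp⟩
  choose ξ h1 h2 using h
  have hξ : Tendsto ξ atTop atTop :=
    tendsto_atTop_mono (fun n => (h1 n).1.le) tendsto_natCast_atTop_atTop
  have h3 : Tendsto (fun n : ℕ => f (n + 1) - f n) atTop (𝓝 c) := by
    simpa [Function.comp_def, h2] using hc.comp hξ
  have h4 : Tendsto (fun n : ℕ => f (n + 1) - f n) atTop (𝓝 (a - a)) :=
    (ha.comp (tendsto_natCast_atTop_atTop.atTop_add tendsto_const_nhds)).sub
      (ha.comp tendsto_natCast_atTop_atTop)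
  rw [sub_self] at h4
  exact tendsto_nhds_unique h3 h4

/-! ### The semigroup e^{-sB} and its long-time limits. -/

namespace IsDiffusion

variable {σ : Type*} {B : ℓ¹(σ, ℝ) →L[ℝ] ℓ¹(σ, ℝ)} {W : σ → σ → ℝ}


variable (B) in
/-- The semigroup `e^{-sB}`. -/
noncomputable def heat (s : ℝ) : ℓ¹(σ, ℝ) →L[ℝ] ℓ¹(σ, ℝ) := NormedSpace.exp ((-s) • B)

@[simp] lemma heat_zero : heat B 0 = 1 := by simp [heat]

lemma heat_add (s r : ℝ) : heat B (s + r) = heat B s * heat B r := by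
  unfold heat
  rw [neg_add, add_smul, ContinuousLinearMap.exp_add_of_commute']
  exact ((Commute.refl B).smul_left _).smul_right _

lemma hasDerivAt_heat (s : ℝ) : HasDerivAt (heat B) (-(B * heat B s)) s := by
  have h := (hasDerivAt_exp_smul_const' B (-s)).scomp s (hasDerivAt_neg s)
  refine (h.congr_deriv ?_)
  simp [heat]

lemma hasDerivAt_heat_apply (v : ℓ¹(σ, ℝ)) (s : ℝ) :
    HasDerivAt (fun s => heat B s v) (-(B (heat B s v))) s := by
  simpa using (hasDerivAt_heat (B := B) s).clm_apply (hasDerivAt_const s v)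

lemma continuous_heat : Continuous (heat B) :=
  continuous_iff_continuousAt.2 fun s => (hasDerivAt_heat s).continuousAt

section

variable (hB : IsDiffusion B W)

include hB

/-- Write e^{-sB} = e^{-s} e^{s(1-B)}; the second factor has norm at most e^s because 1 - B is a
contraction. -/
lemma norm_heat_le {s : ℝ} (hs : 0 ≤ s) : ‖heat B s‖ ≤ 1 := by
  have h : (-s) • B = (-s) • (1 : ℓ¹(σ, ℝ) →L[ℝ] ℓ¹(σ, ℝ)) + s • (1 - B) := by
    module
  unfold heat
  rw [h, ContinuousLinearMap.exp_add_of_commute' ((Commute.one_left _).smul_left _)]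
  have h1 : NormedSpace.exp ((-s) • (1 : ℓ¹(σ, ℝ) →L[ℝ] ℓ¹(σ, ℝ))) = Real.exp (-s) • 1 := by
    have := NormedSpace.algebraMap_exp_comm (𝔸 := ℓ¹(σ, ℝ) →L[ℝ] ℓ¹(σ, ℝ)) (-s)
    rw [Algebra.algebraMap_eq_smul_one, Algebra.algebraMap_eq_smul_one] at this
    rw [← this, Real.exp_eq_exp_ℝ]
  rw [h1, smul_mul_assoc, one_mul, norm_smul, Real.norm_of_nonneg (Real.exp_pos _).le]
  have h2 : ‖s • (1 - B)‖ ≤ s := by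
    rw [norm_smul, Real.norm_of_nonneg hs]
    exact mul_le_of_le_one_right hs hB.norm_one_sub_le
  have h3 := (ContinuousLinearMap.norm_exp_le (s • (1 - B))).trans (Real.exp_le_exp.2 h2)
  calc Real.exp (-s) * ‖NormedSpace.exp (s • (1 - B))‖ ≤ Real.exp (-s) * Real.exp s :=
        mul_le_mul_of_nonneg_left h3 (Real.exp_pos _).le
    _ = 1 := by rw [← Real.exp_add]; simp

lemma norm_heat_sub_le {s r : ℝ} (hs : 0 ≤ s) (hr : 0 ≤ r) :
    ‖heat B s - heat B r‖ ≤ 2 * |s - r| := by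
  refine (convex_Ici (0 : ℝ)).norm_image_sub_le_of_norm_hasDerivWithin_le
    (fun x _ => (hasDerivAt_heat x).hasDerivWithinAt) (fun x hx => ?_) hr hs
  rw [norm_neg]
  refine (norm_mul_le _ _).trans ?_
  nlinarith [hB.norm_le_two, hB.norm_heat_le hx, norm_nonneg B, norm_nonneg (heat B x)]

lemma norm_heat_sub_one_le {s : ℝ} (hs : 0 ≤ s) : ‖heat B s - 1‖ ≤ 2 * s := by
  simpa [abs_of_nonneg hs] using hB.norm_heat_sub_le hs le_rfl

/-- Replacing the one-period map 1 - ε²B by e^{-ε²B} will thus cost only O(ε⁴). The derivative of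
the difference is -B(e^{-xB} - 1), of norm at most 2·2x. -/
lemma norm_heat_sub_one_add_le {s : ℝ} (hs : 0 ≤ s) :
    ‖heat B s - (1 - s • B)‖ ≤ 4 * s ^ 2 := by
  have hd : ∀ x ∈ Set.Icc (0 : ℝ) s,
      HasDerivWithinAt (fun x => heat B x - (1 - x • B)) (-(B * (heat B x - 1)))
        (Set.Icc 0 s) x := fun x _ => by
    have h := (hasDerivAt_heat (B := B) x).sub
      (((hasDerivAt_id x).smul_const B).const_sub (1 : ℓ¹(σ, ℝ) →L[ℝ] ℓ¹(σ, ℝ)))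
    refine (h.congr_deriv ?_).hasDerivWithinAt
    rw [mul_sub, mul_one, one_smul]
    abel
  have := norm_image_sub_le_of_norm_deriv_le_segment' hd (C := 4 * s) (fun x hx => ?_) s ⟨hs, le_rfl⟩
  · simp only [heat_zero, zero_smul, sub_zero, sub_self] at this
    linarith
  · rw [norm_neg]
    refine (norm_mul_le _ _).trans ?_
    have h1 := hB.norm_heat_sub_one_le hx.1
    have h2 := hx.2
    nlinarith [hB.norm_le_two, norm_nonneg B, norm_nonneg (heat B x - 1)]

lemma sum_heat (v : ℓ¹(σ, ℝ)) (s : ℝ) : ∑' k, heat B s v k = ∑' k, v k := by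
  have hd : ∀ x, HasDerivAt (fun x => ellOneSum σ (heat B x v)) 0 x := fun x => by
    refine ((ellOneSum σ).hasFDerivAt.comp_hasDerivAt x (hasDerivAt_heat_apply v x)).congr_deriv ?_
    rw [map_neg, ← ContinuousLinearMap.comp_apply, hB.sum_comp]
    simp
  have := is_const_of_deriv_eq_zero (fun x => (hd x).differentiableAt) (fun x => (hd x).deriv) s 0
  simpa using this

/-- Since B is symmetric, ⟨e^{-xB}v, e^{-(s+r-x)B}v⟩ does not depend on x; compare x = s with the
midpoint. -/
lemma inner_heat (v : ℓ¹(σ, ℝ)) (s r : ℝ) :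
    inner ℝ (ellOneTwo σ (heat B s v)) (ellOneTwo σ (heat B r v)) =
      inner ℝ (ellOneTwo σ (heat B ((s + r) / 2) v)) (ellOneTwo σ (heat B ((s + r) / 2) v)) := by
  let f : ℝ → ℝ := fun x =>
    inner ℝ (ellOneTwo σ (heat B x v)) (ellOneTwo σ (heat B (s + r - x) v))
  have hd : ∀ x, HasDerivAt f 0 x := fun x => by
    have h1 := (ellOneTwo σ).hasFDerivAt.comp_hasDerivAt x (hasDerivAt_heat_apply (B := B) v x)
    have h2 := (ellOneTwo σ).hasFDerivAt.comp_hasDerivAt (s + r - x)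
      (hasDerivAt_heat_apply (B := B) v (s + r - x))
    have h3 := h2.scomp x ((hasDerivAt_id x).const_sub (s + r))
    refine (h1.inner ℝ h3).congr_deriv ?_
    simp only [Function.comp_def, map_neg, neg_smul, one_smul, neg_neg, inner_neg_left]
    rw [hB.inner_symm, add_neg_cancel]
  have h := is_const_of_deriv_eq_zero (fun x => (hd x).differentiableAt) (fun x => (hd x).deriv)
    s ((s + r) / 2)
  have e1 : s + r - s = r := by ring
  have e2 : s + r - (s + r) / 2 = (s + r) / 2 := by ring
  simpa only [f, e1, e2] using h

lemma antitone_heat_norm_sq (v : ℓ¹(σ, ℝ)) :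
    Antitone fun s => ‖ellOneTwo σ (heat B s v)‖ ^ 2 := by
  have hd : ∀ x, HasDerivAt (fun s => ‖ellOneTwo σ (heat B s v)‖ ^ 2)
      (2 * -inner ℝ (ellOneTwo σ (B (heat B x v))) (ellOneTwo σ (heat B x v))) x := fun x => by
    have h1 := (ellOneTwo σ).hasFDerivAt.comp_hasDerivAt x (hasDerivAt_heat_apply (B := B) v x)
    refine h1.norm_sq.congr_deriv ?_
    simp only [Function.comp_def, map_neg, inner_neg_right]
    rw [real_inner_comm]
  refine antitone_of_deriv_nonpos (fun x => (hd x).differentiableAt) fun x => ?_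
  rw [(hd x).deriv]
  linarith [hB.inner_nonneg (heat B x v)]

/-- The function f(s) = ‖e^{-sB}v‖² decreases to a limit, and `inner_heat` expresses the distance of
two points of the orbit by three values of f. This replaces the spectral theorem. -/
lemma exists_tendsto_heat (v : ℓ¹(σ, ℝ)) :
    ∃ y : ℓ²(σ, ℝ), Tendsto (fun s => ellOneTwo σ (heat B s v)) atTop (𝓝 y) := by
  obtain ⟨c, hc⟩ : ∃ c, Tendsto (fun s => ‖ellOneTwo σ (heat B s v)‖ ^ 2) atTop (𝓝 c) :=
    ⟨_, tendsto_atTop_ciInf (hB.antitone_heat_norm_sq v)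
      ⟨0, by rintro _ ⟨s, rfl⟩; exact sq_nonneg _⟩⟩
  refine cauchy_map_iff_exists_tendsto.1 ?_
  refine Metric.cauchy_iff.2 ⟨inferInstance, fun δ hδ => ?_⟩
  -- The squared distance is f(s) + f(r) - 2f((s+r)/2); if the three values are within δ²/8 of the
  -- limit, it is below δ²/2.
  have hδ2 : 0 < δ ^ 2 / 8 := by positivity
  obtain ⟨s₀, hs₀⟩ := eventually_atTop.1 (hc.eventually (Metric.ball_mem_nhds c hδ2))
  refine ⟨_, image_mem_map (Ici_mem_atTop s₀), ?_⟩
  rintro _ ⟨s, hs, rfl⟩ _ ⟨r, hr, rfl⟩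
  rw [dist_eq_norm]
  refine lt_of_pow_lt_pow_left₀ 2 hδ.le ?_
  rw [@norm_sub_sq_real, hB.inner_heat v s r, real_inner_self_eq_norm_sq]
  simp only [Set.mem_Ici] at hs hr
  have h1 := hs₀ s hs
  have h2 := hs₀ r hr
  have h3 := hs₀ ((s + r) / 2) (by linarith)
  simp only [Real.dist_eq, abs_lt] at h1 h2 h3
  linarith [h1.1, h1.2, h2.1, h2.2, h3.1, h3.2]

/-- Each coordinate converges, and so does its derivative (Wx)_k - x_k; the limit of the derivative
must vanish. -/
lemma stationary_of_tendsto_heat {v : ℓ¹(σ, ℝ)} {y : ℓ²(σ, ℝ)}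
    (h : Tendsto (fun s => ellOneTwo σ (heat B s v)) atTop (𝓝 y)) (k : σ) :
    HasSum (fun j => W k j * y j) (y k) := by
  -- The orbit converges only in ℓ², so the k-th row of W is needed as a continuous functional
  -- there; it is summable, hence in ℓ².
  let row : ℓ¹(σ, ℝ) := ⟨fun j => W k j, memℓp_gen' (C := 1) fun s => by
    have e : ∀ j, ‖W k j‖ = W k j := fun j => Real.norm_of_nonneg (hB.nonneg k j)
    simp only [ENNReal.toReal_one, Real.rpow_one, e]
    exact sum_le_hasSum s (fun j _ => hB.nonneg k j) (hB.hasSum_row k)⟩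
  have hrow : ∀ z : ℓ²(σ, ℝ), HasSum (fun j => W k j * z j) (inner ℝ (ellOneTwo σ row) z) :=
    fun z => by simpa [row, mul_comm] using lp.hasSum_inner (𝕜 := ℝ) (ellOneTwo σ row) z
  have hk : Tendsto (fun s => heat B s v k) atTop (𝓝 (y k)) :=
    ((lp.evalCLM ℝ (fun _ : σ => ℝ) 2 k).continuous.tendsto y).comp h
  have hd : ∀ s, HasDerivAt (fun s => heat B s v k)
      (inner ℝ (ellOneTwo σ row) (ellOneTwo σ (heat B s v)) - heat B s v k) s := fun s => by
    refine ((lp.evalCLM ℝ (fun _ : σ => ℝ) 1 k).hasFDerivAt.comp_hasDerivAt s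
      (hasDerivAt_heat_apply v s)).congr_deriv ?_
    have : (lp.evalCLM ℝ (fun _ : σ => ℝ) 1 k) (-(B (heat B s v))) = -(B (heat B s v) k) := rfl
    rw [this, hB.apply, ← (hrow _).tsum_eq]
    simp
  have h0 := eq_zero_of_tendsto_of_tendsto_deriv hd hk
    ((tendsto_const_nhds.inner h).sub hk)
  have := hrow y
  rwa [sub_eq_zero.1 h0] at this

/-- Maximum principle: where the maximum is attained, y is a weighted mean of values that are no
larger, so all neighbours attain it too. By irreducibility the set of maximizers is everything. -/
lemma eq_of_forall_le {y : σ → ℝ} (hy : ∀ k, HasSum (fun j => W k j * y j) (y k))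
    (hirr : ∀ A : Set σ, A.Nonempty → Aᶜ.Nonempty → ∃ k ∈ A, ∃ j ∉ A, W k j ≠ 0)
    {k₀ : σ} (hk₀ : ∀ k, y k ≤ y k₀) (k : σ) : y k = y k₀ := by
  by_contra hne
  obtain ⟨i, hi, j, hj, hW⟩ := hirr {k | y k = y k₀} ⟨k₀, rfl⟩ ⟨k, hne⟩
  have h1 : HasSum (fun j => W i j * (y k₀ - y j)) 0 := by
    have := ((hB.hasSum_row i).mul_right (y k₀)).sub (hy i)
    rw [show y i = y k₀ from hi] at this
    simpa [mul_sub] using this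
  have h2 := (hasSum_zero_iff_of_nonneg fun j =>
    mul_nonneg (hB.nonneg i j) (sub_nonneg.2 (hk₀ j))).1 h1
  have h3 := congrFun h2 j
  simp only [Pi.zero_apply, mul_eq_zero, hW, false_or, sub_eq_zero] at h3
  exact hj h3.symm

/-- An element of ℓ² tends to zero at infinity, so a positive supremum would be attained and y would
be a positive constant, which is impossible on an infinite set. The same applies to -y. -/
lemma eq_zero_of_stationary_of_infinite [Infinite σ] {y : ℓ²(σ, ℝ)}
    (hy : ∀ k, HasSum (fun j => W k j * y j) (y k))
    (hirr : ∀ A : Set σ, A.Nonempty → Aᶜ.Nonempty → ∃ k ∈ A, ∃ j ∉ A, W k j ≠ 0) : y = 0 := by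
  have hlim : Tendsto (fun k => y k) cofinite (𝓝 0) := by
    have hs : Summable fun k => y k * y k := by
      simpa [sq] using lp.summable_inner (𝕜 := ℝ) y y
    have := hs.tendsto_cofinite_zero.sqrt
    simp only [Real.sqrt_mul_self_eq_abs, Real.sqrt_zero] at this
    exact (tendsto_zero_iff_abs_tendsto_zero _).2 this
  have key : ∀ z : σ → ℝ, (∀ k, HasSum (fun j => W k j * z j) (z k)) →
      Tendsto z cofinite (𝓝 0) → ∀ k, z k ≤ 0 := by
    intro z hz hlim k
    by_contra! hk
    -- Only finitely many entries reach the positive value z k, so the maximum over them is the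
    -- global one.
    have hfin : {j | ¬ z j < z k}.Finite := hlim.eventually (gt_mem_nhds hk)
    obtain ⟨k₀, hk₀, hmax⟩ := hfin.exists_maximalFor z _ ⟨k, lt_irrefl _⟩
    have hall : ∀ j, z j ≤ z k₀ := fun j => by
      by_cases hj : z j < z k
      · exact hj.le.trans (not_lt.1 hk₀)
      · by_contra! h
        exact absurd (hmax hj h.le) (not_le.2 h)
    have hconst := hB.eq_of_forall_le hz hirr hall
    have : Tendsto z cofinite (𝓝 (z k₀)) := by
      rw [show z = fun _ => z k₀ from funext hconst]; exact tendsto_const_nhds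
    have h0 := tendsto_nhds_unique this hlim
    linarith [hall k]
  ext k
  refine le_antisymm (key y hy hlim k) ?_
  have := key (fun j => -y j) (fun k => by simpa using (hy k).neg) (by simpa using hlim.neg) k
  simpa using this

theorem tendsto_heat_of_infinite [Infinite σ]
    (hirr : ∀ A : Set σ, A.Nonempty → Aᶜ.Nonempty → ∃ k ∈ A, ∃ j ∉ A, W k j ≠ 0)
    (v : ℓ¹(σ, ℝ)) : Tendsto (fun s => ellOneTwo σ (heat B s v)) atTop (𝓝 0) := by
  obtain ⟨y, hy⟩ := hB.exists_tendsto_heat v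
  rwa [hB.eq_zero_of_stationary_of_infinite (hB.stationary_of_tendsto_heat hy) hirr] at hy

/-- The limit is a constant by the maximum principle, and the preserved sum determines it. -/
theorem tendsto_heat_of_finite [Finite σ]
    (hirr : ∀ A : Set σ, A.Nonempty → Aᶜ.Nonempty → ∃ k ∈ A, ∃ j ∉ A, W k j ≠ 0)
    (v : ℓ¹(σ, ℝ)) (k : σ) :
    Tendsto (fun s => heat B s v k) atTop (𝓝 ((∑' j, v j) / Nat.card σ)) := by
  cases nonempty_fintype σ
  have : Nonempty σ := ⟨k⟩
  obtain ⟨y, hy⟩ := hB.exists_tendsto_heat v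
  have hk : ∀ k, Tendsto (fun s => heat B s v k) atTop (𝓝 (y k)) := fun k =>
    ((lp.evalCLM ℝ (fun _ : σ => ℝ) 2 k).continuous.tendsto y).comp hy
  obtain ⟨k₀, hk₀⟩ := Finite.exists_max fun k => y k
  have hconst := hB.eq_of_forall_le (hB.stationary_of_tendsto_heat hy) hirr hk₀
  have hsum : Tendsto (fun s => ∑ k, heat B s v k) atTop (𝓝 (∑ k, y k)) :=
    tendsto_finsetSum _ fun k _ => hk k
  have h1 : ∀ s, ∑ k, heat B s v k = ∑' j, v j := fun s => by
    rw [← hB.sum_heat v s, tsum_fintype]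
  simp only [h1] at hsum
  have h2 := tendsto_nhds_unique hsum tendsto_const_nhds
  simp only [hconst, Finset.sum_const, Finset.card_univ, nsmul_eq_mul] at h2
  have hc : (Fintype.card σ : ℝ) ≠ 0 := by exact_mod_cast Fintype.card_ne_zero
  have h3 : (∑' j, v j) / Nat.card σ = y k := by
    rw [hconst k, Nat.card_eq_fintype_card, ← h2]; field_simp
  rw [h3]
  exact hk k

end

end IsDiffusion

lemma norm_fourierHat_neg (g : ℝ → ℝ) (ξ : ℝ) : ‖fourierHat g (-ξ)‖ = ‖fourierHat g ξ‖ := by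
  have h : fourierHat g (-ξ) = starRingEnd ℂ (fourierHat g ξ) := by
    unfold fourierHat
    rw [← integral_conj]
    refine integral_congr_ae (Eventually.of_forall fun t => ?_)
    simp [← Complex.exp_conj]
  rw [h, RCLike.norm_conj]

/-! ### The power transmission matrix as a diffusion, and the powers of a state. -/

namespace DefectSystem

variable {ι H : Type*} [NormedAddCommGroup H] [InnerProductSpace ℂ H] [CompleteSpace H]
  (sys : DefectSystem ι H)

lemma rate_symm (k j : ι) : sys.rate k j = sys.rate j k := by
  unfold rate
  rw [sys.norm_α_symm, ← norm_fourierHat_neg, neg_neg, neg_sub]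

lemma b_symm (k j : ι) : sys.b k j = sys.b j k := by
  unfold b
  by_cases h : j = k
  · subst h; rfl
  · rw [if_neg h, if_neg (Ne.symm h), sys.rate_symm]

lemma abs_b_le_two {S : Set ι} (k j : S) : |sys.b k j| ≤ 2 := by
  simpa using sys.sum_abs_b_le S j {k}

/-- The diagonal entry is a sum of rates along a row; as the rates are symmetric, it also balances
the column. -/
lemma hasSum_b_col (j : ι) : HasSum (fun k => sys.b k j) 0 := by
  classical
  have hs : Summable fun l => if l = j then 0 else sys.rate j l := by
    refine (sys.hasRateCol j).1.of_nonneg_of_le (fun l => ?_) fun l => ?_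
    · split_ifs
      · exact le_rfl
      · exact sys.rate_nonneg _ _
    · split_ifs
      · exact sys.rate_nonneg _ _
      · exact (sys.rate_symm _ _).le
  have h1 : HasSum (fun k => if k = j then sys.b j j else 0) (sys.b j j) := hasSum_ite_eq _ _
  have hb : sys.b j j = ∑' l, if l = j then 0 else sys.rate j l := by
    unfold b; rw [if_pos rfl]
  have h2 := h1.sub hs.hasSum
  rw [← hb, sub_self] at h2
  refine h2.congr_fun fun k => ?_
  by_cases h : k = j
  · subst h; simp
  · simp only [h, if_false]
    unfold b
    rw [if_neg (Ne.symm h), sys.rate_symm]; ring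

open Classical in
/-- The doubly stochastic matrix `1 - B` on the subsystem `S`. -/
noncomputable def W (S : Set ι) (k j : S) : ℝ := (if k = j then 1 else 0) - sys.b k j

lemma isDiffusion {S : Set ι} (hS : sys.IsIrreducibleSubsystem S) :
    IsDiffusion (sys.B S) (sys.W S) where
  nonneg k j := by
    classical
    unfold W
    by_cases h : k = j
    · subst h
      -- The off-diagonal rates of a row sum to at most ‖βψ_k‖² ≤ 1, so the diagonal of W is
      -- nonnegative.
      have := (sys.hasDiag (k : ι)).2
      simp only [if_true]
      unfold b
      simp only [if_true]
      linarith
    · have h' : (j : ι) ≠ k := fun e => h (Subtype.ext e.symm)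
      rw [if_neg h]
      unfold b
      rw [if_neg h']
      linarith [sys.rate_nonneg k j]
  symm k j := by
    unfold W
    rw [sys.b_symm]
    by_cases h : k = j
    · rw [h]
    · rw [if_neg h, if_neg (Ne.symm h)]
  hasSum j := by
    classical
    have h1 : HasSum (fun k : S => sys.b k j) 0 := by
      -- By symmetry the columns of S also vanish outside S, so their sums over S are those over all
      -- modes.
      refine (hasSum_subtype_iff_of_support_subset (f := fun k => sys.b k j) fun k hk => ?_).2
        (sys.hasSum_b_col j)
      by_contra hkS
      exact hk ((sys.b_symm k j).trans (hS.2.1 j j.2 k hkS))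
    have h2 : HasSum (fun k : S => if k = j then (1 : ℝ) else 0) 1 := hasSum_ite_eq _ _
    simpa [W] using h2.sub h1
  apply v k := by
    classical
    rw [sys.B_apply]
    have h1 : HasSum (fun j : S => (if k = j then (1 : ℝ) else 0) * v j) (v k) := by
      convert! hasSum_ite_eq k (v k) using 2 with j
      by_cases h : k = j
      · subst h; simp
      · simp [h, Ne.symm h]
    have h2 : Summable fun j : S => sys.b k j * v j := by
      refine Summable.of_norm_bounded ((ellOne_summable_abs v).mul_left 2) fun j => ?_
      rw [norm_mul]
      exact mul_le_mul_of_nonneg_right (sys.abs_b_le_two k j) (abs_nonneg _)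
    have h3 := h1.sub h2.hasSum
    have h4 : ∑' j, sys.W S k j * v j = v k - ∑' j : S, sys.b k j * v j := by
      rw [← h3.tsum_eq]
      exact tsum_congr fun j => by unfold W; rw [sub_mul]
    rw [h4]; ring

lemma irreducible_W {S : Set ι} (hS : sys.IsIrreducibleSubsystem S) (A : Set S)
    (hA : A.Nonempty) (hAc : Aᶜ.Nonempty) : ∃ k ∈ A, ∃ j ∉ A, sys.W S k j ≠ 0 := by
  obtain ⟨a, ha⟩ := hA
  obtain ⟨c, hc⟩ := hAc
  obtain ⟨k, ⟨k', hk, rfl⟩, j, ⟨hjS, hjA⟩, h⟩ := hS.2.2 (Subtype.val '' A)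
    (by rintro _ ⟨x, -, rfl⟩; exact x.2) ⟨a, a, ha, rfl⟩
    ⟨c, c.2, by rintro ⟨x, hx, e⟩; exact hc (Subtype.ext e ▸ hx)⟩
  have hj : (⟨j, hjS⟩ : S) ∉ A := fun h => hjA ⟨_, h, rfl⟩
  refine ⟨k', hk, ⟨j, hjS⟩, hj, ?_⟩
  have hne : k' ≠ ⟨j, hjS⟩ := fun e => hj (e ▸ hk)
  simpa [W, hne] using h

lemma sum_norm_inner_mul_le (x y : H) (s : Finset ι) :
    ∑ k ∈ s, ‖inner ℂ (sys.ψ k) x‖ * ‖inner ℂ (sys.ψ k) y‖ ≤ ‖x‖ * ‖y‖ := by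
  refine (Real.sum_mul_le_sqrt_mul_sqrt s _ _).trans ?_
  refine mul_le_mul ?_ ?_ (Real.sqrt_nonneg _) (norm_nonneg _)
  · exact Real.sqrt_le_left (norm_nonneg _) |>.2 (sys.ψ.orthonormal.sum_inner_products_le x)
  · exact Real.sqrt_le_left (norm_nonneg _) |>.2 (sys.ψ.orthonormal.sum_inner_products_le y)

/-- The powers of the state `x` in the modes of `S`. -/
noncomputable def powerAt (S : Set ι) (x : H) : ℓ¹(S, ℝ) :=
  ⟨fun k : S => ‖inner ℂ (sys.ψ k) x‖ ^ 2, memℓp_gen' (C := ‖x‖ ^ 2) fun s => by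
    have := sys.ψ.orthonormal.sum_inner_products_le x
      (s := s.map (Function.Embedding.subtype _))
    simpa using this⟩

@[simp] lemma powerAt_apply (S : Set ι) (x : H) (k : S) :
    sys.powerAt S x k = ‖inner ℂ (sys.ψ k) x‖ ^ 2 := rfl

lemma norm_powerAt_le (S : Set ι) (x : H) : ‖sys.powerAt S x‖ ≤ ‖x‖ ^ 2 :=
  ellOne_norm_le (sq_nonneg _) fun s => by
    have := sys.ψ.orthonormal.sum_inner_products_le x
      (s := s.map (Function.Embedding.subtype _))
    simpa using this

/-- Factor |a|² - |b|² coordinatewise and apply Cauchy–Schwarz. An error in the state thus gets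
multiplied by the size of the states, which later yields the order ε²·|ε|. -/
lemma norm_powerAt_sub_le (S : Set ι) (x y : H) :
    ‖sys.powerAt S x - sys.powerAt S y‖ ≤ ‖x - y‖ * (‖x‖ + ‖y‖) := by
  refine ellOne_norm_le (by positivity) fun s => ?_
  have h : ∀ k : S, |(sys.powerAt S x - sys.powerAt S y) k| ≤
      ‖inner ℂ (sys.ψ k) (x - y)‖ * ‖inner ℂ (sys.ψ k) x‖ +
      ‖inner ℂ (sys.ψ k) (x - y)‖ * ‖inner ℂ (sys.ψ k) y‖ := fun k => by
    have e : (sys.powerAt S x - sys.powerAt S y) k =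
        (‖inner ℂ (sys.ψ k) x‖ - ‖inner ℂ (sys.ψ k) y‖) *
          (‖inner ℂ (sys.ψ k) x‖ + ‖inner ℂ (sys.ψ k) y‖) := by
      have : (sys.powerAt S x - sys.powerAt S y) k =
        ‖inner ℂ (sys.ψ k) x‖ ^ 2 - ‖inner ℂ (sys.ψ k) y‖ ^ 2 := rfl
      rw [this]; ring
    rw [e, abs_mul, abs_of_nonneg (a := _ + _) (by positivity), ← mul_add, inner_sub_right]
    exact mul_le_mul_of_nonneg_right (abs_norm_sub_norm_le _ _) (by positivity)
  refine (Finset.sum_le_sum fun k _ => h k).trans ?_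
  rw [Finset.sum_add_distrib, mul_add]
  have h1 := sys.sum_norm_inner_mul_le (x - y) x (s.map (Function.Embedding.subtype _))
  have h2 := sys.sum_norm_inner_mul_le (x - y) y (s.map (Function.Embedding.subtype _))
  simp only [Finset.sum_map, Function.Embedding.subtype_apply] at h1 h2
  exact add_le_add h1 h2

lemma continuous_powerAt (S : Set ι) : Continuous (sys.powerAt S) := by
  refine continuous_iff_continuousAt.2 fun y => ?_
  refine tendsto_iff_norm_sub_tendsto_zero.2 ?_
  refine squeeze_zero (fun _ => norm_nonneg _) (fun x => sys.norm_powerAt_sub_le S x y) ?_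
  have : Continuous fun x : H => ‖x - y‖ * (‖x‖ + ‖y‖) := by fun_prop
  simpa using this.tendsto y

variable {Ω : Type*} [MeasurableSpace Ω] {μ : Measure Ω}

lemma integrable_powerAt {X : Ω → H} (hX : MemLp X 2 μ) (S : Set ι) :
    Integrable (fun ω => sys.powerAt S (X ω)) μ := by
  have hX2 : Integrable (fun ω => ‖X ω‖ ^ 2) μ := hX.integrable_norm_pow (by norm_num)
  refine hX2.mono' ((sys.continuous_powerAt S).comp_aestronglyMeasurable hX.1) ?_
  exact Eventually.of_forall fun ω => sys.norm_powerAt_le S _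

/-- As a Bochner integral in ℓ¹ the vector of expected powers can be estimated and split pointwise
in ω. -/
lemma powerVec_eq_integral {X : Ω → H} (hX : MemLp X 2 μ) (S : Set ι) :
    sys.powerVec μ X S = ∫ ω, sys.powerAt S (X ω) ∂μ := by
  ext k
  rw [sys.powerVec_apply μ hX]
  exact ((lp.evalCLM ℝ (fun _ : S => ℝ) 1 k).integral_comp_comm (sys.integrable_powerAt hX S))

end DefectSystem

/-! ### Unitary operators that are diagonal in a Hilbert basis. -/

section Diagonal

variable {ι H : Type*} [NormedAddCommGroup H] [InnerProductSpace ℂ H]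

lemma HilbertBasis.ext_inner (b : HilbertBasis ι ℂ H) {x y : H}
    (h : ∀ k, inner ℂ (b k) x = inner ℂ (b k) y) : x = y := by
  refine b.repr.injective ?_
  ext k
  rw [b.repr_apply_apply, b.repr_apply_apply, h]

lemma HilbertBasis.hasSum_norm_sq (b : HilbertBasis ι ℂ H) (x : H) :
    HasSum (fun k => ‖inner ℂ (b k) x‖ ^ 2) (‖x‖ ^ 2) := by
  have h := (b.hasSum_inner_mul_inner x x).mapL Complex.reCLM
  have e : Complex.reCLM (inner ℂ x x) = ‖x‖ ^ 2 := by
    rw [inner_self_eq_norm_sq_to_K]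
    simp [← Complex.ofReal_pow]
  rw [e] at h
  refine h.congr_fun fun k => ?_
  rw [← inner_conj_symm x (b k), ← Complex.normSq_eq_conj_mul_self, Complex.normSq_eq_norm_sq]
  simp [-Complex.ofReal_pow]

lemma HilbertBasis.orthonormal_smul (b : HilbertBasis ι ℂ H) {c : ι → ℂ} (hc : ∀ k, ‖c k‖ = 1) :
    Orthonormal ℂ fun k => c k • b k := by
  refine ⟨fun k => by rw [norm_smul, hc, one_mul, b.orthonormal.1 k], fun j k hjk => ?_⟩
  change inner ℂ (c j • b j) (c k • b k) = 0
  rw [inner_smul_left, inner_smul_right, b.orthonormal.2 hjk]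
  simp

lemma HilbertBasis.dense_smul (b : HilbertBasis ι ℂ H) {c : ι → ℂ} (hc : ∀ k, ‖c k‖ = 1) :
    ⊤ ≤ (Submodule.span ℂ (Set.range fun k => c k • b k)).topologicalClosure := by
  rw [← b.dense_span]
  refine Submodule.topologicalClosure_mono (Submodule.span_le.2 ?_)
  rintro _ ⟨k, rfl⟩
  have h0 : c k ≠ 0 := fun h => by simpa [h] using hc k
  have : b k = (c k)⁻¹ • (c k • b k) := by rw [smul_smul, inv_mul_cancel₀ h0, one_smul]
  rw [this]
  exact Submodule.smul_mem _ _ (Submodule.subset_span ⟨k, rfl⟩)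

variable [CompleteSpace H]

/-- The unitary operator that multiplies the `k`-th coordinate by the phase `c k`. -/
noncomputable def HilbertBasis.diagonal (b : HilbertBasis ι ℂ H) (c : ι → ℂ)
    (hc : ∀ k, ‖c k‖ = 1) : H ≃ₗᵢ[ℂ] H :=
  b.repr.trans (HilbertBasis.mk (b.orthonormal_smul hc) (b.dense_smul hc)).repr.symm

lemma HilbertBasis.inner_diagonal (b : HilbertBasis ι ℂ H) {c : ι → ℂ}
    (hc : ∀ k, ‖c k‖ = 1) (x : H) (k : ι) :
    inner ℂ (b k) (b.diagonal c hc x) = c k * inner ℂ (b k) x := by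
  have h : (HilbertBasis.mk (b.orthonormal_smul hc) (b.dense_smul hc)).repr
      (b.diagonal c hc x) = b.repr x := by
    simp [diagonal]
  have h2 := congrArg (fun v : ℓ²(ι, ℂ) => v k) h
  simp only [HilbertBasis.repr_apply_apply, HilbertBasis.coe_mk, inner_smul_left] at h2
  rw [← h2, ← mul_assoc, Complex.mul_conj, Complex.normSq_eq_norm_sq, hc]
  simp

end Diagonal

/-! ### The free evolution and the interaction picture. -/

namespace DefectSystem

variable {ι H : Type*} [NormedAddCommGroup H] [InnerProductSpace ℂ H] [CompleteSpace H]
  (sys : DefectSystem ι H)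

/-- The unitary group `e^{isH₀}`. -/
noncomputable def V (s : ℝ) : H ≃ₗᵢ[ℂ] H :=
  sys.ψ.diagonal (fun k => Complex.exp (Complex.I * (sys.lam k * s : ℝ))) fun k => by
    rw [mul_comm]; exact Complex.norm_exp_ofReal_mul_I _

lemma inner_V (s : ℝ) (x : H) (k : ι) : inner ℂ (sys.ψ k) (sys.V s x) =
    Complex.exp (Complex.I * (sys.lam k * s : ℝ)) * inner ℂ (sys.ψ k) x :=
  sys.ψ.inner_diagonal _ x k

lemma norm_inner_V (s : ℝ) (x : H) (k : ι) :
    ‖inner ℂ (sys.ψ k) (sys.V s x)‖ = ‖inner ℂ (sys.ψ k) x‖ := by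
  rw [inner_V, norm_mul, mul_comm Complex.I, Complex.norm_exp_ofReal_mul_I, one_mul]

lemma V_add (s r : ℝ) (x : H) : sys.V (s + r) x = sys.V s (sys.V r x) :=
  sys.ψ.ext_inner fun k => by
    simp only [inner_V]
    rw [← mul_assoc, ← Complex.exp_add]
    congr 2
    push_cast
    ring

@[simp] lemma V_zero (x : H) : sys.V 0 x = x :=
  sys.ψ.ext_inner fun k => by simp [inner_V]

@[simp] lemma V_neg_V (s : ℝ) (x : H) : sys.V (-s) (sys.V s x) = x := by
  rw [← V_add, neg_add_cancel, V_zero]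

@[simp] lemma V_V_neg (s : ℝ) (x : H) : sys.V s (sys.V (-s) x) = x := by
  rw [← V_add, add_neg_cancel, V_zero]

lemma powerAt_V (S : Set ι) (s : ℝ) (x : H) : sys.powerAt S (sys.V s x) = sys.powerAt S x := by
  ext k
  simp [norm_inner_V]

lemma V_ψ (s : ℝ) (k : ι) :
    sys.V s (sys.ψ k) = Complex.exp (Complex.I * (sys.lam k * s : ℝ)) • sys.ψ k := by
  classical
  refine sys.ψ.ext_inner fun j => ?_
  rw [inner_V, inner_smul_right, orthonormal_iff_ite.1 sys.ψ.orthonormal]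
  by_cases h : j = k
  · subst h; rfl
  · simp [h]

/-- For a finite combination of eigenvectors the orbit is a trigonometric sum; a general orbit is a
uniform limit of such orbits, as the group is isometric. -/
lemma continuous_V_apply (x : H) : Continuous fun s => sys.V s x := by
  refine continuous_of_uniform_approx_of_continuous fun u hu => ?_
  obtain ⟨δ, hδ, hu⟩ := Metric.mem_uniformity_dist.1 hu
  obtain ⟨F, hF⟩ := ((sys.ψ.hasSum_repr x).eventually (Metric.ball_mem_nhds x hδ)).exists
  refine ⟨fun s => sys.V s (∑ k ∈ F, sys.ψ.repr x k • sys.ψ k), ?_, fun s => hu ?_⟩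
  · simp only [map_sum, map_smul, V_ψ]
    fun_prop
  · rw [(sys.V s).dist_map, dist_comm]
    exact hF

lemma continuous_V : Continuous fun p : ℝ × H => sys.V p.1 p.2 := by
  refine continuous_iff_continuousAt.2 fun ⟨s, x⟩ => ?_
  refine tendsto_iff_norm_sub_tendsto_zero.2 ?_
  have h : Continuous fun p : ℝ × H => ‖p.2 - x‖ + ‖sys.V p.1 x - sys.V s x‖ := by
    have := (sys.continuous_V_apply x).comp (continuous_fst (X := ℝ) (Y := H))
    simp only [Function.comp_def] at this
    fun_prop
  have h0 := h.tendsto (s, x)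
  simp only [sub_self, norm_zero, add_zero] at h0
  refine squeeze_zero (fun _ => norm_nonneg _) (fun p => ?_) h0
  refine (norm_sub_le_norm_sub_add_norm_sub _ (sys.V p.1 x) _).trans ?_
  rw [← map_sub, (sys.V p.1).norm_map]

lemma continuous_V_comp {X : Type*} [TopologicalSpace X] {f : X → ℝ} {g : X → H}
    (hf : Continuous f) (hg : Continuous g) : Continuous fun x => sys.V (f x) (g x) := by
  have h := sys.continuous_V.comp (hf.prodMk hg)
  simpa only [Function.comp_def] using h

/-- The perturbation `e^{isH₀} β e^{-isH₀}` in the interaction picture. -/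
noncomputable def A (s : ℝ) (x : H) : H := sys.V s (sys.β (sys.V (-s) x))

lemma norm_A_le (s : ℝ) (x : H) : ‖sys.A s x‖ ≤ ‖x‖ := by
  unfold A
  rw [(sys.V s).norm_map]
  have := sys.β.le_opNorm (sys.V (-s) x)
  rwa [sys.β_norm, one_mul, (sys.V (-s)).norm_map] at this

lemma A_add (s : ℝ) (x y : H) : sys.A s (x + y) = sys.A s x + sys.A s y := by
  unfold A
  rw [map_add, map_add, map_add]

lemma A_smul (s : ℝ) (c : ℂ) (x : H) : sys.A s (c • x) = c • sys.A s x := by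
  unfold A
  rw [map_smul, map_smul, map_smul]

lemma A_sub (s : ℝ) (x y : H) : sys.A s (x - y) = sys.A s x - sys.A s y := by
  unfold A
  rw [map_sub, map_sub, map_sub]

/-- Conjugation by the free group moves a defect that starts at time r to time zero. -/
lemma A_shift (s r : ℝ) (x : H) : sys.A (s + r) x = sys.V r (sys.A s (sys.V (-r) x)) := by
  unfold A
  rw [add_comm, V_add, neg_add, add_comm (-r), V_add]

lemma continuous_A : Continuous fun p : ℝ × H => sys.A p.1 p.2 := by
  have h1 : Continuous fun p : ℝ × H => sys.V (-p.1) p.2 :=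
    sys.continuous_V_comp continuous_fst.neg continuous_snd
  have h2 := sys.β.continuous.comp h1
  exact sys.continuous_V_comp continuous_fst h2

lemma continuous_A_comp {X : Type*} [TopologicalSpace X] {f : X → ℝ} {g : X → H}
    (hf : Continuous f) (hg : Continuous g) : Continuous fun x => sys.A (f x) (g x) := by
  have h := sys.continuous_A.comp (hf.prodMk hg)
  simpa only [Function.comp_def] using h

/-- This symmetry makes -i h(t) A(t)w orthogonal to w in the real sense, so norms are conserved. -/
lemma inner_A_im (s : ℝ) (x : H) : (inner ℂ x (sys.A s x)).im = 0 := by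
  have h1 : inner ℂ x (sys.A s x) = inner ℂ (sys.V (-s) x) (sys.β (sys.V (-s) x)) := by
    unfold A
    conv_lhs => rw [← sys.V_V_neg s x]
    rw [(sys.V s).inner_map_map]
    simp
  rw [h1]
  refine Complex.conj_eq_iff_im.1 ?_
  rw [inner_conj_symm]
  have := ContinuousLinearMap.adjoint_inner_right sys.β (sys.V (-s) x) (sys.V (-s) x)
  rw [sys.β_selfAdjoint.adjoint_eq] at this
  exact this.symm

end DefectSystem

/-! ### Absolutely continuous primitives and the Volterra series. -/

/-- Sums of oscillations of f are dominated by those of g. Used to pass absolute continuity from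
real primitives to vector-valued ones and to squared norms. -/
lemma AbsolutelyContinuousOnInterval.of_dist_le {X Y : Type*} [PseudoMetricSpace X]
    [PseudoMetricSpace Y] {f : ℝ → X} {g : ℝ → Y} {a b C : ℝ}
    (hg : AbsolutelyContinuousOnInterval g a b)
    (h : ∀ s ∈ Set.uIcc a b, ∀ t ∈ Set.uIcc a b, dist (f s) (f t) ≤ C * dist (g s) (g t)) :
    AbsolutelyContinuousOnInterval f a b := by
  unfold AbsolutelyContinuousOnInterval at hg ⊢
  have h0 := hg.const_mul C
  rw [mul_zero] at h0
  refine tendsto_of_tendsto_of_tendsto_of_le_of_le' tendsto_const_nhds h0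
    (Eventually.of_forall fun E => Finset.sum_nonneg fun _ _ => dist_nonneg) ?_
  refine eventually_inf_principal.2 (Eventually.of_forall fun E hE => ?_)
  rw [Finset.mul_sum]
  exact Finset.sum_le_sum fun i hi => h _ (hE.1 i hi).1 _ (hE.1 i hi).2

/-- Neumann series: the factorials make ∑(cK)ⁿ converge for every c, so no smallness of ε is needed.
-/
lemma exists_resolvent {X : Type*} [NormedAddCommGroup X] [NormedSpace ℂ X] [CompleteSpace X]
    {K : X →L[ℂ] X} (hK : ∀ n : ℕ, ‖K ^ n‖ ≤ 1 / n.factorial) (c : ℂ) :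
    ∃ R : X →L[ℂ] X, ∀ x, R x = x + c • K (R x) := by
  have hs : Summable fun n : ℕ => (c • K) ^ n := by
    refine Summable.of_norm_bounded (Real.summable_pow_div_factorial ‖c‖) fun n => ?_
    rw [smul_pow, norm_smul, norm_pow, div_eq_mul_one_div]
    exact mul_le_mul_of_nonneg_left (hK n) (by positivity)
  refine ⟨∑' n : ℕ, (c • K) ^ n, fun x => ?_⟩
  have h := DFunLike.congr_fun hs.one_sub_mul_tsum_pow x
  rw [mul_apply_eq_comp] at h
  exact sub_eq_iff_eq_add.1 h

lemma dist_primitive_le {F : Type*} [NormedAddCommGroup F] [NormedSpace ℝ F] {f : ℝ → F}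
    {a b : ℝ} (hf : IntervalIntegrable f volume a b) {s t : ℝ} (hs : s ∈ Set.uIcc a b)
    (ht : t ∈ Set.uIcc a b) : dist (∫ r in a..s, f r) (∫ r in a..t, f r) ≤
      dist (∫ r in a..s, ‖f r‖) (∫ r in a..t, ‖f r‖) := by
  have hi : ∀ s ∈ Set.uIcc a b, IntervalIntegrable f volume a s :=
    fun s hs => hf.mono_set (Set.uIcc_subset_uIcc Set.left_mem_uIcc hs)
  rw [dist_eq_norm, Real.dist_eq, intervalIntegral.integral_interval_sub_left (hi s hs) (hi t ht),
    intervalIntegral.integral_interval_sub_left (hi s hs).norm (hi t ht).norm]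
  exact intervalIntegral.norm_integral_le_abs_integral_norm

lemma IntervalIntegrable.absolutelyContinuous_primitive {F : Type*} [NormedAddCommGroup F]
    [NormedSpace ℝ F] {f : ℝ → F} {a b : ℝ} (hf : IntervalIntegrable f volume a b) :
    AbsolutelyContinuousOnInterval (fun t => ∫ r in a..t, f r) a b :=
  (hf.norm.absolutelyContinuousOnInterval_intervalIntegral
    (Set.left_mem_uIcc (a := a) (b := b))).of_dist_le (C := 1) fun s hs t ht => by
      rw [one_mul]; exact dist_primitive_le hf hs ht

/-- The product rule for a primitive and a `C¹` function. -/
lemma mul_const_add_primitive_eq {f E E' : ℝ → ℂ} {c : ℂ} {a b : ℝ} (hf : IntervalIntegrable f volume a b)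
    (hE : ∀ t, HasDerivAt E (E' t) t)
    (hE' : Continuous E') :
    E b * (c + ∫ s in a..b, f s) =
      E a * c + ∫ s in a..b, (E' s * (c + ∫ r in a..s, f r) + E s * f s) := by
  have hF := hf.absolutelyContinuous_primitive
  have hEc : Continuous E := continuous_iff_continuousAt.2 fun t => (hE t).continuousAt
  have hEAC : AbsolutelyContinuousOnInterval E a b := by
    refine ContDiffOn.absolutelyContinuousOnInterval (ContDiff.contDiffOn ?_)
    refine contDiff_one_iff_deriv.2 ⟨fun t => (hE t).differentiableAt, ?_⟩
    rwa [show deriv E = E' from funext fun t => (hE t).deriv]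
  have hc : AbsolutelyContinuousOnInterval (fun t => c + ∫ r in a..t, f r) a b :=
    hF.of_dist_le (C := 1) fun s _ t _ => by rw [dist_add_left, one_mul]
  set g : ℝ → ℂ := fun s => E' s * (c + ∫ r in a..s, f r) + E s * f s
  have hg : IntervalIntegrable g volume a b :=
    (hE'.continuousOn.mul hc.continuousOn).intervalIntegrable.add
      (hf.continuousOn_mul hEc.continuousOn)
  have hD := (hEAC.smul hc).sub hg.absolutelyContinuous_primitive
  -- The profile is merely integrable, so the product rule holds only almost everywhere; absolute
  -- continuity still makes the difference of the two sides constant.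
  obtain ⟨C, hC⟩ := hD.const_of_ae_hasDerivAt_zero (by
    filter_upwards [hf.ae_hasDerivAt_integral, hg.ae_hasDerivAt_integral] with t h1 h2 ht
    have h3 := ((hE t).mul ((h1 ht a Set.left_mem_uIcc).const_add c)).sub
      (h2 ht a Set.left_mem_uIcc)
    refine h3.congr_deriv ?_
    simp [g])
  have ha := hC a Set.left_mem_uIcc
  have hb := hC b Set.right_mem_uIcc
  rw [← ha] at hb
  simp only [Pi.sub_apply, smul_eq_mul, Pi.mul_apply, intervalIntegral.integral_same, add_zero,
    sub_zero] at hb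
  rw [← hb]; ring

/-- A primitive whose increments are orthogonal to it has constant norm. -/
lemma norm_const_add_primitive_eq {H : Type*} [NormedAddCommGroup H] [InnerProductSpace ℂ H]
    [CompleteSpace H] {f : ℝ → H} {x : H} {a b : ℝ} (hab : a ≤ b)
    (hf : IntervalIntegrable f volume a b)
    (horth : ∀ t ∈ Set.Icc a b, (inner ℂ (x + ∫ s in a..t, f s) (f t)).re = 0) :
    ‖x + ∫ s in a..b, f s‖ = ‖x‖ := by
  let : InnerProductSpace ℝ H := InnerProductSpace.complexToReal
  set w : ℝ → H := fun t => x + ∫ s in a..t, f s with hw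
  have hu : Set.uIcc a b = Set.Icc a b := Set.uIcc_of_le hab
  have hwAC : AbsolutelyContinuousOnInterval w a b :=
    hf.absolutelyContinuous_primitive.of_dist_le (C := 1) fun s _ t _ => by
      rw [dist_add_left, one_mul]
  obtain ⟨C, hC⟩ := hwAC.exists_bound
  have hN : AbsolutelyContinuousOnInterval (fun t => ‖w t‖ ^ 2) a b :=
    hwAC.of_dist_le (C := C + C) fun s hs t ht => by
      rw [Real.dist_eq, sq_sub_sq, abs_mul, abs_of_nonneg (a := _ + _) (by positivity),
        dist_eq_norm]
      exact mul_le_mul (add_le_add (hC s hs) (hC t ht)) (abs_norm_sub_norm_le _ _)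
        (abs_nonneg _) (by linarith [norm_nonneg (w s), hC s hs])
  -- The derivative of ‖w‖² is 2 Re⟨w, f⟩ almost everywhere, which vanishes by orthogonality.
  obtain ⟨c, hc⟩ := hN.const_of_ae_hasDerivAt_zero (by
    filter_upwards [hf.ae_hasDerivAt_integral] with t ht htI
    have h1 : HasDerivAt w (f t) t := (ht htI a Set.left_mem_uIcc).const_add x
    refine h1.norm_sq.congr_deriv ?_
    have h2 : inner ℝ (w t) (f t) = (inner ℂ (w t) (f t)).re := rfl
    rw [h2, horth t (hu ▸ htI), mul_zero])
  have ha := hc a Set.left_mem_uIcc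
  have hb := hc b Set.right_mem_uIcc
  have h : ‖w b‖ ^ 2 = ‖w a‖ ^ 2 := hb.trans ha.symm
  have := (pow_left_inj₀ (norm_nonneg _) (norm_nonneg _) two_ne_zero).1 h
  simpa [hw] using this

/-- Fundamental theorem for the absolutely continuous power G^{n+1} of the primitive G. This is the
source of the factor 1/n! in the iterated Volterra operator. -/
lemma integral_mul_primitive_pow {h : ℝ → ℝ} {t : ℝ} (hh : IntervalIntegrable h volume 0 t) (n : ℕ) :
    ∫ s in (0 : ℝ)..t, (∫ r in (0 : ℝ)..s, h r) ^ n * h s =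
      (∫ r in (0 : ℝ)..t, h r) ^ (n + 1) / (n + 1) := by
  set G : ℝ → ℝ := fun s => ∫ r in (0 : ℝ)..s, h r
  have hG : AbsolutelyContinuousOnInterval G 0 t :=
    hh.absolutelyContinuousOnInterval_intervalIntegral Set.left_mem_uIcc
  have hpow : ∀ n : ℕ, AbsolutelyContinuousOnInterval (fun s => G s ^ (n + 1)) 0 t := by
    intro n
    induction n with
    | zero => simpa using hG
    | succ n ih => simpa [pow_succ] using! ih.mul hG
  have h1 := (hpow n).integral_deriv_eq_sub
  have h2 : ∫ s in (0 : ℝ)..t, deriv (fun s => G s ^ (n + 1)) s =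
      ∫ s in (0 : ℝ)..t, (n + 1) * (G s ^ n * h s) := by
    refine intervalIntegral.integral_congr_ae ?_
    filter_upwards [hh.ae_hasDerivAt_integral] with s hs hsI
    have := (hs (Set.uIoc_subset_uIcc hsI) 0 Set.left_mem_uIcc).pow (n + 1)
    rw [show (fun s => G s ^ (n + 1)) = (fun x => ∫ r in (0 : ℝ)..x, h r) ^ (n + 1) from rfl,
      this.deriv]
    push_cast
    ring
  rw [h2, intervalIntegral.integral_const_mul] at h1
  have h3 : G 0 = 0 := by simp [G]
  simp only [h3, ne_eq, Nat.add_eq_zero_iff, one_ne_zero, and_false, not_false_eq_true, zero_pow,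
    sub_zero] at h1
  rw [eq_div_iff (by positivity), mul_comm]
  exact h1

/-! ### The propagator of a single defect. -/

namespace DefectSystem

variable {ι H : Type*} [NormedAddCommGroup H] [InnerProductSpace ℂ H] [CompleteSpace H]
  (sys : DefectSystem ι H)

lemma integrable_g₀ : Integrable sys.g₀ := by
  have h : Integrable fun s => |sys.g₀ s| := by
    -- The integral of a non-integrable function is 0 by convention, which the value 1 excludes.
    by_contra h
    have := sys.g₀_norm
    rw [integral_undef h] at this
    exact zero_ne_one this
  exact (integrable_norm_iff sys.g₀_memLp.1).1 h

lemma T_pos : 0 < sys.T := by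
  by_contra! h
  have h1 : ∀ᵐ s, |sys.g₀ s| = 0 := by
    have : ∀ᵐ s : ℝ, s ≠ 0 := by simp [ae_iff, measure_singleton]
    filter_upwards [this] with s hs
    rw [sys.g₀_support s fun hI => hs (le_antisymm (hI.2.trans h) hI.1), abs_zero]
  have h2 := sys.g₀_norm
  rw [integral_congr_ae h1] at h2
  simp at h2

lemma norm_smul_A_le (c : ℝ) (s : ℝ) (x : H) : ‖(c : ℂ) • sys.A s x‖ ≤ |c| * ‖x‖ := by
  rw [norm_smul, Complex.norm_real]
  exact mul_le_mul_of_nonneg_left (sys.norm_A_le s x) (norm_nonneg _)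

lemma intervalIntegrable_smul_A {h : ℝ → ℝ} {a b : ℝ} (hh : IntervalIntegrable h volume a b)
    {w : ℝ → H} (hw : Continuous w) :
    IntervalIntegrable (fun s => (h s : ℂ) • sys.A s (w s)) volume a b :=
  IntervalIntegrable.smul_continuousOn (f := fun s => (h s : ℂ))
    ⟨hh.1.ofReal, hh.2.ofReal⟩ (sys.continuous_A_comp continuous_id hw).continuousOn

lemma norm_eq_of_volterra {h : ℝ → ℝ} {a b : ℝ} (hh : IntervalIntegrable h volume a b)
    {w : ℝ → H} (hw : Continuous w) (heq : ∀ t ∈ Set.Icc a b,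
      w t = w a - Complex.I • ∫ s in a..t, (h s : ℂ) • sys.A s (w s))
    {t : ℝ} (ht : t ∈ Set.Icc a b) : ‖w t‖ = ‖w a‖ := by
  have e : ∀ t ∈ Set.Icc a b,
      w a + ∫ s in a..t, (-Complex.I) • ((h s : ℂ) • sys.A s (w s)) = w t := fun t ht => by
    rw [intervalIntegral.integral_smul, heq t ht, neg_smul, sub_eq_add_neg]
  have hsub : Set.uIcc a t ⊆ Set.uIcc a b :=
    Set.uIcc_subset_uIcc Set.left_mem_uIcc (Set.Icc_subset_uIcc ht)
  rw [← e t ht]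
  refine norm_const_add_primitive_eq ht.1
    ((sys.intervalIntegrable_smul_A (hh.mono_set hsub) hw).smul (-Complex.I)) fun s hs => ?_
  rw [e s ⟨hs.1, hs.2.trans ht.2⟩, inner_smul_right, inner_smul_right]
  simp [sys.inner_A_im]

/-- The equation is linear, so the difference of two solutions has constant norm, and this norm is
zero at the start. -/
lemma eq_of_volterra {h : ℝ → ℝ} {a b : ℝ} (hh : IntervalIntegrable h volume a b)
    {w z : ℝ → H} (hw : Continuous w) (hz : Continuous z) (h0 : w a = z a)
    (heqw : ∀ t ∈ Set.Icc a b, w t = w a - Complex.I • ∫ s in a..t, (h s : ℂ) • sys.A s (w s))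
    (heqz : ∀ t ∈ Set.Icc a b, z t = z a - Complex.I • ∫ s in a..t, (h s : ℂ) • sys.A s (z s))
    {t : ℝ} (ht : t ∈ Set.Icc a b) : w t = z t := by
  have h1 := sys.norm_eq_of_volterra hh (hw.sub hz) (fun t ht => ?_) ht
  · simp only [Pi.sub_apply] at h1
    rw [h0, sub_self, norm_zero, norm_eq_zero, sub_eq_zero] at h1
    exact h1
  · have hsub : Set.uIcc a t ⊆ Set.uIcc a b :=
      Set.uIcc_subset_uIcc Set.left_mem_uIcc (Set.Icc_subset_uIcc ht)
    simp only [Pi.sub_apply, A_sub, smul_sub]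
    rw [intervalIntegral.integral_sub (sys.intervalIntegrable_smul_A (hh.mono_set hsub) hw)
      (sys.intervalIntegrable_smul_A (hh.mono_set hsub) hz), smul_sub, heqw t ht, heqz t ht]
    abel

open scoped BoundedContinuousFunction

lemma norm_integral_smul_A_le (w : ℝ →ᵇ H) (a t : ℝ) :
    ‖∫ s in a..t, (sys.g₀ s : ℂ) • sys.A s (w s)‖ ≤ ‖w‖ := by
  refine intervalIntegral.norm_integral_le_integral_norm_uIoc.trans ?_
  have hg : Integrable fun s => |sys.g₀ s| * ‖w‖ := sys.integrable_g₀.abs.mul_const _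
  have h1 : ∫ s in Set.uIoc a t, ‖(sys.g₀ s : ℂ) • sys.A s (w s)‖ ≤
      ∫ s in Set.uIoc a t, |sys.g₀ s| * ‖w‖ := by
    refine integral_mono_of_nonneg (Eventually.of_forall fun _ => norm_nonneg _) hg.integrableOn
      (Eventually.of_forall fun s => ?_)
    exact (sys.norm_smul_A_le _ _ _).trans
      (mul_le_mul_of_nonneg_left (w.norm_coe_le_norm s) (abs_nonneg _))
  refine h1.trans ((setIntegral_le_integral hg (Eventually.of_forall fun s => by positivity)).trans
    (le_of_eq ?_))
  rw [integral_mul_const, sys.g₀_norm, one_mul]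

/-- The Volterra operator `w ↦ -i ∫₀ᵗ g₀(s) A(s) w(s) ds` of a single defect. -/
noncomputable def volterra : (ℝ →ᵇ H) →L[ℂ] (ℝ →ᵇ H) :=
  LinearMap.mkContinuous
    { toFun := fun w => BoundedContinuousFunction.ofNormedAddCommGroup
        (fun t => -Complex.I • ∫ s in (0 : ℝ)..t, (sys.g₀ s : ℂ) • sys.A s (w s))
        ((intervalIntegral.continuous_primitive (fun a b => sys.intervalIntegrable_smul_A
          sys.integrable_g₀.intervalIntegrable w.continuous) 0).const_smul _)
        ‖w‖ fun t => by
          rw [norm_smul, norm_neg, Complex.norm_I, one_mul]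
          exact sys.norm_integral_smul_A_le w 0 t
      map_add' := fun w z => by
        ext t
        simp only [BoundedContinuousFunction.coe_ofNormedAddCommGroup,
          BoundedContinuousFunction.coe_add, Pi.add_apply, A_add, smul_add]
        rw [intervalIntegral.integral_add (sys.intervalIntegrable_smul_A
            sys.integrable_g₀.intervalIntegrable w.continuous) (sys.intervalIntegrable_smul_A
            sys.integrable_g₀.intervalIntegrable z.continuous), smul_add]
      map_smul' := fun c w => by
        ext t
        simp only [BoundedContinuousFunction.coe_ofNormedAddCommGroup,
          BoundedContinuousFunction.coe_smul, A_smul, RingHom.id_apply]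
        simp only [smul_comm _ c]
        rw [intervalIntegral.integral_smul, smul_comm _ c] }
    1 fun w => by
      rw [one_mul]
      refine (BoundedContinuousFunction.norm_le (norm_nonneg _)).2 fun t => ?_
      change ‖-Complex.I • ∫ s in (0 : ℝ)..t, (sys.g₀ s : ℂ) • sys.A s (w s)‖ ≤ ‖w‖
      rw [norm_smul, norm_neg, Complex.norm_I, one_mul]
      exact sys.norm_integral_smul_A_le w 0 t

lemma volterra_apply (w : ℝ →ᵇ H) (t : ℝ) : sys.volterra w t =
    -Complex.I • ∫ s in (0 : ℝ)..t, (sys.g₀ s : ℂ) • sys.A s (w s) := rfl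

lemma norm_volterra_apply_le (w : ℝ →ᵇ H) : ‖sys.volterra w‖ ≤ ‖w‖ := by
  have := sys.volterra.le_of_opNorm_le (LinearMap.mkContinuous_norm_le _ zero_le_one _) w
  rwa [one_mul] at this

lemma g₀_eq_zero_of_neg {s : ℝ} (hs : s < 0) : sys.g₀ s = 0 :=
  sys.g₀_support s fun h => absurd h.1 (not_le.2 hs)

lemma integral_g₀_smul_of_nonpos (w : ℝ → H) {t : ℝ} (ht : t ≤ 0) :
    ∫ s in (0 : ℝ)..t, (sys.g₀ s : ℂ) • sys.A s (w s) = 0 := by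
  refine intervalIntegral.integral_zero_ae ?_
  have : ∀ᵐ s : ℝ, s ≠ 0 := by simp [ae_iff, measure_singleton]
  filter_upwards [this] with s hs hsI
  rw [Set.uIoc_of_ge ht] at hsI
  rw [sys.g₀_eq_zero_of_neg (lt_of_le_of_ne hsI.2 hs)]
  simp

/-- Induction on n: each application of the operator integrates the previous bound against |g₀|,
which turns Gⁿ/n! into the next such term for the primitive G of |g₀|. -/
lemma norm_volterra_pow_apply_le (n : ℕ) (w : ℝ →ᵇ H) (t : ℝ) (ht : 0 ≤ t) :
    ‖(sys.volterra ^ n) w t‖ ≤ (∫ r in (0 : ℝ)..t, |sys.g₀ r|) ^ n / n.factorial * ‖w‖ := by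
  induction n generalizing t with
  | zero => simpa using w.norm_coe_le_norm t
  | succ n ih =>
    have hi : ∀ a b, IntervalIntegrable (fun s => |sys.g₀ s|) volume a b := fun a b =>
      sys.integrable_g₀.abs.intervalIntegrable
    have hG : Continuous fun t => ∫ r in (0 : ℝ)..t, |sys.g₀ r| :=
      intervalIntegral.continuous_primitive hi 0
    rw [pow_succ', mul_apply_eq_comp, volterra_apply, norm_smul, norm_neg,
      Complex.norm_I, one_mul]
    have h1 : ‖∫ s in (0 : ℝ)..t, (sys.g₀ s : ℂ) • sys.A s ((sys.volterra ^ n) w s)‖ ≤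
        ∫ s in (0 : ℝ)..t, ((∫ r in (0 : ℝ)..s, |sys.g₀ r|) ^ n * |sys.g₀ s|) *
          ((n.factorial : ℝ)⁻¹ * ‖w‖) := by
      refine intervalIntegral.norm_integral_le_of_norm_le ht
        (Eventually.of_forall fun s hs => ?_) ?_
      · refine (sys.norm_smul_A_le _ _ _).trans ?_
        have := mul_le_mul_of_nonneg_left (ih s hs.1.le) (abs_nonneg (sys.g₀ s))
        refine this.trans (le_of_eq ?_)
        ring
      · exact ((hi 0 t).continuousOn_mul (hG.pow n).continuousOn).mul_const _
    refine h1.trans (le_of_eq ?_)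
    rw [intervalIntegral.integral_mul_const, integral_mul_primitive_pow (hi 0 t),
      Nat.factorial_succ]
    push_cast
    field_simp

lemma norm_volterra_pow_le (n : ℕ) : ‖sys.volterra ^ n‖ ≤ 1 / n.factorial := by
  refine ContinuousLinearMap.opNorm_le_bound _ (by positivity) fun w => ?_
  refine (BoundedContinuousFunction.norm_le (by positivity)).2 fun t => ?_
  rcases le_total 0 t with ht | ht
  · refine (sys.norm_volterra_pow_apply_le n w t ht).trans ?_
    have h0 : 0 ≤ ∫ r in (0 : ℝ)..t, |sys.g₀ r| :=
      intervalIntegral.integral_nonneg ht fun _ _ => abs_nonneg _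
    have h1 : ∫ r in (0 : ℝ)..t, |sys.g₀ r| ≤ 1 := by
      rw [intervalIntegral.integral_of_le ht, ← sys.g₀_norm]
      exact setIntegral_le_integral sys.integrable_g₀.abs
        (Eventually.of_forall fun s => abs_nonneg _)
    have h2 := pow_le_one₀ (n := n) h0 h1
    gcongr
  · cases n with
    | zero => simpa using w.norm_coe_le_norm t
    | succ n =>
      rw [pow_succ', mul_apply_eq_comp, volterra_apply,
        sys.integral_g₀_smul_of_nonpos _ ht, smul_zero, norm_zero]
      positivity

/-- The trajectory `t ↦ w(t)` in the interaction picture of a single defect that starts at time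
zero with `w = x`. -/
noncomputable def trajectory (ε : ℝ) : H →L[ℂ] (ℝ →ᵇ H) :=
  (exists_resolvent sys.norm_volterra_pow_le ε).choose.comp
    (LinearMap.mkContinuous
      ({ toFun := BoundedContinuousFunction.const ℝ
         map_add' := fun _ _ => rfl
         map_smul' := fun _ _ => rfl } : H →ₗ[ℂ] (ℝ →ᵇ H)) 1 fun x => by
      rw [one_mul]
      exact (BoundedContinuousFunction.norm_le (norm_nonneg _)).2 fun _ => le_rfl)

lemma trajectory_eq (ε : ℝ) (x : H) : sys.trajectory ε x =
    BoundedContinuousFunction.const ℝ x + (ε : ℂ) • sys.volterra (sys.trajectory ε x) :=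
  (exists_resolvent sys.norm_volterra_pow_le ε).choose_spec (BoundedContinuousFunction.const ℝ x)

lemma trajectory_apply (ε : ℝ) (x : H) (t : ℝ) : sys.trajectory ε x t =
    x - Complex.I • ∫ s in (0 : ℝ)..t, ((ε * sys.g₀ s : ℝ) : ℂ) • sys.A s (sys.trajectory ε x s) := by
  conv_lhs => rw [trajectory_eq]
  simp only [BoundedContinuousFunction.coe_add, BoundedContinuousFunction.coe_smul, Pi.add_apply,
    BoundedContinuousFunction.const_apply', volterra_apply, Complex.ofReal_mul, mul_smul,
    intervalIntegral.integral_smul]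
  rw [smul_comm, neg_smul, sub_eq_add_neg]

lemma trajectory_of_nonpos (ε : ℝ) (x : H) {t : ℝ} (ht : t ≤ 0) : sys.trajectory ε x t = x := by
  rw [trajectory_eq, BoundedContinuousFunction.coe_add, BoundedContinuousFunction.coe_smul,
    Pi.add_apply, volterra_apply, sys.integral_g₀_smul_of_nonpos _ ht, smul_zero, smul_zero,
    add_zero, BoundedContinuousFunction.const_apply']

lemma intervalIntegrable_ε_g₀ (ε a b : ℝ) :
    IntervalIntegrable (fun s => ε * sys.g₀ s) volume a b :=
  (sys.integrable_g₀.const_mul ε).intervalIntegrable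

lemma norm_trajectory_apply (ε : ℝ) (x : H) (t : ℝ) : ‖sys.trajectory ε x t‖ = ‖x‖ := by
  rcases le_total 0 t with ht | ht
  · have h0 := sys.trajectory_of_nonpos ε x le_rfl
    have := sys.norm_eq_of_volterra (sys.intervalIntegrable_ε_g₀ ε 0 t)
      (sys.trajectory ε x).continuous
      (fun s _ => by rw [h0]; exact sys.trajectory_apply ε x s) (Set.right_mem_Icc.2 ht)
    rwa [h0] at this
  · rw [sys.trajectory_of_nonpos ε x ht]

lemma norm_trajectory_le (ε : ℝ) (x : H) : ‖sys.trajectory ε x‖ ≤ ‖x‖ :=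
  (BoundedContinuousFunction.norm_le (norm_nonneg _)).2 fun t =>
    (sys.norm_trajectory_apply ε x t).le

/-- The profile vanishes before time zero, so the integral may start at any a ≤ 0. This will absorb
the gap in front of a defect. -/
lemma trajectory_apply_of_nonpos (ε : ℝ) (x : H) {a : ℝ} (ha : a ≤ 0) (t : ℝ) :
    sys.trajectory ε x t = x -
      Complex.I • ∫ s in a..t, ((ε * sys.g₀ s : ℝ) : ℂ) • sys.A s (sys.trajectory ε x s) := by
  have hi : ∀ a b, IntervalIntegrable
      (fun s => ((ε * sys.g₀ s : ℝ) : ℂ) • sys.A s (sys.trajectory ε x s)) volume a b := fun a b =>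
    sys.intervalIntegrable_smul_A (sys.intervalIntegrable_ε_g₀ ε a b)
      (sys.trajectory ε x).continuous
  have h0 : ∫ s in (0 : ℝ)..a, ((ε * sys.g₀ s : ℝ) : ℂ) • sys.A s (sys.trajectory ε x s) = 0 := by
    simp only [Complex.ofReal_mul, mul_smul, intervalIntegral.integral_smul]
    rw [sys.integral_g₀_smul_of_nonpos _ ha, smul_zero]
  rw [trajectory_apply, ← intervalIntegral.integral_add_adjacent_intervals (hi 0 a) (hi a t), h0,
    zero_add]

lemma eq_trajectory (ε : ℝ) {w : ℝ → H} (hw : Continuous w) {a b : ℝ} (ha : a ≤ 0)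
    (heq : ∀ t ∈ Set.Icc a b, w t = w a -
      Complex.I • ∫ s in a..t, ((ε * sys.g₀ s : ℝ) : ℂ) • sys.A s (w s))
    {t : ℝ} (ht : t ∈ Set.Icc a b) : w t = sys.trajectory ε (w a) t := by
  have h0 := sys.trajectory_of_nonpos ε (w a) ha
  exact sys.eq_of_volterra (sys.intervalIntegrable_ε_g₀ ε a b) hw
    (sys.trajectory ε (w a)).continuous h0.symm heq
    (fun s _ => by rw [h0]; exact sys.trajectory_apply_of_nonpos ε _ ha s) ht

/-- The propagator of a single defect up to time `t` in the interaction picture. -/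
noncomputable def propagator (ε t : ℝ) : H →L[ℂ] H :=
  (BoundedContinuousFunction.evalCLM ℂ t).comp (sys.trajectory ε)

lemma propagator_apply (ε t : ℝ) (x : H) : sys.propagator ε t x = sys.trajectory ε x t := rfl

lemma norm_propagator (ε t : ℝ) (x : H) : ‖sys.propagator ε t x‖ = ‖x‖ :=
  sys.norm_trajectory_apply ε x t

lemma propagator_of_nonpos (ε : ℝ) {t : ℝ} (ht : t ≤ 0) (x : H) : sys.propagator ε t x = x :=
  sys.trajectory_of_nonpos ε x ht

lemma continuous_propagator (ε : ℝ) : Continuous fun p : ℝ × H => sys.propagator ε p.1 p.2 := by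
  refine continuous_iff_continuousAt.2 fun ⟨s, x⟩ => ?_
  refine tendsto_iff_norm_sub_tendsto_zero.2 ?_
  have h : Continuous fun p : ℝ × H => ‖p.2 - x‖ +
      ‖sys.trajectory ε x p.1 - sys.trajectory ε x s‖ := by
    have := (sys.trajectory ε x).continuous
    fun_prop
  have h0 := h.tendsto (s, x)
  simp only [sub_self, norm_zero, add_zero] at h0
  refine squeeze_zero (fun _ => norm_nonneg _) (fun p => ?_) h0
  refine (norm_sub_le_norm_sub_add_norm_sub _ (sys.propagator ε p.1 x) _).trans ?_
  rw [← map_sub, norm_propagator]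
  rfl

lemma norm_propagator_sub_le (ε t : ℝ) (x : H) : ‖sys.propagator ε t x - x‖ ≤ |ε| * ‖x‖ := by
  rw [propagator_apply, trajectory_eq]
  simp only [BoundedContinuousFunction.coe_add, BoundedContinuousFunction.coe_smul, Pi.add_apply,
    BoundedContinuousFunction.const_apply', add_sub_cancel_left]
  rw [norm_smul, Complex.norm_real, Real.norm_eq_abs]
  refine mul_le_mul_of_nonneg_left ?_ (abs_nonneg _)
  exact (BoundedContinuousFunction.norm_coe_le_norm _ t).trans
    ((sys.norm_volterra_apply_le _).trans (sys.norm_trajectory_le ε x))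

/-- Insert the integral equation into itself once; the remainder is ε² times two Volterra operators
of norm at most one. -/
lemma norm_propagator_sub_sub_le (ε t : ℝ) (x : H) :
    ‖sys.propagator ε t x - x - (ε : ℂ) • sys.volterra (BoundedContinuousFunction.const ℝ x) t‖ ≤
      ε ^ 2 * ‖x‖ := by
  have h : sys.trajectory ε x = BoundedContinuousFunction.const ℝ x + (ε : ℂ) •
      sys.volterra (BoundedContinuousFunction.const ℝ x) + ((ε : ℂ) * ε) •
        sys.volterra (sys.volterra (sys.trajectory ε x)) := by
    conv_lhs => rw [trajectory_eq, trajectory_eq]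
    rw [map_add, map_smul, smul_add, smul_smul, add_assoc]
  rw [propagator_apply, h]
  simp only [BoundedContinuousFunction.coe_add, BoundedContinuousFunction.coe_smul, Pi.add_apply,
    BoundedContinuousFunction.const_apply']
  rw [add_assoc, add_sub_cancel_left, add_sub_cancel_left, norm_smul, norm_mul, Complex.norm_real,
    Real.norm_eq_abs, abs_mul_abs_self, ← sq]
  refine mul_le_mul_of_nonneg_left ?_ (sq_nonneg _)
  exact (BoundedContinuousFunction.norm_coe_le_norm _ t).trans
    ((sys.norm_volterra_apply_le _).trans ((sys.norm_volterra_apply_le _).trans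
      (sys.norm_trajectory_le ε x)))

end DefectSystem

/-! ### The train of defects: solutions as products of propagators. -/

namespace DefectSystem

variable {ι H : Type*} [NormedAddCommGroup H] [InnerProductSpace ℂ H] [CompleteSpace H]
  (sys : DefectSystem ι H)

/-- The end `(d_0 + T) + ⋯ + (d_{n-1} + T)` of the first `n` periods, each consisting of a gap and
a defect. -/
noncomputable def period (d : ℕ → ℝ) (n : ℕ) : ℝ := ∑ i ∈ Finset.range n, (d i + sys.T)

@[simp] lemma period_zero (d : ℕ → ℝ) : sys.period d 0 = 0 := by simp [period]

lemma period_succ (d : ℕ → ℝ) (n : ℕ) : sys.period d (n + 1) = sys.period d n + (d n + sys.T) := by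
  simp [period, Finset.sum_range_succ]

lemma onset_eq (d : ℕ → ℝ) (n : ℕ) : sys.onset d n = sys.period d n + d n := rfl

section

variable {d : ℕ → ℝ} (hd : ∀ n, 0 ≤ d n)

include hd

lemma period_le_onset (n : ℕ) : sys.period d n ≤ sys.onset d n := by
  rw [onset_eq]; linarith [hd n]

lemma period_strictMono : StrictMono (sys.period d) :=
  strictMono_nat_of_lt_succ fun n => by
    rw [period_succ]; linarith [hd n, sys.T_pos]

lemma mul_T_le_period (n : ℕ) : n * sys.T ≤ sys.period d n := by
  induction n with
  | zero => simp
  | succ n ih => rw [period_succ]; push_cast; linarith [hd n]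

lemma period_nonneg (n : ℕ) : 0 ≤ sys.period d n :=
  (mul_nonneg n.cast_nonneg sys.T_pos.le).trans (sys.mul_T_le_period hd n)

lemma exists_lt_period (t : ℝ) : ∃ n, t < sys.period d n := by
  obtain ⟨n, hn⟩ := exists_nat_gt (t / sys.T)
  exact ⟨n, ((div_lt_iff₀ sys.T_pos).1 hn).trans_le (sys.mul_T_le_period hd n)⟩

lemma exists_mem_period {t : ℝ} (ht : 0 ≤ t) :
    ∃ n, sys.period d n ≤ t ∧ t < sys.period d (n + 1) := by
  classical
  have h := sys.exists_lt_period hd t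
  obtain ⟨n, hn⟩ : ∃ n, Nat.find h = n + 1 := by
    refine Nat.exists_eq_succ_of_ne_zero fun h0 => ?_
    have := Nat.find_spec h
    rw [h0, period_zero] at this
    linarith
  refine ⟨n, not_lt.1 (Nat.find_min h (by omega)), ?_⟩
  rw [← hn]
  exact Nat.find_spec h

/-- The m-th defect lives between its onset and the end of its period, so the others vanish inside
the n-th period. Endpoints are excluded because two defects can touch there when a gap is zero. -/
lemma train_eq {n : ℕ} {s : ℝ} (hs : s ∈ Set.Ioo (sys.period d n) (sys.period d (n + 1))) :
    sys.train d s = sys.g₀ (s - sys.onset d n) := by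
  refine tsum_eq_single n fun m hm => sys.g₀_support _ fun hI => ?_
  have hmono := (sys.period_strictMono hd).monotone
  have h1 : sys.onset d m + sys.T = sys.period d (m + 1) := by rw [onset_eq, period_succ]; ring
  rcases lt_or_gt_of_ne hm with h | h
  · have := hmono (Nat.succ_le_of_lt h)
    simp only [Nat.succ_eq_add_one] at this
    linarith [hI.2, hs.1]
  · have := hmono (Nat.succ_le_of_lt h)
    simp only [Nat.succ_eq_add_one] at this
    linarith [hI.1, hs.2, sys.period_le_onset hd m]

lemma ae_train_eq (n : ℕ) : ∀ᵐ s, s ∈ Set.Icc (sys.period d n) (sys.period d (n + 1)) →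
    sys.train d s = sys.g₀ (s - sys.onset d n) := by
  have h1 : ∀ a : ℝ, ∀ᵐ s : ℝ, s ≠ a := fun a => by simp [ae_iff, measure_singleton]
  filter_upwards [h1 (sys.period d n), h1 (sys.period d (n + 1))] with s ha hb hs
  exact sys.train_eq hd ⟨lt_of_le_of_ne hs.1 (Ne.symm ha), lt_of_le_of_ne hs.2 hb⟩

lemma intervalIntegrable_train_period (n : ℕ) :
    IntervalIntegrable (sys.train d) volume (sys.period d n) (sys.period d (n + 1)) := by
  have h : IntervalIntegrable (fun s => sys.g₀ (s - sys.onset d n)) volume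
      (sys.period d n) (sys.period d (n + 1)) :=
    (sys.integrable_g₀.comp_sub_right _).intervalIntegrable
  refine h.congr_ae ?_
  rw [Filter.EventuallyEq, ae_restrict_iff' measurableSet_uIoc]
  filter_upwards [sys.ae_train_eq hd n] with s hs hsI
  rw [Set.uIoc_of_le ((sys.period_strictMono hd).monotone n.le_succ)] at hsI
  exact (hs (Set.Ioc_subset_Icc_self hsI)).symm

lemma intervalIntegrable_train {t : ℝ} (ht : 0 ≤ t) :
    IntervalIntegrable (sys.train d) volume 0 t := by
  obtain ⟨n, hn⟩ := sys.exists_lt_period hd t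
  have h : ∀ n, IntervalIntegrable (sys.train d) volume 0 (sys.period d n) := fun n => by
    induction n with
    | zero => simp
    | succ n ih => exact ih.trans (sys.intervalIntegrable_train_period hd n)
  refine (h n).mono_set ?_
  rw [Set.uIcc_of_le ht, Set.uIcc_of_le (ht.trans hn.le)]
  exact Set.Icc_subset_Icc le_rfl hn.le

/-- Test the weak equation with ψ_k and multiply by e^{iλ_k t}: the terms with λ_k cancel, and the
remaining coordinates form an integral equation with the bounded operators A(s). -/
lemma volterra_of_isSolution {ε : ℝ} {u₀ : H} {u : ℝ → H} (hu : sys.IsSolution ε d u₀ u) {t : ℝ}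
    (ht : 0 ≤ t) : sys.V t (u t) = u₀ - Complex.I • ∫ s in (0 : ℝ)..t,
      ((ε * sys.train d s : ℝ) : ℂ) • sys.A s (sys.V s (u s)) := by
  -- The solution is continuous only for t ≥ 0; extending it by its initial value gives a function
  -- continuous on the whole line.
  set u' : ℝ → H := fun s => u (max s 0) with hu'
  have hc : Continuous u' :=
    hu.continuousOn.comp_continuous (by fun_prop) fun s => le_max_right s 0
  have hu'u : ∀ s ∈ Set.uIcc 0 t, u s = u' s := fun s hs => by
    rw [Set.uIcc_of_le ht] at hs
    simp [hu', max_eq_left hs.1]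
  have hi : IntervalIntegrable (fun s => ε * sys.train d s) volume 0 t :=
    (sys.intervalIntegrable_train hd ht).const_mul ε
  have hcA : Continuous fun s => sys.V s (u' s) := sys.continuous_V_comp continuous_id hc
  have hI : IntervalIntegrable
      (fun s => ((ε * sys.train d s : ℝ) : ℂ) • sys.A s (sys.V s (u' s))) volume 0 t :=
    sys.intervalIntegrable_smul_A hi hcA
  have e1 : ∫ s in (0 : ℝ)..t, ((ε * sys.train d s : ℝ) : ℂ) • sys.A s (sys.V s (u s)) =
      ∫ s in (0 : ℝ)..t, ((ε * sys.train d s : ℝ) : ℂ) • sys.A s (sys.V s (u' s)) :=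
    intervalIntegral.integral_congr fun s hs => by simp only [hu'u s hs]
  rw [e1]
  refine sys.ψ.ext_inner fun k => ?_
  set lam : ℂ := (sys.lam k : ℂ) with hlam
  set γ : ℝ → ℂ := fun s => ((ε * sys.train d s : ℝ) : ℂ) * inner ℂ (sys.ψ k) (sys.β (u' s)) with hγ
  have hγi : IntervalIntegrable γ volume 0 t := by
    have h2 : Continuous fun s => inner ℂ (sys.ψ k) (sys.β (u' s)) :=
      continuous_const.inner (sys.β.continuous.comp hc)
    exact IntervalIntegrable.mul_continuousOn (f := fun s => ((ε * sys.train d s : ℝ) : ℂ))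
      ⟨hi.1.ofReal, hi.2.ofReal⟩ h2.continuousOn
  set f : ℝ → ℂ := fun s => lam * inner ℂ (sys.ψ k) (u' s) + γ s with hf
  have hcc : Continuous fun s => lam * inner ℂ (sys.ψ k) (u' s) :=
    continuous_const.mul (continuous_const.inner hc)
  have hfi : IntervalIntegrable f volume 0 t := (hcc.intervalIntegrable 0 t).add hγi
  have hweak : ∀ s ∈ Set.Icc 0 t, inner ℂ (sys.ψ k) (u' s) =
      inner ℂ (sys.ψ k) u₀ + ∫ r in (0 : ℝ)..s, -Complex.I * f r := fun s hs => by
    have h := hu.weak ⟨sys.ψ k, sys.ψ_mem k⟩ s hs.1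
    have hsub : ∀ r ∈ Set.uIcc 0 s, u r = u' r := fun r hr =>
      hu'u r (Set.uIcc_subset_uIcc Set.left_mem_uIcc (Set.Icc_subset_uIcc hs) hr)
    rw [intervalIntegral.integral_const_mul, neg_mul, ← sub_eq_add_neg,
      ← hu'u s (Set.Icc_subset_uIcc hs), h]
    congr 2
    refine intervalIntegral.integral_congr fun r hr => ?_
    simp only [hf, hγ, sys.eigen, inner_smul_left, Complex.conj_ofReal, hsub r hr, hlam]
  have hE : ∀ s, HasDerivAt (fun s : ℝ => Complex.exp (Complex.I * (sys.lam k * s : ℝ)))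
      (Complex.I * lam * Complex.exp (Complex.I * (sys.lam k * s : ℝ))) s := fun s => by
    have h1 : HasDerivAt (fun s : ℝ => Complex.I * ((sys.lam k * s : ℝ) : ℂ))
        (Complex.I * lam) s := by
      have := ((hasDerivAt_id s).const_mul (sys.lam k)).ofReal_comp.const_mul Complex.I
      simpa [hlam] using this
    have := h1.cexp
    rwa [mul_comm] at this
  have key := mul_const_add_primitive_eq (c := inner ℂ (sys.ψ k) u₀) (hfi.const_mul (-Complex.I)) hE
    (by fun_prop)
  rw [← hweak t ⟨ht, le_rfl⟩] at key
  rw [sys.inner_V, hu'u t Set.right_mem_uIcc, key, inner_sub_right, inner_smul_right]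
  have e2 : inner ℂ (sys.ψ k) (∫ s in (0 : ℝ)..t,
      ((ε * sys.train d s : ℝ) : ℂ) • sys.A s (sys.V s (u' s))) = ∫ s in (0 : ℝ)..t,
        inner ℂ (sys.ψ k) (((ε * sys.train d s : ℝ) : ℂ) • sys.A s (sys.V s (u' s))) :=
    ((innerSL ℂ (sys.ψ k)).intervalIntegral_comp_comm hI).symm
  rw [e2, sub_eq_add_neg, ← neg_mul, ← intervalIntegral.integral_const_mul]
  congr 1
  · simp
  · refine intervalIntegral.integral_congr fun s hs => ?_
    rw [Set.uIcc_of_le ht] at hs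
    rw [← hweak s hs, inner_smul_right, A, sys.V_neg_V, sys.inner_V]
    simp only [hf, hγ]
    ring

end

/-- The state after `n` periods. -/
noncomputable def state (ε : ℝ) (x : H) (d : ℕ → ℝ) : ℕ → H
  | 0 => x
  | n + 1 => sys.V (-sys.T) (sys.propagator ε sys.T (sys.V (-d n) (state ε x d n)))

/-- The state at the time `t` of the period that starts after `n` periods. -/
noncomputable def stateAt (ε : ℝ) (x : H) (d : ℕ → ℝ) (n : ℕ) (t : ℝ) : H :=
  sys.V (-(t - sys.onset d n)) (sys.propagator ε (t - sys.onset d n)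
    (sys.V (-d n) (sys.state ε x d n)))

lemma norm_state (ε : ℝ) (x : H) (d : ℕ → ℝ) (n : ℕ) : ‖sys.state ε x d n‖ = ‖x‖ := by
  induction n with
  | zero => rfl
  | succ n ih =>
    rw [state, (sys.V _).norm_map, norm_propagator, (sys.V _).norm_map, ih]

lemma norm_stateAt (ε : ℝ) (x : H) (d : ℕ → ℝ) (n : ℕ) (t : ℝ) :
    ‖sys.stateAt ε x d n t‖ = ‖x‖ := by
  rw [stateAt, (sys.V _).norm_map, norm_propagator, (sys.V _).norm_map, norm_state]

lemma stateAt_period_succ (ε : ℝ) (x : H) (d : ℕ → ℝ) (n : ℕ) :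
    sys.stateAt ε x d n (sys.period d (n + 1)) = sys.state ε x d (n + 1) := by
  have : sys.period d (n + 1) - sys.onset d n = sys.T := by rw [period_succ, onset_eq]; ring
  rw [stateAt, state, this]

/-- In the interaction picture, with time counted from the onset, the solution satisfies the
equation of a single defect on [-d n, T]; uniqueness identifies it with the trajectory. -/
lemma eq_stateAt_of_isSolution {d : ℕ → ℝ} (hd : ∀ n, 0 ≤ d n) {ε : ℝ} {u₀ : H} {u : ℝ → H}
    (hu : sys.IsSolution ε d u₀ u) {n : ℕ} (hn : u (sys.period d n) = sys.state ε u₀ d n) {t : ℝ}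
    (ht : t ∈ Set.Icc (sys.period d n) (sys.period d (n + 1))) :
    u t = sys.stateAt ε u₀ d n t := by
  set o := sys.period d n with ho
  set r := sys.onset d n with hr
  have hro : r = o + d n := sys.onset_eq d n
  have ho0 : 0 ≤ o := sys.period_nonneg hd n
  set y : ℝ → H := fun s => sys.V (-r) (sys.V (max (s + r) 0) (u (max (s + r) 0))) with hy
  have hyc : Continuous y := by
    have h1 : Continuous fun s : ℝ => max (s + r) 0 := by fun_prop
    have h2 : Continuous fun s : ℝ => u (max (s + r) 0) :=
      hu.continuousOn.comp_continuous h1 fun s => le_max_right (s + r) 0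
    exact sys.continuous_V_comp continuous_const (sys.continuous_V_comp h1 h2)
  have hys : ∀ s, 0 ≤ s → y (s - r) = sys.V (-r) (sys.V s (u s)) := fun s hs => by
    simp [hy, max_eq_left hs]
  have hya : y (-d n) = sys.V (-d n) (sys.state ε u₀ d n) := by
    have h := hys o ho0
    rw [show o - r = -d n by rw [hro]; ring] at h
    rw [h, ← V_add, hn]
    congr 2
    rw [hro]; ring
  have hi : ∀ t, 0 ≤ t → IntervalIntegrable
      (fun s => ((ε * sys.train d s : ℝ) : ℂ) • sys.A s (sys.V s (u s))) volume 0 t :=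
    fun t ht => by
    set u' : ℝ → H := fun s => u (max s 0) with hu'
    have hc : Continuous u' :=
      hu.continuousOn.comp_continuous (by fun_prop) fun s => le_max_right s 0
    have hcA : Continuous fun s => sys.V s (u' s) := sys.continuous_V_comp continuous_id hc
    refine (sys.intervalIntegrable_smul_A
      ((sys.intervalIntegrable_train hd ht).const_mul ε) hcA).congr fun s hs => ?_
    rw [Set.uIoc_of_le ht] at hs
    simp only [hu', max_eq_left hs.1.le]
  have heq : ∀ s ∈ Set.Icc (-d n) sys.T, y s = y (-d n) -
      Complex.I • ∫ σ in (-d n)..s, ((ε * sys.g₀ σ : ℝ) : ℂ) • sys.A σ (y σ) := by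
    intro s hs
    have hs0 : 0 ≤ s + r := by linarith [hs.1]
    have h1 := hys (s + r) hs0
    rw [add_sub_cancel_right] at h1
    have h2 := hys o ho0
    rw [show o - r = -d n by rw [hro]; ring] at h2
    have hio : IntervalIntegrable
        (fun s => ((ε * sys.train d s : ℝ) : ℂ) • sys.A s (sys.V s (u s))) volume o (s + r) :=
      (hi o ho0).symm.trans (hi _ hs0)
    have h3 : sys.V (s + r) (u (s + r)) = sys.V o (u o) - Complex.I • ∫ σ in o..(s + r),
        ((ε * sys.train d σ : ℝ) : ℂ) • sys.A σ (sys.V σ (u σ)) := by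
      rw [sys.volterra_of_isSolution hd hu hs0, sys.volterra_of_isSolution hd hu ho0,
        ← intervalIntegral.integral_add_adjacent_intervals (hi o ho0) hio, smul_add]
      abel
    rw [h1, h2, h3, map_sub, map_smul]
    congr 2
    have h4 : sys.V (-r) (∫ σ in o..(s + r),
        ((ε * sys.train d σ : ℝ) : ℂ) • sys.A σ (sys.V σ (u σ))) = ∫ σ in o..(s + r),
        sys.V (-r) (((ε * sys.train d σ : ℝ) : ℂ) • sys.A σ (sys.V σ (u σ))) :=
      (((sys.V (-r)).toContinuousLinearEquiv : H →L[ℂ] H).intervalIntegral_comp_comm hio).symm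
    have h5 := intervalIntegral.integral_comp_add_right (a := -d n) (b := s)
      (fun σ => sys.V (-r) (((ε * sys.train d σ : ℝ) : ℂ) • sys.A σ (sys.V σ (u σ)))) r
    rw [show -d n + r = o by rw [hro]; ring] at h5
    rw [h4, ← h5]
    refine intervalIntegral.integral_congr_ae ?_
    -- The train agrees with the single profile only almost everywhere on the closed period, and
    -- translation preserves null sets.
    have hae := (measurePreserving_add_right volume r).quasiMeasurePreserving.ae
      (sys.ae_train_eq hd n)
    filter_upwards [hae] with σ hσ hσI
    rw [Set.uIoc_of_le hs.1] at hσI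
    have hmem : σ + r ∈ Set.Icc (sys.period d n) (sys.period d (n + 1)) := by
      rw [period_succ]
      constructor <;> linarith [hσI.1, hσI.2, hs.2]
    have hσ0 : 0 ≤ σ + r := ho0.trans hmem.1
    have h6 := hys (σ + r) hσ0
    rw [add_sub_cancel_right] at h6
    rw [hσ hmem, h6, sys.A_shift, map_smul, sys.V_neg_V, add_sub_cancel_right]
  have htI : t - r ∈ Set.Icc (-d n) sys.T := by
    have h1 := ht.2
    rw [period_succ] at h1
    constructor <;> linarith [ht.1]
  have h := sys.eq_trajectory ε hyc (neg_nonpos.2 (hd n)) heq htI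
  rw [hys t (ho0.trans ht.1), hya] at h
  rw [stateAt, propagator_apply, ← h, ← V_add, ← V_add,
    show -(t - r) + -r + t = 0 by ring, V_zero]

lemma eq_state_of_isSolution {d : ℕ → ℝ} (hd : ∀ n, 0 ≤ d n) {ε : ℝ} {u₀ : H} {u : ℝ → H}
    (hu : sys.IsSolution ε d u₀ u) (n : ℕ) : u (sys.period d n) = sys.state ε u₀ d n := by
  induction n with
  | zero => rw [period_zero, hu.initial]; rfl
  | succ n ih =>
    rw [sys.eq_stateAt_of_isSolution hd hu ih
      (Set.right_mem_Icc.2 ((sys.period_strictMono hd).monotone n.le_succ)), stateAt_period_succ]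

theorem isSolution_eq_stateAt {d : ℕ → ℝ} (hd : ∀ n, 0 ≤ d n) {ε : ℝ} {u₀ : H} {u : ℝ → H}
    (hu : sys.IsSolution ε d u₀ u) {n : ℕ} {t : ℝ}
    (ht : t ∈ Set.Icc (sys.period d n) (sys.period d (n + 1))) :
    u t = sys.stateAt ε u₀ d n t :=
  sys.eq_stateAt_of_isSolution hd hu (sys.eq_state_of_isSolution hd hu n) ht

end DefectSystem

/-! ### Transition probabilities of a defect. -/

namespace DefectSystem

variable {ι H : Type*} [NormedAddCommGroup H] [InnerProductSpace ℂ H] [CompleteSpace H]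
  (sys : DefectSystem ι H)

lemma inner_A_ψ (s : ℝ) (k j : ι) : inner ℂ (sys.ψ k) (sys.A s (sys.ψ j)) =
    Complex.exp (Complex.I * ((sys.lam k - sys.lam j) * s : ℝ)) * sys.α k j := by
  rw [A, V_ψ, map_smul, map_smul, inner_smul_right, inner_V, ← mul_assoc, ← Complex.exp_add, α]
  congr 2
  push_cast
  ring

/-- The first-order transition amplitudes of a defect are given by the Fourier transform of its
profile. -/
lemma norm_sq_inner_volterra_const (k j : ι) :
    ‖inner ℂ (sys.ψ k) (sys.volterra (BoundedContinuousFunction.const ℝ (sys.ψ j)) sys.T)‖ ^ 2 =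
      sys.rate k j := by
  have hi := sys.intervalIntegrable_smul_A (a := 0) (b := sys.T)
    sys.integrable_g₀.intervalIntegrable
    (BoundedContinuousFunction.const ℝ (sys.ψ j)).continuous
  have h1 : inner ℂ (sys.ψ k) (∫ s in (0 : ℝ)..sys.T,
      (sys.g₀ s : ℂ) • sys.A s (BoundedContinuousFunction.const ℝ (sys.ψ j) s)) =
      ∫ s in (0 : ℝ)..sys.T, inner ℂ (sys.ψ k)
        ((sys.g₀ s : ℂ) • sys.A s (BoundedContinuousFunction.const ℝ (sys.ψ j) s)) :=
    ((innerSL ℂ (sys.ψ k)).intervalIntegral_comp_comm hi).symm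
  have h2 : ∫ s in (0 : ℝ)..sys.T, inner ℂ (sys.ψ k)
        ((sys.g₀ s : ℂ) • sys.A s (BoundedContinuousFunction.const ℝ (sys.ψ j) s)) =
      fourierHat sys.g₀ (-(sys.lam k - sys.lam j)) * sys.α k j := by
    rw [intervalIntegral.integral_of_le sys.T_pos.le, ← integral_Icc_eq_integral_Ioc,
      setIntegral_eq_integral_of_forall_compl_eq_zero fun s hs => by
        rw [sys.g₀_support s hs]; simp]
    rw [fourierHat, ← integral_mul_const]
    refine integral_congr_ae (Eventually.of_forall fun s => ?_)
    simp only [BoundedContinuousFunction.const_apply', inner_smul_right, inner_A_ψ]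
    rw [show Complex.I * (((sys.lam k - sys.lam j) * s : ℝ) : ℂ) =
      -(Complex.I * ((-(sys.lam k - sys.lam j) : ℝ) : ℂ) * s) by push_cast; ring]
    push_cast
    ring
  rw [volterra_apply, inner_smul_right, h1, h2, norm_mul, norm_neg, Complex.norm_I, one_mul,
    norm_mul, mul_pow, rate]
  ring

/-- The transition probabilities of a defect agree with `1 - ε²B` up to third order. -/
lemma sum_abs_transition_le (ε : ℝ) (j : ι) [DecidableEq ι] (s : Finset ι) :
    ∑ k ∈ s, |‖inner ℂ (sys.ψ k) (sys.propagator ε sys.T (sys.ψ j))‖ ^ 2 -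
      (if k = j then 1 else 0) + ε ^ 2 * sys.b k j| ≤ 4 * |ε| ^ 3 := by
  set ρ : ι → ℝ := fun k => ‖inner ℂ (sys.ψ k) (sys.propagator ε sys.T (sys.ψ j))‖ ^ 2 -
      (if k = j then 1 else 0) + ε ^ 2 * sys.b k j with hρ
  have hψ : ‖sys.ψ j‖ = 1 := sys.ψ.orthonormal.1 j
  -- The propagator preserves the norm of ψ_j, and the columns of B sum to zero.
  have hsum : HasSum ρ 0 := by
    have h1 := sys.ψ.hasSum_norm_sq (sys.propagator ε sys.T (sys.ψ j))
    rw [norm_propagator, hψ] at h1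
    have h2 := (h1.sub (hasSum_ite_eq j (1 : ℝ))).add ((sys.hasSum_b_col j).mul_left (ε ^ 2))
    simpa using h2
  set x : H := sys.propagator ε sys.T (sys.ψ j) - sys.ψ j with hx
  set y : H := (ε : ℂ) • sys.volterra (BoundedContinuousFunction.const ℝ (sys.ψ j)) sys.T with hy
  have hxn : ‖x‖ ≤ |ε| := by simpa [hψ] using sys.norm_propagator_sub_le ε sys.T (sys.ψ j)
  have hyn : ‖y‖ ≤ |ε| := by
    rw [hy, norm_smul, Complex.norm_real, Real.norm_eq_abs]
    refine mul_le_of_le_one_right (abs_nonneg _) ?_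
    refine (BoundedContinuousFunction.norm_coe_le_norm _ _).trans
      ((sys.norm_volterra_apply_le _).trans ?_)
    exact (BoundedContinuousFunction.norm_le zero_le_one).2 fun _ => hψ.le
  have hxy : ‖x - y‖ ≤ ε ^ 2 := by
    have := sys.norm_propagator_sub_sub_le ε sys.T (sys.ψ j)
    rwa [hψ, mul_one] at this
  -- Off the diagonal ρ compares the powers of the exact change x and of its first-order part y;
  -- both are O(|ε|) and differ by O(ε²), hence O(|ε|³) in ℓ¹.
  have hoff : ∀ k, k ≠ j → ρ k = ‖inner ℂ (sys.ψ k) x‖ ^ 2 - ‖inner ℂ (sys.ψ k) y‖ ^ 2 := by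
    intro k hk
    have h1 : inner ℂ (sys.ψ k) x = inner ℂ (sys.ψ k) (sys.propagator ε sys.T (sys.ψ j)) := by
      rw [hx, inner_sub_right, sys.ψ.orthonormal.2 hk, sub_zero]
    have h2 : ‖inner ℂ (sys.ψ k) y‖ ^ 2 = ε ^ 2 * sys.rate k j := by
      rw [hy, inner_smul_right, norm_mul, mul_pow, norm_sq_inner_volterra_const, Complex.norm_real,
        Real.norm_eq_abs, sq_abs]
    have h3 : sys.b k j = -sys.rate k j := by
      unfold b
      rw [if_neg (Ne.symm hk)]
    simp only [hρ]
    rw [h1, h2, h3, if_neg hk]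
    ring
  have hoffsum : ∀ s : Finset ι, j ∉ s → ∑ k ∈ s, |ρ k| ≤ 2 * |ε| ^ 3 := fun s hs => by
    have h1 := sys.norm_powerAt_sub_le Set.univ x y
    have h2 : ‖x - y‖ * (‖x‖ + ‖y‖) ≤ 2 * |ε| ^ 3 := by
      have : ‖x - y‖ * (‖x‖ + ‖y‖) ≤ ε ^ 2 * (|ε| + |ε|) :=
        mul_le_mul hxy (add_le_add hxn hyn) (by positivity) (sq_nonneg _)
      rw [← sq_abs] at this
      linarith
    refine le_trans ?_ (h1.trans h2)
    rw [ellOne_norm_eq]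
    have h3 := (ellOne_summable_abs (sys.powerAt Set.univ x - sys.powerAt Set.univ y)).sum_le_tsum
      (s.map ⟨fun k => (⟨k, Set.mem_univ k⟩ : (Set.univ : Set ι)),
        fun a b h => congrArg Subtype.val h⟩) fun _ _ => abs_nonneg _
    refine le_trans (le_of_eq ?_) h3
    rw [Finset.sum_map]
    refine Finset.sum_congr rfl fun k hk => ?_
    rw [hoff k fun h => hs (h ▸ hk)]
    rfl
  -- As ρ sums to zero, its diagonal entry is controlled by the off-diagonal ones; no second-order
  -- amplitude is computed.
  have hdiag : |ρ j| ≤ 2 * |ε| ^ 3 := by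
    have h1 : Tendsto (fun s : Finset ι => |∑ k ∈ s, ρ k| + 2 * |ε| ^ 3) atTop
        (𝓝 (|0| + 2 * |ε| ^ 3)) := (hsum.abs).add_const _
    rw [abs_zero, zero_add] at h1
    refine ge_of_tendsto h1 ?_
    filter_upwards [eventually_ge_atTop {j}] with s hs
    have hj : j ∈ s := Finset.singleton_subset_iff.1 hs
    have h2 := Finset.add_sum_erase s ρ hj
    have h3 := hoffsum (s.erase j) (Finset.notMem_erase j s)
    have h4 := (Finset.abs_sum_le_sum_abs ρ (s.erase j)).trans h3
    rw [← h2]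
    have h5 := abs_sub (ρ j + ∑ k ∈ s.erase j, ρ k) (∑ k ∈ s.erase j, ρ k)
    rw [add_sub_cancel_right] at h5
    linarith
  by_cases hj : j ∈ s
  · rw [← Finset.add_sum_erase s _ hj]
    have := hoffsum (s.erase j) (Finset.notMem_erase j s)
    linarith
  · have := hoffsum s hj
    have : 0 ≤ |ε| ^ 3 := by positivity
    linarith

/-- Makes the Borel structure of products with H the product structure, so jointly continuous maps
such as the free evolution are measurable. -/
lemma secondCountableTopology [Countable ι] (sys : DefectSystem ι H) :
    SecondCountableTopology H := by
  have h1 : TopologicalSpace.IsSeparable (Submodule.span ℂ (Set.range sys.ψ) : Set H) :=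
    (Set.countable_range sys.ψ).isSeparable.span
  have h2 := h1.closure
  rw [← Submodule.topologicalClosure_coe, sys.ψ.dense_span, Submodule.top_coe] at h2
  have : TopologicalSpace.SeparableSpace H := TopologicalSpace.isSeparable_univ_iff.1 h2
  exact UniformSpace.secondCountable_of_separable H

/-! ### Averaging over the random phases, and the effect of one period. -/

section Averaging

variable {Ω : Type*} [MeasurableSpace Ω] {μ : Measure Ω} [IsProbabilityMeasure μ]

/-- Random phases that average out remove the interference between the modes. -/
lemma integral_norm_sq_inner_V [Countable ι] {D : Ω → ℝ} (hD : Measurable D)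
    (hphase : ∀ j k, j ≠ k →
      ∫ ω, Complex.exp (Complex.I * ((sys.lam j - sys.lam k) * D ω : ℝ)) ∂μ = 0) (u y : H) :
    ∫ ω, ‖inner ℂ u (sys.V (-D ω) y)‖ ^ 2 ∂μ =
      ∑' j, ‖inner ℂ u (sys.ψ j)‖ ^ 2 * ‖inner ℂ (sys.ψ j) y‖ ^ 2 := by
  classical
  set z : ι → ℂ := fun j => inner ℂ u (sys.ψ j) * inner ℂ (sys.ψ j) y with hz
  have hzs : Summable fun j => ‖z j‖ := (sys.ψ.summable_inner_mul_inner u y).norm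
  set a : ι → Ω → ℂ := fun j ω => z j * Complex.exp (Complex.I * (sys.lam j * (-D ω) : ℝ)) with ha
  have han : ∀ j ω, ‖a j ω‖ = ‖z j‖ := fun j ω => by
    rw [ha, norm_mul, mul_comm Complex.I, Complex.norm_exp_ofReal_mul_I, mul_one]
  have ham : ∀ j, Measurable (a j) := fun j => by
    have : Measurable fun ω => ((sys.lam j * (-D ω) : ℝ) : ℂ) :=
      Complex.measurable_ofReal.comp ((hD.neg).const_mul _)
    exact ((this.const_mul Complex.I).cexp).const_mul _
  have hexp : ∀ ω, inner ℂ u (sys.V (-D ω) y) = ∑' j, a j ω := fun ω => by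
    rw [← sys.ψ.tsum_inner_mul_inner]
    refine tsum_congr fun j => ?_
    rw [inner_V, ha, hz]; ring
  have hprod : Summable fun p : ι × ι => ‖z p.1‖ * ‖z p.2‖ :=
    hzs.mul_of_nonneg hzs (fun _ => norm_nonneg _) fun _ => norm_nonneg _
  -- The square becomes an absolutely convergent double series, which may be integrated termwise;
  -- only its diagonal survives the averaging.
  have hsq : ∀ ω, ((‖inner ℂ u (sys.V (-D ω) y)‖ ^ 2 : ℝ) : ℂ) =
      ∑' p : ι × ι, a p.1 ω * starRingEnd ℂ (a p.2 ω) := fun ω => by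
    have h1 : Summable fun j => ‖a j ω‖ := by simpa only [han] using hzs
    have h2 : Summable fun j => ‖starRingEnd ℂ (a j ω)‖ := by
      simpa only [RCLike.norm_conj] using h1
    rw [← tsum_mul_tsum_of_summable_norm h1 h2, hexp, Complex.ofReal_pow, ← Complex.mul_conj',
      Complex.conj_tsum]
  have hint : ∀ p : ι × ι, ∫ ω, a p.1 ω * starRingEnd ℂ (a p.2 ω) ∂μ =
      if p.2 = p.1 then ((‖z p.1‖ ^ 2 : ℝ) : ℂ) else 0 := fun p => by
    have h1 : ∀ ω, a p.1 ω * starRingEnd ℂ (a p.2 ω) = z p.1 * starRingEnd ℂ (z p.2) *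
        Complex.exp (Complex.I * ((sys.lam p.2 - sys.lam p.1) * D ω : ℝ)) := fun ω => by
      have h3 : starRingEnd ℂ (Complex.exp (Complex.I * (sys.lam p.2 * (-D ω) : ℝ))) =
          Complex.exp (Complex.I * (sys.lam p.2 * D ω : ℝ)) := by
        rw [← Complex.exp_conj, map_mul, Complex.conj_I, Complex.conj_ofReal]
        congr 1; push_cast; ring
      have h4 : Complex.exp (Complex.I * ((sys.lam p.2 - sys.lam p.1) * D ω : ℝ)) =
          Complex.exp (Complex.I * (sys.lam p.1 * (-D ω) : ℝ)) *
          Complex.exp (Complex.I * (sys.lam p.2 * D ω : ℝ)) := by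
        rw [← Complex.exp_add]; congr 1; push_cast; ring
      rw [ha, map_mul, h3, h4]; ring
    simp only [h1]
    rw [integral_const_mul]
    split_ifs with h
    · rw [h]
      simp [Complex.mul_conj']
    · rw [hphase _ _ h, mul_zero]
  have hmain : HasSum (fun p : ι × ι => ∫ ω, a p.1 ω * starRingEnd ℂ (a p.2 ω) ∂μ)
      (∫ ω, ∑' p : ι × ι, a p.1 ω * starRingEnd ℂ (a p.2 ω) ∂μ) := by
    have hnorm : ∀ (p : ι × ι) ω, ‖a p.1 ω * starRingEnd ℂ (a p.2 ω)‖ = ‖z p.1‖ * ‖z p.2‖ :=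
      fun p ω => by rw [norm_mul, RCLike.norm_conj, han, han]
    refine hasSum_integral_of_summable_integral_norm (fun p => ?_) ?_
    · refine Integrable.of_bound (C := ‖z p.1‖ * ‖z p.2‖) ?_ (Eventually.of_forall fun ω =>
        (hnorm p ω).le)
      exact ((ham _).mul (Complex.continuous_conj.measurable.comp (ham _))).aestronglyMeasurable
    · simp only [hnorm, integral_const, probReal_univ, one_smul]
      exact hprod
  simp only [hint, ← hsq] at hmain
  rw [integral_complex_ofReal] at hmain
  have h5 : HasSum (fun p : ι × ι => if p.2 = p.1 then ‖z p.1‖ ^ 2 else 0)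
      (∫ ω, ‖inner ℂ u (sys.V (-D ω) y)‖ ^ 2 ∂μ) := by
    have := hmain.mapL Complex.reCLM
    simpa [apply_ite, -Complex.ofReal_pow] using this
  rw [← h5.tsum_eq, h5.summable.tsum_prod]
  refine tsum_congr fun j => ?_
  have h6 : ∑' l, (if l = j then ‖z j‖ ^ 2 else 0) = ‖z j‖ ^ 2 := tsum_ite_eq j _
  simp only [hz, norm_mul, mul_pow] at h6 ⊢
  exact h6

end Averaging

end DefectSystem

section

variable {H Ω : Type*} [NormedAddCommGroup H] [InnerProductSpace ℂ H] [MeasurableSpace Ω]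
  {μ : Measure Ω}

lemma integral_norm_sq_inner_nonneg (u : H) (Y : Ω → H) : 0 ≤ ∫ ω, ‖inner ℂ u (Y ω)‖ ^ 2 ∂μ :=
  integral_nonneg fun _ => sq_nonneg _

lemma integrable_norm_sq_inner {Y : Ω → H} (hY : MemLp Y 2 μ) (u : H) :
    Integrable (fun ω => ‖inner ℂ u (Y ω)‖ ^ 2) μ := by
  have hX2 : Integrable (fun ω => ‖u‖ ^ 2 * ‖Y ω‖ ^ 2) μ :=
    (hY.integrable_norm_pow (by norm_num)).const_mul _
  refine hX2.mono' ((hY.1.const_inner).norm.pow 2) (Eventually.of_forall fun ω => ?_)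
  rw [Real.norm_of_nonneg (by positivity), ← mul_pow]
  exact pow_le_pow_left₀ (norm_nonneg _) (norm_inner_le_norm _ _) 2

end

namespace DefectSystem

variable {ι H : Type*} [NormedAddCommGroup H] [InnerProductSpace ℂ H] [CompleteSpace H]
  (sys : DefectSystem ι H) {Ω : Type*} [MeasurableSpace Ω] {μ : Measure Ω}

lemma hasSum_integral_norm_sq_inner [Countable ι] {Y : Ω → H} (hY : MemLp Y 2 μ) :
    HasSum (fun j => ∫ ω, ‖inner ℂ (sys.ψ j) (Y ω)‖ ^ 2 ∂μ) (∫ ω, ‖Y ω‖ ^ 2 ∂μ) := by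
  have hi := fun j => integrable_norm_sq_inner hY (sys.ψ j)
  have h0 : ∀ j, ∫ ω, ‖(‖inner ℂ (sys.ψ j) (Y ω)‖ ^ 2)‖ ∂μ =
      ∫ ω, ‖inner ℂ (sys.ψ j) (Y ω)‖ ^ 2 ∂μ := fun j =>
    integral_congr_ae (Eventually.of_forall fun ω => by simp)
  have hs : Summable fun j => ∫ ω, ‖inner ℂ (sys.ψ j) (Y ω)‖ ^ 2 ∂μ := by
    refine summable_of_sum_le (c := ∫ ω, ‖Y ω‖ ^ 2 ∂μ)
      (fun j => integral_nonneg fun _ => sq_nonneg _) fun s => ?_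
    rw [← integral_finsetSum s fun k _ => hi k]
    exact integral_mono (integrable_finsetSum s fun k _ => hi k)
      (hY.integrable_norm_pow (by norm_num)) fun ω =>
        sys.ψ.orthonormal.sum_inner_products_le (Y ω)
  have h := hasSum_integral_of_summable_integral_norm hi (by simpa only [h0] using hs)
  have e : ∀ ω, ∑' j, ‖inner ℂ (sys.ψ j) (Y ω)‖ ^ 2 = ‖Y ω‖ ^ 2 := fun ω =>
    (sys.ψ.hasSum_norm_sq (Y ω)).tsum_eq
  simpa only [e] using h

variable [IsProbabilityMeasure μ]

/-- Free evolution over an independent random time with averaging phases, followed by a bounded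
operator: the expected powers are transformed by the matrix of transition probabilities. -/
lemma hasSum_integral_norm_sq_inner_comp [Countable ι] [MeasurableSpace H] [BorelSpace H]
    {D : Ω → ℝ} (hD : Measurable D)
    (hphase : ∀ j k, j ≠ k →
      ∫ ω, Complex.exp (Complex.I * ((sys.lam j - sys.lam k) * D ω : ℝ)) ∂μ = 0)
    {Y : Ω → H} (hYm : Measurable Y) (hY : MemLp Y 2 μ) (hind : IndepFun Y D μ)
    (U : H →L[ℂ] H) (k : ι) :
    HasSum (fun j => ‖inner ℂ (sys.ψ k) (U (sys.ψ j))‖ ^ 2 *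
        ∫ ω, ‖inner ℂ (sys.ψ j) (Y ω)‖ ^ 2 ∂μ)
      (∫ ω, ‖inner ℂ (sys.ψ k) (U (sys.V (-D ω) (Y ω)))‖ ^ 2 ∂μ) := by
  have := sys.secondCountableTopology
  -- Moving U to the other side leaves the free evolution alone, so that by independence and Fubini
  -- the average over D can be taken first.
  set u : H := ContinuousLinearMap.adjoint U (sys.ψ k) with hu
  have hUu : ∀ x, inner ℂ (sys.ψ k) (U x) = inner ℂ u x := fun x =>
    (ContinuousLinearMap.adjoint_inner_left U x (sys.ψ k)).symm
  simp only [hUu]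
  have : IsProbabilityMeasure (μ.map D) := Measure.isProbabilityMeasure_map hD.aemeasurable
  have : IsProbabilityMeasure (μ.map Y) := Measure.isProbabilityMeasure_map hYm.aemeasurable
  set F : H × ℝ → ℝ := fun p => ‖inner ℂ u (sys.V (-p.2) p.1)‖ ^ 2 with hF
  have hFc : Continuous F :=
    ((continuous_const.inner (sys.continuous_V_comp continuous_snd.neg continuous_fst)).norm).pow 2
  have hFle : ∀ p, ‖F p‖ ≤ ‖u‖ ^ 2 * ‖p.1‖ ^ 2 := fun p => by
    rw [Real.norm_of_nonneg (sq_nonneg _), ← mul_pow]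
    refine pow_le_pow_left₀ (norm_nonneg _) ?_ 2
    have := norm_inner_le_norm (𝕜 := ℂ) u (sys.V (-p.2) p.1)
    rwa [(sys.V _).norm_map] at this
  have hYsq : Integrable (fun y : H => ‖y‖ ^ 2) (μ.map Y) :=
    (integrable_map_measure (by fun_prop) hYm.aemeasurable).2
      (hY.integrable_norm_pow (by norm_num))
  have hFi : Integrable F ((μ.map Y).prod (μ.map D)) :=
    (((hYsq.comp_fst (μ.map D))).const_mul (‖u‖ ^ 2)).mono' hFc.aestronglyMeasurable
      (Eventually.of_forall hFle)
  have hmap : μ.map (fun ω => (Y ω, D ω)) = (μ.map Y).prod (μ.map D) :=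
    (indepFun_iff_map_prod_eq_prod_map_map hYm.aemeasurable hD.aemeasurable).1 hind
  have h1 : ∫ ω, ‖inner ℂ u (sys.V (-D ω) (Y ω))‖ ^ 2 ∂μ =
      ∫ y, ∫ δ, F (y, δ) ∂(μ.map D) ∂(μ.map Y) := by
    rw [← integral_prod F hFi, ← hmap,
      integral_map (hYm.prodMk hD).aemeasurable hFc.aestronglyMeasurable]
  have h2 : ∀ y, ∫ δ, F (y, δ) ∂(μ.map D) =
      ∑' j, ‖inner ℂ u (sys.ψ j)‖ ^ 2 * ‖inner ℂ (sys.ψ j) y‖ ^ 2 := fun y => by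
    have hm : AEStronglyMeasurable (fun δ => F (y, δ)) (μ.map D) :=
      (hFc.comp (Continuous.prodMk_right y)).aestronglyMeasurable
    rw [integral_map hD.aemeasurable hm]
    exact sys.integral_norm_sq_inner_V hD hphase u y
  simp only [h2] at h1
  have h3 : ∫ y, ∑' j, ‖inner ℂ u (sys.ψ j)‖ ^ 2 * ‖inner ℂ (sys.ψ j) y‖ ^ 2 ∂(μ.map Y) =
      ∫ ω, ∑' j, ‖inner ℂ u (sys.ψ j)‖ ^ 2 * ‖inner ℂ (sys.ψ j) (Y ω)‖ ^ 2 ∂μ := by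
    refine integral_map hYm.aemeasurable (Measurable.aestronglyMeasurable ?_)
    refine Measurable.tsum fun j => ?_
    exact Continuous.measurable (by fun_prop)
  rw [h1, h3]
  have hi := fun j => (integrable_norm_sq_inner hY (sys.ψ j)).const_mul
    (‖inner ℂ u (sys.ψ j)‖ ^ 2)
  have h4 := hasSum_integral_of_summable_integral_norm hi (by
    have h0 : ∀ j, ∫ ω, ‖‖inner ℂ u (sys.ψ j)‖ ^ 2 * ‖inner ℂ (sys.ψ j) (Y ω)‖ ^ 2‖ ∂μ =
        ‖inner ℂ u (sys.ψ j)‖ ^ 2 * ∫ ω, ‖inner ℂ (sys.ψ j) (Y ω)‖ ^ 2 ∂μ := fun j => by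
      rw [← integral_const_mul]
      exact integral_congr_ae (Eventually.of_forall fun ω => by simp)
    simp only [h0]
    refine ((sys.hasSum_integral_norm_sq_inner hY).summable.mul_left (‖u‖ ^ 2)).of_nonneg_of_le
      (fun j => mul_nonneg (sq_nonneg _) (integral_norm_sq_inner_nonneg _ _)) fun j => ?_
    refine mul_le_mul_of_nonneg_right ?_ (integral_norm_sq_inner_nonneg _ _)
    refine pow_le_pow_left₀ (norm_nonneg _) ?_ 2
    simpa [sys.ψ.orthonormal.1 j] using norm_inner_le_norm (𝕜 := ℂ) u (sys.ψ j))
  simpa only [integral_const_mul] using h4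

/-- One period changes the expected powers by `1 - ε²B`, up to third order. -/
lemma norm_integral_powerAt_period_le [Countable ι] [MeasurableSpace H] [BorelSpace H]
    {S : Set ι} (hS : sys.IsIrreducibleSubsystem S) {D : Ω → ℝ} (hD : Measurable D)
    (hphase : ∀ j k, j ≠ k →
      ∫ ω, Complex.exp (Complex.I * ((sys.lam j - sys.lam k) * D ω : ℝ)) ∂μ = 0)
    {Y : Ω → H} (hYm : Measurable Y) (hY : MemLp Y 2 μ) (hind : IndepFun Y D μ) (ε : ℝ)
    (hY' : MemLp (fun ω => sys.propagator ε sys.T (sys.V (-D ω) (Y ω))) 2 μ) :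
    ‖∫ ω, sys.powerAt S (sys.propagator ε sys.T (sys.V (-D ω) (Y ω))) ∂μ -
      (1 - ε ^ 2 • sys.B S) (∫ ω, sys.powerAt S (Y ω) ∂μ)‖ ≤
      4 * |ε| ^ 3 * ∫ ω, ‖Y ω‖ ^ 2 ∂μ := by
  classical
  set p : ι → ℝ := fun j => ∫ ω, ‖inner ℂ (sys.ψ j) (Y ω)‖ ^ 2 ∂μ with hp
  have hp0 : ∀ j, 0 ≤ p j := fun j => integral_norm_sq_inner_nonneg _ _
  have hps : HasSum p (∫ ω, ‖Y ω‖ ^ 2 ∂μ) := sys.hasSum_integral_norm_sq_inner hY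
  set r : ι → ι → ℝ := fun k j => ‖inner ℂ (sys.ψ k) (sys.propagator ε sys.T (sys.ψ j))‖ ^ 2 -
      (if k = j then 1 else 0) + ε ^ 2 * sys.b k j with hr
  have hev : ∀ {X : Ω → H} (_ : MemLp X 2 μ) (k : S),
      (∫ ω, sys.powerAt S (X ω) ∂μ) k = ∫ ω, ‖inner ℂ (sys.ψ k) (X ω)‖ ^ 2 ∂μ := fun hX k =>
    ((lp.evalCLM ℝ (fun _ : S => ℝ) 1 k).integral_comp_comm (sys.integrable_powerAt hX S)).symm
  have hcoord : ∀ k : S, HasSum (fun j => r k j * p j)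
      ((∫ ω, sys.powerAt S (sys.propagator ε sys.T (sys.V (-D ω) (Y ω))) ∂μ -
        (1 - ε ^ 2 • sys.B S) (∫ ω, sys.powerAt S (Y ω) ∂μ)) k) := fun k => by
    have e : (∫ ω, sys.powerAt S (sys.propagator ε sys.T (sys.V (-D ω) (Y ω))) ∂μ -
        (1 - ε ^ 2 • sys.B S) (∫ ω, sys.powerAt S (Y ω) ∂μ)) k =
        (∫ ω, sys.powerAt S (sys.propagator ε sys.T (sys.V (-D ω) (Y ω))) ∂μ) k -
        ((∫ ω, sys.powerAt S (Y ω) ∂μ) k -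
          ε ^ 2 * sys.B S (∫ ω, sys.powerAt S (Y ω) ∂μ) k) := rfl
    rw [e, hev hY', hev hY, sys.B_apply]
    simp only [hev hY]
    have h1 := sys.hasSum_integral_norm_sq_inner_comp hD hphase hYm hY hind
      (sys.propagator ε sys.T) k
    have h2 : HasSum (fun j => (if (k : ι) = j then (1 : ℝ) else 0) * p j) (p k) := by
      convert! hasSum_ite_eq (k : ι) (p k) using 2 with j
      by_cases h : (k : ι) = j
      · simp [h]
      · simp [h, Ne.symm h]
    -- Since b k j = 0 for j outside S, the sum may run over all modes; leakage from outside S then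
    -- belongs to the error r.
    have h3 : HasSum (fun j => sys.b k j * p j) (∑' j : S, sys.b k j * p j) := by
      refine (hasSum_subtype_iff_of_support_subset (s := S)
        (f := fun j => sys.b k j * p j) fun j hj => ?_).1 (Summable.hasSum ?_)
      · by_contra hjS
        exact hj (by simp [hS.2.1 k k.2 j hjS])
      · refine Summable.of_norm_bounded ((hps.summable.subtype S).mul_left 2) fun j => ?_
        rw [Function.comp_apply, norm_mul, Real.norm_of_nonneg (hp0 _)]
        exact mul_le_mul_of_nonneg_right (sys.abs_b_le_two k j) (hp0 _)
    have h4 := (h1.sub h2).add (h3.mul_left (ε ^ 2))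
    rw [← sub_add]
    refine h4.congr_fun fun j => ?_
    simp only [hr]
    ring
  have hN : 0 ≤ ∫ ω, ‖Y ω‖ ^ 2 ∂μ := integral_nonneg fun _ => sq_nonneg _
  refine ellOne_norm_le (by positivity) fun s => ?_
  -- Column bounds suffice: interchanging the sums bounds the ℓ¹ error by 4|ε|³ times the total
  -- expected power.
  have hcol : ∀ j, ∑ k ∈ s, |r k j| ≤ 4 * |ε| ^ 3 := fun j => by
    have := sys.sum_abs_transition_le ε j (s.map (Function.Embedding.subtype _))
    rwa [Finset.sum_map] at this
  have hrs : ∀ k ∈ s, Summable fun j => |r k j| * p j := fun k hk => by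
    refine (hps.summable.mul_left (4 * |ε| ^ 3)).of_nonneg_of_le
      (fun j => mul_nonneg (abs_nonneg _) (hp0 j)) fun j => ?_
    exact mul_le_mul_of_nonneg_right ((Finset.single_le_sum (f := fun k : S => |r k j|)
      (fun _ _ => abs_nonneg _) hk).trans (hcol j)) (hp0 j)
  calc _ ≤ ∑ k ∈ s, ∑' j, |r k j| * p j := by
        refine Finset.sum_le_sum fun k hk => ?_
        rw [← (hcoord k).tsum_eq, ← Real.norm_eq_abs]
        have h5 : ∀ j, ‖r k j * p j‖ = |r k j| * p j := fun j => by
          rw [norm_mul, Real.norm_of_nonneg (hp0 j), Real.norm_eq_abs]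
        refine (norm_tsum_le_tsum_norm (by simpa only [h5] using hrs k hk)).trans (le_of_eq ?_)
        exact tsum_congr h5
    _ = ∑' j, ∑ k ∈ s, |r k j| * p j := (Summable.tsum_finsetSum hrs).symm
    _ ≤ ∑' j, 4 * |ε| ^ 3 * p j := by
        refine Summable.tsum_le_tsum (fun j => ?_) (summable_sum hrs)
          (hps.summable.mul_left _)
        rw [← Finset.sum_mul]
        exact mul_le_mul_of_nonneg_right (hcol j) (hp0 j)
    _ = 4 * |ε| ^ 3 * ∫ ω, ‖Y ω‖ ^ 2 ∂μ := by rw [tsum_mul_left, hps.tsum_eq]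

end DefectSystem

/-- Both hypotheses say that the joint law of X, Y and Z is a triple product, and product measures
are associative. -/
lemma ProbabilityTheory.IndepFun.prodMk_left_of_prodMk_right {Ω α β γ : Type*} [MeasurableSpace Ω]
    [MeasurableSpace α] [MeasurableSpace β] [MeasurableSpace γ] {μ : Measure Ω}
    [IsProbabilityMeasure μ] {X : Ω → α} {Y : Ω → β} {Z : Ω → γ} (hX : Measurable X)
    (hY : Measurable Y) (hZ : Measurable Z) (h : IndepFun X (fun ω => (Y ω, Z ω)) μ)
    (h' : IndepFun Y Z μ) : IndepFun (fun ω => (X ω, Y ω)) Z μ := by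
  have := Measure.isProbabilityMeasure_map (μ := μ) hX.aemeasurable
  have := Measure.isProbabilityMeasure_map (μ := μ) hY.aemeasurable
  have := Measure.isProbabilityMeasure_map (μ := μ) hZ.aemeasurable
  have hXY : IndepFun X Y μ := h.comp measurable_id measurable_fst
  rw [indepFun_iff_map_prod_eq_prod_map_map (by fun_prop) (by fun_prop)] at h h' hXY ⊢
  rw [hXY]
  have e : μ.map (fun ω => ((X ω, Y ω), Z ω)) =
      (μ.map fun ω => (X ω, (Y ω, Z ω))).map MeasurableEquiv.prodAssoc.symm := by
    rw [Measure.map_map (MeasurableEquiv.measurable _) (by fun_prop)]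
    rfl
  rw [e, h, h', ← Measure.prodAssoc_prod, MeasurableEquiv.map_symm_map]

/-! ### Recursions with losses near the diffusion. -/

namespace IsDiffusion

variable {σ : Type*} {B : ℓ¹(σ, ℝ) →L[ℝ] ℓ¹(σ, ℝ)} {W : σ → σ → ℝ} (hB : IsDiffusion B W)

include hB

lemma norm_heat_apply_le {s : ℝ} (hs : 0 ≤ s) (v : ℓ¹(σ, ℝ)) : ‖heat B s v‖ ≤ ‖v‖ :=
  (ContinuousLinearMap.le_of_opNorm_le _ (hB.norm_heat_le hs) v).trans_eq (one_mul _)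

/-- A recursion that loses the mass `e j` in the `j`-th step follows the diffusion. -/
lemma norm_add_sum_sub_heat_le {a e : ℕ → ℓ¹(σ, ℝ)} {s δ : ℝ} (hs : 0 ≤ s)
    (hstep : ∀ j, ‖a (j + 1) + e j - heat B s (a j)‖ ≤ δ) (m : ℕ) :
    ‖a m + ∑ j ∈ Finset.range m, heat B (s * (m - 1 - j)) (e j) - heat B (s * m) (a 0)‖ ≤
      m * δ := by
  induction m with
  | zero => simp
  | succ m ih =>
    -- Discrete Duhamel formula: the previous error is propagated by a contraction, so the step
    -- errors only add up.
    have e1 : a (m + 1) + ∑ j ∈ Finset.range (m + 1),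
          heat B (s * ((m + 1 : ℕ) - 1 - j)) (e j) - heat B (s * (m + 1 : ℕ)) (a 0) =
        (a (m + 1) + e m - heat B s (a m)) + heat B s (a m +
          ∑ j ∈ Finset.range m, heat B (s * (m - 1 - j)) (e j) - heat B (s * m) (a 0)) := by
      rw [Finset.sum_range_succ, map_sub, map_add, map_sum]
      have h1 : ∀ r v, heat B s (heat B r v) = heat B (s + r) v := fun r v => by
        rw [heat_add]; rfl
      simp only [h1]
      have h2 : ∀ j : ℕ, s * (((m + 1 : ℕ) : ℝ) - 1 - j) = s + s * (m - 1 - j) := fun j => by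
        push_cast; ring
      have h3 : s * ((m + 1 : ℕ) : ℝ) = s + s * m := by push_cast; ring
      have h4 : s + s * ((m : ℝ) - 1 - m) = 0 := by ring
      simp only [h2, h3, h4, heat_zero, one_apply_eq_self]
      abel
    rw [e1]
    refine (norm_add_le _ _).trans ?_
    have := (hB.norm_heat_apply_le hs _).trans ih
    push_cast
    linarith [hstep m]

/-- Here π bounds the surviving mass, and P is nearly the sum of the lost masses. Duhamel's formula
contains these masses diffused for their remaining time. Undoing this costs at most twice the mass π
0 - π l lost before l, and for losses between l and m at most twice the remaining time s(m - l) per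
unit of mass; what survives m steps is at most π m. -/
lemma norm_sub_heat_le {a e : ℕ → ℓ¹(σ, ℝ)} {s δ η : ℝ} {π : ℕ → ℝ} (hs : 0 ≤ s)
    (hstep : ∀ j, ‖a (j + 1) + e j - heat B s (a j)‖ ≤ δ) (ha : ∀ j, ‖a j‖ ≤ π j)
    (he : ∀ j, ‖e j‖ ≤ π j - π (j + 1)) {P : ℓ¹(σ, ℝ)} {l m : ℕ} (hlm : l ≤ m)
    (hP : ‖P - ∑ j ∈ Finset.range m, e j‖ ≤ η) :
    ‖P - heat B (s * m) (a 0)‖ ≤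
      η + π m + 2 * (π 0 - π l) + 2 * (s * (m - l)) * π 0 + m * δ := by
  have hanti : Antitone π := antitone_nat_of_succ_le fun j => by
    linarith [he j, norm_nonneg (e j)]
  have hπ : ∀ j, 0 ≤ π j := fun j => (norm_nonneg _).trans (ha j)
  have hj0 : ∀ j ∈ Finset.range m, 0 ≤ s * ((m : ℝ) - 1 - j) := fun j hj => by
    have : ((j + 1 : ℕ) : ℝ) ≤ m := by exact_mod_cast Finset.mem_range.1 hj
    push_cast at this
    exact mul_nonneg hs (by linarith)
  have h1 := hB.norm_add_sum_sub_heat_le hs hstep m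
  have h2 : ‖∑ j ∈ Finset.range m, e j -
      ∑ j ∈ Finset.range m, heat B (s * (m - 1 - j)) (e j)‖ ≤
      2 * (π 0 - π l) + 2 * (s * (m - l)) * (π l - π m) := by
    rw [← Finset.sum_sub_distrib]
    refine (norm_sum_le _ _).trans ?_
    rw [← Finset.sum_range_add_sum_Ico _ hlm]
    refine add_le_add ?_ ?_
    · rw [← Finset.sum_range_sub', Finset.mul_sum]
      refine Finset.sum_le_sum fun j hj => ?_
      have := hB.norm_heat_apply_le
        (hj0 j (Finset.mem_range.2 ((Finset.mem_range.1 hj).trans_le hlm))) (e j)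
      linarith [norm_sub_le (e j) (heat B (s * (m - 1 - j)) (e j)), he j]
    · have h3 : π l - π m = ∑ j ∈ Finset.Ico l m, (π j - π (j + 1)) := by
        rw [Finset.sum_Ico_eq_sub _ hlm, Finset.sum_range_sub', Finset.sum_range_sub']
        ring
      rw [h3, Finset.mul_sum]
      refine Finset.sum_le_sum fun j hj => ?_
      obtain ⟨hlj, hjm⟩ := Finset.mem_Ico.1 hj
      have h4 := hj0 j (Finset.mem_range.2 hjm)
      have h5 : ‖e j - heat B (s * (m - 1 - j)) (e j)‖ ≤ 2 * (s * (m - 1 - j)) * ‖e j‖ := by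
        rw [norm_sub_rev]
        exact ContinuousLinearMap.le_of_opNorm_le (heat B (s * (m - 1 - j)) - 1)
          (hB.norm_heat_sub_one_le h4) (e j)
      have h6 : s * ((m : ℝ) - 1 - j) ≤ s * (m - l) := by
        have : (l : ℝ) ≤ j := by exact_mod_cast hlj
        exact mul_le_mul_of_nonneg_left (by linarith) hs
      exact h5.trans (mul_le_mul (by linarith) (he j) (norm_nonneg _) (by linarith))
  have h7 : 2 * (s * (m - l)) * (π l - π m) ≤ 2 * (s * (m - l)) * π 0 := by
    refine mul_le_mul_of_nonneg_left (by linarith [hanti (Nat.zero_le l), hπ m]) ?_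
    have : (l : ℝ) ≤ m := by exact_mod_cast hlm
    exact mul_nonneg zero_le_two (mul_nonneg hs (by linarith))
  have e2 : P - heat B (s * m) (a 0) = (P - ∑ j ∈ Finset.range m, e j) +
      (∑ j ∈ Finset.range m, e j - ∑ j ∈ Finset.range m, heat B (s * (m - 1 - j)) (e j)) +
      (a m + ∑ j ∈ Finset.range m, heat B (s * (m - 1 - j)) (e j) - heat B (s * m) (a 0)) -
      a m := by abel
  rw [e2]
  refine (norm_sub_le _ _).trans ?_
  refine (add_le_add (norm_add₃_le) (ha m)).trans ?_
  linarith

end IsDiffusion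

/-! ### Stopping the recursion at the time t. -/

namespace DefectSystem

variable {ι H : Type*} [NormedAddCommGroup H] [InnerProductSpace ℂ H] [CompleteSpace H]
  (sys : DefectSystem ι H)

lemma measurable_period (n : ℕ) : Measurable fun d : ℕ → ℝ => sys.period d n := by
  unfold period
  fun_prop

lemma measurable_onset (n : ℕ) : Measurable fun d : ℕ → ℝ => sys.onset d n := by
  unfold onset
  fun_prop

lemma period_congr {d d' : ℕ → ℝ} {n : ℕ} (h : ∀ i < n, d i = d' i) :
    sys.period d n = sys.period d' n :=
  Finset.sum_congr rfl fun i hi => by rw [h i (Finset.mem_range.1 hi)]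

/-- Together with `period_congr`: the stopped state after n periods does not involve the gap that
follows, which gives the required independence. -/
lemma state_congr (ε : ℝ) (x : H) {d d' : ℕ → ℝ} {n : ℕ} (h : ∀ i < n, d i = d' i) :
    sys.state ε x d n = sys.state ε x d' n := by
  induction n with
  | zero => rfl
  | succ n ih => rw [state, state, h n n.lt_succ_self, ih fun i hi => h i (hi.trans n.lt_succ_self)]

section

variable [Countable ι] [MeasurableSpace H] [BorelSpace H]

lemma measurable_V_comp {α : Type*} [MeasurableSpace α] {f : α → ℝ} {g : α → H}
    (hf : Measurable f) (hg : Measurable g) : Measurable fun a => sys.V (f a) (g a) := by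
  have := sys.secondCountableTopology
  have h : Measurable fun p : ℝ × H => sys.V p.1 p.2 := sys.continuous_V.measurable
  exact Measurable.comp (f := fun a => (f a, g a)) h (hf.prodMk hg)

lemma measurable_propagator_comp (ε : ℝ) {α : Type*} [MeasurableSpace α] {f : α → ℝ} {g : α → H}
    (hf : Measurable f) (hg : Measurable g) :
    Measurable fun a => sys.propagator ε (f a) (g a) := by
  have := sys.secondCountableTopology
  have h : Measurable fun p : ℝ × H => sys.propagator ε p.1 p.2 :=
    (sys.continuous_propagator ε).measurable
  exact Measurable.comp (f := fun a => (f a, g a)) h (hf.prodMk hg)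

lemma measurable_state (ε : ℝ) (n : ℕ) :
    Measurable fun p : H × (ℕ → ℝ) => sys.state ε p.1 p.2 n := by
  induction n with
  | zero => exact measurable_fst
  | succ n ih =>
    have h1 : Measurable fun p : H × (ℕ → ℝ) => -p.2 n := by fun_prop
    have h2 := sys.measurable_propagator_comp ε (measurable_const (a := sys.T))
      (sys.measurable_V_comp h1 ih)
    simp only [state]
    exact sys.measurable_V_comp measurable_const h2

lemma measurable_stateAt (ε : ℝ) (n : ℕ) (t : ℝ) :
    Measurable fun p : H × (ℕ → ℝ) => sys.stateAt ε p.1 p.2 n t := by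
  have h : Measurable fun p : H × (ℕ → ℝ) => t - sys.onset p.2 n :=
    measurable_const.sub ((sys.measurable_onset n).comp measurable_snd)
  have h1 : Measurable fun p : H × (ℕ → ℝ) => -p.2 n := by fun_prop
  have h2 := sys.measurable_propagator_comp ε h
    (sys.measurable_V_comp h1 (sys.measurable_state ε n))
  simp only [stateAt]
  exact sys.measurable_V_comp h.neg h2

end

/-- The state after `n` periods, or zero if these end after the time `t`. -/
noncomputable def running (ε t : ℝ) (n : ℕ) (p : H × (ℕ → ℝ)) : H :=
  if sys.period p.2 n ≤ t then sys.state ε p.1 p.2 n else 0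

/-- The state at the end of the period numbered `n`, or zero if the time `t` is not in it. -/
noncomputable def ending (ε t : ℝ) (n : ℕ) (p : H × (ℕ → ℝ)) : H :=
  if sys.period p.2 n ≤ t ∧ t < sys.period p.2 (n + 1) then sys.state ε p.1 p.2 (n + 1) else 0

lemma norm_sq_running (ε t : ℝ) (n : ℕ) (p : H × (ℕ → ℝ)) : ‖sys.running ε t n p‖ ^ 2 =
    {d : ℕ → ℝ | sys.period d n ≤ t}.indicator 1 p.2 * ‖p.1‖ ^ 2 := by
  by_cases h : sys.period p.2 n ≤ t <;> simp [running, h, norm_state]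

lemma norm_running_le (ε t : ℝ) (n : ℕ) (p : H × (ℕ → ℝ)) : ‖sys.running ε t n p‖ ≤ ‖p.1‖ := by
  by_cases h : sys.period p.2 n ≤ t <;> simp [running, h, norm_state]

lemma norm_ending_le (ε t : ℝ) (n : ℕ) (p : H × (ℕ → ℝ)) : ‖sys.ending ε t n p‖ ≤ ‖p.1‖ := by
  unfold ending
  split_ifs <;> simp [norm_state]

lemma norm_sq_ending (ε t : ℝ) (n : ℕ) (p : H × (ℕ → ℝ)) (hd : ∀ n, 0 ≤ p.2 n) :
    ‖sys.ending ε t n p‖ ^ 2 = ‖sys.running ε t n p‖ ^ 2 - ‖sys.running ε t (n + 1) p‖ ^ 2 := by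
  have hle := (sys.period_strictMono hd).monotone n.le_succ
  simp only [Nat.succ_eq_add_one] at hle
  by_cases h : sys.period p.2 n ≤ t
  · by_cases h' : sys.period p.2 (n + 1) ≤ t
    · simp [running, ending, h, h', norm_state, not_lt.2 h']
    · simp [running, ending, h, h', norm_state, not_le.1 h']
  · have h' : ¬ sys.period p.2 (n + 1) ≤ t := fun h' => h (hle.trans h')
    simp [running, ending, h, h']

lemma norm_isSolution {d : ℕ → ℝ} (hd : ∀ n, 0 ≤ d n) {ε : ℝ} {u₀ : H} {u : ℝ → H}
    (hu : sys.IsSolution ε d u₀ u) {t : ℝ} (ht : 0 ≤ t) : ‖u t‖ = ‖u₀‖ := by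
  obtain ⟨n, hn, hn'⟩ := sys.exists_mem_period hd ht
  rw [sys.isSolution_eq_stateAt hd hu ⟨hn, hn'.le⟩, norm_stateAt]

lemma powerAt_zero (S : Set ι) : sys.powerAt S (0 : H) = 0 := by
  ext k
  simp

/-- A period that starts by time t is either over by then or contains t; the two alternatives have
disjoint supports, so powers add. The final free evolution does not affect powers. -/
lemma powerAt_running_step (S : Set ι) (ε t : ℝ) (n : ℕ) (p : H × (ℕ → ℝ))
    (hd : ∀ n, 0 ≤ p.2 n) :
    sys.powerAt S (sys.propagator ε sys.T (sys.V (-p.2 n) (sys.running ε t n p))) =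
      sys.powerAt S (sys.running ε t (n + 1) p) + sys.powerAt S (sys.ending ε t n p) := by
  have hle := (sys.period_strictMono hd).monotone n.le_succ
  simp only [Nat.succ_eq_add_one] at hle
  by_cases h : sys.period p.2 n ≤ t
  · have e : sys.powerAt S (sys.propagator ε sys.T (sys.V (-p.2 n) (sys.running ε t n p))) =
        sys.powerAt S (sys.state ε p.1 p.2 (n + 1)) := by
      rw [running, if_pos h, state, powerAt_V]
    rw [e]
    by_cases h' : sys.period p.2 (n + 1) ≤ t
    · simp [running, ending, h, h', powerAt_zero, not_lt.2 h']
    · simp [running, ending, h, h', powerAt_zero, not_le.1 h']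
  · have h' : ¬ sys.period p.2 (n + 1) ≤ t := fun h' => h (hle.trans h')
    simp [running, ending, h, h', powerAt_zero]

/-- Up to phases both states arise from the state y at the onset by propagators that move y by at
most |ε|‖y‖. -/
lemma norm_powerAt_stateAt_sub_le (S : Set ι) (ε : ℝ) (x : H) (d : ℕ → ℝ) (n : ℕ) (t : ℝ) :
    ‖sys.powerAt S (sys.stateAt ε x d n t) - sys.powerAt S (sys.state ε x d (n + 1))‖ ≤
      4 * |ε| * ‖x‖ ^ 2 := by
  rw [stateAt, state, powerAt_V, powerAt_V]
  set y := sys.V (-d n) (sys.state ε x d n) with hy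
  have hyx : ‖y‖ = ‖x‖ := by rw [hy, (sys.V _).norm_map, norm_state]
  refine (sys.norm_powerAt_sub_le S _ _).trans ?_
  have h1 := sys.norm_propagator_sub_le ε (t - sys.onset d n) y
  have h2 := sys.norm_propagator_sub_le ε sys.T y
  rw [norm_propagator, norm_propagator, hyx]
  rw [hyx] at h1 h2
  have h3 := norm_sub_le_norm_sub_add_norm_sub (sys.propagator ε (t - sys.onset d n) y) y
    (sys.propagator ε sys.T y)
  rw [norm_sub_rev y] at h3
  nlinarith [norm_nonneg x]

/-- Up to the change in one period, the powers at the time `t` are those at the end of the period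
that contains `t`. -/
lemma norm_powerAt_sub_sum_ending_le (S : Set ι) {ε : ℝ} {x : H} {d : ℕ → ℝ} (hd : ∀ n, 0 ≤ d n)
    {u : ℝ → H} (hu : sys.IsSolution ε d x u) {t : ℝ} (ht : 0 ≤ t) (m : ℕ) :
    ‖sys.powerAt S (u t) - ∑ j ∈ Finset.range m, sys.powerAt S (sys.ending ε t j (x, d))‖ ≤
      4 * |ε| * ‖x‖ ^ 2 + ‖sys.running ε t m (x, d)‖ ^ 2 := by
  obtain ⟨n, hn, hn'⟩ := sys.exists_mem_period hd ht
  have hmono := sys.period_strictMono hd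
  rw [sys.isSolution_eq_stateAt hd hu ⟨hn, hn'.le⟩]
  have hz : ∀ j, j ≠ n → sys.powerAt S (sys.ending ε t j (x, d)) = 0 := fun j hj => by
    rw [ending, if_neg, powerAt_zero]
    rintro ⟨h1, h2⟩
    rcases lt_or_gt_of_ne hj with h | h
    · exact absurd (h2.trans_le ((hmono.monotone h).trans hn)) (lt_irrefl t)
    · exact absurd (hn'.trans_le ((hmono.monotone h).trans h1)) (lt_irrefl t)
  by_cases h : n < m
  · rw [Finset.sum_eq_single_of_mem n (Finset.mem_range.2 h) fun j _ hj => hz j hj]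
    have e : sys.ending ε t n (x, d) = sys.state ε x d (n + 1) := if_pos ⟨hn, hn'⟩
    rw [e]
    have := sys.norm_powerAt_stateAt_sub_le S ε x d n t
    nlinarith [sq_nonneg ‖sys.running ε t m (x, d)‖]
  · rw [Finset.sum_eq_zero fun j hj =>
      hz j (ne_of_lt ((Finset.mem_range.1 hj).trans_le (not_lt.1 h))), sub_zero]
    have e : sys.running ε t m (x, d) = sys.state ε x d m :=
      if_pos ((hmono.monotone (not_lt.1 h)).trans hn)
    rw [e, norm_state]
    have := sys.norm_powerAt_le S (sys.stateAt ε x d n t)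
    rw [norm_stateAt] at this
    have : 0 ≤ 4 * |ε| * ‖x‖ ^ 2 := by positivity
    linarith

end DefectSystem

/-- The initial state and the gaps before the `n`-th one are independent of the `n`-th gap. -/
lemma indepFun_past {Ω E : Type*} [MeasurableSpace Ω] [MeasurableSpace E] {μ : Measure Ω}
    [IsProbabilityMeasure μ] {d : ℕ → Ω → ℝ} {φ₀ : Ω → E} (hd_meas : ∀ l, Measurable (d l)) (hd_indep : iIndepFun d μ)
    (hφ₀_meas : Measurable φ₀) (hφ₀_indep : IndepFun φ₀ (fun ω l => d l ω) μ) (n : ℕ) :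
    IndepFun (fun ω => (φ₀ ω, fun i => if i < n then d i ω else 0)) (d n) μ := by
  have hm : Measurable fun e : ℕ → ℝ => fun i => if i < n then e i else 0 := by
    refine measurable_pi_lambda _ fun i => ?_
    split_ifs
    · exact measurable_pi_apply i
    · exact measurable_const
  have hdm : Measurable fun ω l => d l ω := measurable_pi_lambda _ hd_meas
  refine IndepFun.prodMk_left_of_prodMk_right hφ₀_meas (hm.comp hdm) (hd_meas n)
    (hφ₀_indep.comp (φ := id) (ψ := fun e : ℕ → ℝ => (fun i => if i < n then e i else 0, e n))
      measurable_id (hm.prodMk (measurable_pi_apply n))) ?_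
  have h := hd_indep.indepFun_finset (Finset.range n) {n} (by simp) hd_meas
  have hp : Measurable fun (e : Finset.range n → ℝ) (i : ℕ) =>
      if h : i ∈ Finset.range n then e ⟨i, h⟩ else 0 := by
    refine measurable_pi_lambda _ fun i => ?_
    split_ifs
    · exact measurable_pi_apply _
    · exact measurable_const
  have := h.comp hp (measurable_pi_apply (⟨n, by simp⟩ : ({n} : Finset ℕ)))
  convert! this using 2 with ω
  funext i
  simp

/-! ### Comparison of the expected powers with the diffusion. -/

namespace DefectSystem

variable {ι H Ω : Type*} [NormedAddCommGroup H] [InnerProductSpace ℂ H] [CompleteSpace H]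
  (sys : DefectSystem ι H) [MeasurableSpace H] [BorelSpace H] [Countable ι] [MeasurableSpace Ω] {μ : Measure Ω}
  {d : ℕ → Ω → ℝ} {φ₀ : Ω → H}

lemma measurable_running (ε t : ℝ) (n : ℕ) : Measurable (sys.running ε t n) := by
  refine Measurable.ite ?_ (sys.measurable_state ε n) measurable_const
  exact measurableSet_le ((sys.measurable_period n).comp measurable_snd) measurable_const

lemma measurable_ending (ε t : ℝ) (n : ℕ) : Measurable (sys.ending ε t n) := by
  refine Measurable.ite ?_ (sys.measurable_state ε (n + 1)) measurable_const
  exact (measurableSet_le ((sys.measurable_period n).comp measurable_snd) measurable_const).inter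
    (measurableSet_lt measurable_const ((sys.measurable_period (n + 1)).comp measurable_snd))

lemma indepFun_running [IsProbabilityMeasure μ] (hd_meas : ∀ l, Measurable (d l)) (hd_indep : iIndepFun d μ)
    (hφ₀_meas : Measurable φ₀) (hφ₀_indep : IndepFun φ₀ (fun ω l => d l ω) μ)
    (ε t : ℝ) (n : ℕ) : IndepFun (fun ω => sys.running ε t n (φ₀ ω, fun l => d l ω)) (d n) μ := by
  have h := (indepFun_past hd_meas hd_indep hφ₀_meas hφ₀_indep n).comp
    (sys.measurable_running ε t n) measurable_id
  convert! h using 2 with ω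
  have hc : ∀ i < n, d i ω = if i < n then d i ω else 0 := fun i hi => (if_pos hi).symm
  simp only [running, Function.comp_apply]
  rw [sys.period_congr hc, sys.state_congr ε (φ₀ ω) hc]

/-- The indicator is a function of the gaps alone and the norm one of the initial state alone,
because the evolution is isometric. -/
lemma integral_norm_sq_running (hd_meas : ∀ l, Measurable (d l)) (hφ₀_meas : Measurable φ₀)
    (hφ₀_indep : IndepFun φ₀ (fun ω l => d l ω) μ) (ε t : ℝ) (n : ℕ) :
    ∫ ω, ‖sys.running ε t n (φ₀ ω, fun l => d l ω)‖ ^ 2 ∂μ =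
      μ.real {ω | sys.period (fun l => d l ω) n ≤ t} * ∫ ω, ‖φ₀ ω‖ ^ 2 ∂μ := by
  have hdm : Measurable fun ω l => d l ω := measurable_pi_lambda _ hd_meas
  have hA : MeasurableSet {e : ℕ → ℝ | sys.period e n ≤ t} :=
    measurableSet_le (sys.measurable_period n) measurable_const
  simp only [norm_sq_running]
  have := sys.secondCountableTopology
  rw [hφ₀_indep.symm.integral_fun_comp_mul_comp (f := {e | sys.period e n ≤ t}.indicator 1)
    (g := fun x : H => ‖x‖ ^ 2) hdm.aemeasurable hφ₀_meas.aemeasurable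
    (measurable_const.indicator hA).aestronglyMeasurable
    (by fun_prop)]
  congr 1
  have e : ∀ ω, ({e : ℕ → ℝ | sys.period e n ≤ t}.indicator (1 : (ℕ → ℝ) → ℝ) fun l => d l ω) =
      {ω | sys.period (fun l => d l ω) n ≤ t}.indicator 1 ω := fun ω => rfl
  simp only [e]
  exact integral_indicator_one (hA.preimage hdm)

include sys in
lemma memLp_comp_of_norm_le {F : H × (ℕ → ℝ) → H} (hF : Measurable F) (hF' : ∀ p, ‖F p‖ ≤ ‖p.1‖)
    (hd_meas : ∀ l, Measurable (d l)) (hφ₀_meas : Measurable φ₀) (hφ₀ : MemLp φ₀ 2 μ) :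
    MemLp (fun ω => F (φ₀ ω, fun l => d l ω)) 2 μ := by
  have := sys.secondCountableTopology
  have hdm : Measurable fun ω l => d l ω := measurable_pi_lambda _ hd_meas
  exact hφ₀.mono (hF.comp (hφ₀_meas.prodMk hdm)).aestronglyMeasurable
    (Eventually.of_forall fun ω => hF' _)

/-- The family φ is given without any measurability in ω. On each event that fixes the period
containing t, uniqueness identifies it with an explicit measurable state. -/
lemma measurable_solution (hd_meas : ∀ l, Measurable (d l)) (hd_nonneg : ∀ l ω, 0 ≤ d l ω)
    (hφ₀_meas : Measurable φ₀) {ε : ℝ} {φ : Ω → ℝ → H}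
    (hφ : ∀ ω, sys.IsSolution ε (fun l => d l ω) (φ₀ ω) (φ ω)) {t : ℝ} (ht : 0 ≤ t) :
    Measurable fun ω => φ ω t := by
  have hdm : Measurable fun ω l => d l ω := measurable_pi_lambda _ hd_meas
  have hp : ∀ n, Measurable fun ω => sys.period (fun l => d l ω) n := fun n =>
    (sys.measurable_period n).comp hdm
  intro s hs
  have e : (fun ω => φ ω t) ⁻¹' s = ⋃ n, {ω | sys.period (fun l => d l ω) n ≤ t} ∩
      {ω | t < sys.period (fun l => d l ω) (n + 1)} ∩
      {ω | sys.stateAt ε (φ₀ ω) (fun l => d l ω) n t ∈ s} := by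
    ext ω
    simp only [Set.mem_preimage, Set.mem_iUnion, Set.mem_inter_iff, Set.mem_ofPred_eq]
    constructor
    · intro h
      obtain ⟨n, hn, hn'⟩ := sys.exists_mem_period (fun l => hd_nonneg l ω) ht
      refine ⟨n, ⟨hn, hn'⟩, ?_⟩
      rwa [← sys.isSolution_eq_stateAt (fun l => hd_nonneg l ω) (hφ ω) ⟨hn, hn'.le⟩]
    · rintro ⟨n, ⟨hn, hn'⟩, h⟩
      rwa [sys.isSolution_eq_stateAt (fun l => hd_nonneg l ω) (hφ ω) ⟨hn, hn'.le⟩]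
  rw [e]
  refine MeasurableSet.iUnion fun n => ((measurableSet_le (hp n) measurable_const).inter
    (measurableSet_lt measurable_const (hp (n + 1)))).inter ?_
  exact ((sys.measurable_stateAt ε n t).comp (hφ₀_meas.prodMk hdm)) hs

lemma memLp_solution (hd_meas : ∀ l, Measurable (d l)) (hd_nonneg : ∀ l ω, 0 ≤ d l ω)
    (hφ₀_meas : Measurable φ₀) (hφ₀ : MemLp φ₀ 2 μ) {ε : ℝ} {φ : Ω → ℝ → H}
    (hφ : ∀ ω, sys.IsSolution ε (fun l => d l ω) (φ₀ ω) (φ ω)) {t : ℝ} (ht : 0 ≤ t) :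
    MemLp (fun ω => φ ω t) 2 μ := by
  have := sys.secondCountableTopology
  exact hφ₀.mono (sys.measurable_solution hd_meas hd_nonneg hφ₀_meas hφ ht).aestronglyMeasurable
    (Eventually.of_forall fun ω => (sys.norm_isSolution (fun l => hd_nonneg l ω) (hφ ω) ht).le)

/-- The expected powers follow the diffusion, up to errors that depend on how well `l ≤ m` bracket
the number of the periods before the time `t`. -/
theorem norm_powerVec_sub_heat_le [IsProbabilityMeasure μ]
    (hd_meas : ∀ l, Measurable (d l)) (hd_nonneg : ∀ l ω, 0 ≤ d l ω)
    (hd_indep : iIndepFun d μ)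
    (hd_phase : ∀ (l : ℕ) (j k : ι), j ≠ k →
      ∫ ω, Complex.exp (Complex.I * ((sys.lam j - sys.lam k) * d l ω : ℝ)) ∂μ = 0)
    (hφ₀_meas : Measurable φ₀) (hφ₀ : MemLp φ₀ 2 μ)
    (hφ₀_indep : IndepFun φ₀ (fun ω l => d l ω) μ) {ε : ℝ} {φ : Ω → ℝ → H}
    (hφ : ∀ ω, sys.IsSolution ε (fun l => d l ω) (φ₀ ω) (φ ω)) {S : Set ι}
    (hS : sys.IsIrreducibleSubsystem S) {t : ℝ} (ht : 0 ≤ t) {l m : ℕ} (hlm : l ≤ m) :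
    ‖sys.powerVec μ (fun ω => φ ω t) S -
        IsDiffusion.heat (sys.B S) (ε ^ 2 * m) (sys.powerVec μ φ₀ S)‖ ≤
      (4 * |ε| + 2 * μ.real {ω | sys.period (fun l => d l ω) m ≤ t} +
        2 * (1 - μ.real {ω | sys.period (fun l => d l ω) l ≤ t}) + 2 * (ε ^ 2 * (m - l)) +
        m * (4 * |ε| ^ 3 + 4 * ε ^ 4)) * ∫ ω, ‖φ₀ ω‖ ^ 2 ∂μ := by
  have hB := sys.isDiffusion hS
  set Φ : Ω → H × (ℕ → ℝ) := fun ω => (φ₀ ω, fun l => d l ω) with hΦ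
  set N : ℝ := ∫ ω, ‖φ₀ ω‖ ^ 2 ∂μ with hN
  have hN0 : 0 ≤ N := integral_nonneg fun _ => sq_nonneg _
  set q : ℕ → ℝ := fun j => μ.real {ω | sys.period (fun l => d l ω) j ≤ t} with hq
  have hrun : ∀ j, MemLp (fun ω => sys.running ε t j (Φ ω)) 2 μ := fun j =>
    sys.memLp_comp_of_norm_le (sys.measurable_running ε t j) (sys.norm_running_le ε t j)
      hd_meas hφ₀_meas hφ₀
  have hend : ∀ j, MemLp (fun ω => sys.ending ε t j (Φ ω)) 2 μ := fun j =>
    sys.memLp_comp_of_norm_le (sys.measurable_ending ε t j) (sys.norm_ending_le ε t j)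
      hd_meas hφ₀_meas hφ₀
  have hrunm : ∀ j, Measurable fun ω => sys.running ε t j (Φ ω) := fun j =>
    (sys.measurable_running ε t j).comp (hφ₀_meas.prodMk (measurable_pi_lambda _ hd_meas))
  have hrunN : ∀ j, ∫ ω, ‖sys.running ε t j (Φ ω)‖ ^ 2 ∂μ = q j * N :=
    sys.integral_norm_sq_running hd_meas hφ₀_meas hφ₀_indep ε t
  have hq1 : ∀ j, q j ≤ 1 := fun j => measureReal_le_one
  have hq0 : q 0 = 1 := by simp [hq, ht]
  set a : ℕ → ℓ¹(S, ℝ) := fun j => ∫ ω, sys.powerAt S (sys.running ε t j (Φ ω)) ∂μ with ha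
  set e : ℕ → ℓ¹(S, ℝ) := fun j => ∫ ω, sys.powerAt S (sys.ending ε t j (Φ ω)) ∂μ with he
  have ha0 : a 0 = sys.powerVec μ φ₀ S := by
    rw [sys.powerVec_eq_integral hφ₀]
    exact integral_congr_ae (Eventually.of_forall fun ω => by simp [running, ht, hΦ, state])
  have ha_le : ∀ j, ‖a j‖ ≤ q j * N := fun j => by
    rw [← hrunN]
    exact norm_integral_le_of_norm_le ((hrun j).integrable_norm_pow (by norm_num))
      (Eventually.of_forall fun ω => sys.norm_powerAt_le S _)
  have he_le : ∀ j, ‖e j‖ ≤ q j * N - q (j + 1) * N := fun j => by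
    rw [← hrunN, ← hrunN, ← integral_sub ((hrun j).integrable_norm_pow (by norm_num))
      ((hrun (j + 1)).integrable_norm_pow (by norm_num))]
    refine norm_integral_le_of_norm_le (((hrun j).integrable_norm_pow (by norm_num)).sub
      ((hrun (j + 1)).integrable_norm_pow (by norm_num))) (Eventually.of_forall fun ω => ?_)
    rw [← sys.norm_sq_ending ε t j (Φ ω) fun l => hd_nonneg l ω]
    exact sys.norm_powerAt_le S _
  -- The cubic term is the error of the transition matrix, the quartic one that of replacing 1 - ε²B
  -- by e^{-ε²B}.
  have hstep : ∀ j, ‖a (j + 1) + e j - IsDiffusion.heat (sys.B S) (ε ^ 2) (a j)‖ ≤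
      (4 * |ε| ^ 3 + 4 * ε ^ 4) * N := fun j => by
    have hY' : MemLp (fun ω => sys.propagator ε sys.T
        (sys.V (-d j ω) (sys.running ε t j (Φ ω)))) 2 μ := by
      have := sys.secondCountableTopology
      refine hφ₀.mono (sys.measurable_propagator_comp ε measurable_const
        (sys.measurable_V_comp (hd_meas j).neg (hrunm j))).aestronglyMeasurable
        (Eventually.of_forall fun ω => ?_)
      rw [norm_propagator, (sys.V _).norm_map]
      exact sys.norm_running_le ε t j (Φ ω)
    have h1 := sys.norm_integral_powerAt_period_le hS (hd_meas j) (hd_phase j) (hrunm j) (hrun j)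
      (sys.indepFun_running hd_meas hd_indep hφ₀_meas hφ₀_indep ε t j) ε hY'
    have h2 : ∫ ω, sys.powerAt S (sys.propagator ε sys.T
        (sys.V (-d j ω) (sys.running ε t j (Φ ω)))) ∂μ = a (j + 1) + e j := by
      rw [ha, he, ← integral_add (sys.integrable_powerAt (hrun (j + 1)) S)
        (sys.integrable_powerAt (hend j) S)]
      exact integral_congr_ae (Eventually.of_forall fun ω =>
        sys.powerAt_running_step S ε t j (Φ ω) fun l => hd_nonneg l ω)
    rw [h2, hrunN] at h1
    have h3 : ‖(IsDiffusion.heat (sys.B S) (ε ^ 2) - (1 - ε ^ 2 • sys.B S)) (a j)‖ ≤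
        4 * (ε ^ 2) ^ 2 * ‖a j‖ :=
      ContinuousLinearMap.le_of_opNorm_le _ (hB.norm_heat_sub_one_add_le (sq_nonneg ε)) _
    have h4 : a (j + 1) + e j - IsDiffusion.heat (sys.B S) (ε ^ 2) (a j) =
        (a (j + 1) + e j - (1 - ε ^ 2 • sys.B S) (a j)) -
        (IsDiffusion.heat (sys.B S) (ε ^ 2) - (1 - ε ^ 2 • sys.B S)) (a j) := by
      rw [sub_apply (IsDiffusion.heat (sys.B S) (ε ^ 2))]
      abel
    rw [h4]
    refine (norm_sub_le _ _).trans ((add_le_add h1 h3).trans ?_)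
    have h5 : q j * N ≤ N := mul_le_of_le_one_left hN0 (hq1 j)
    have h6 : 4 * |ε| ^ 3 * (q j * N) ≤ 4 * |ε| ^ 3 * N :=
      mul_le_mul_of_nonneg_left h5 (by positivity)
    have h7 : 4 * (ε ^ 2) ^ 2 * ‖a j‖ ≤ 4 * (ε ^ 2) ^ 2 * N :=
      mul_le_mul_of_nonneg_left ((ha_le j).trans h5) (by positivity)
    calc _ ≤ 4 * |ε| ^ 3 * N + 4 * (ε ^ 2) ^ 2 * N := add_le_add h6 h7
      _ = _ := by ring
  have hφm := sys.memLp_solution hd_meas hd_nonneg hφ₀_meas hφ₀ hφ ht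
  -- Passing to the end of the current period costs 4|ε|; realizations with at least m periods
  -- before t are missed by the sum and cost q m.
  have hP : ‖sys.powerVec μ (fun ω => φ ω t) S - ∑ j ∈ Finset.range m, e j‖ ≤
      4 * |ε| * N + q m * N := by
    have hi := fun j => sys.integrable_powerAt (hend j) S
    rw [sys.powerVec_eq_integral hφm, he, ← integral_finsetSum _ fun j _ => hi j,
      ← integral_sub (sys.integrable_powerAt hφm S) (integrable_finsetSum _ fun j _ => hi j),
      ← hrunN m, hN, ← integral_const_mul,
      ← integral_add ((hφ₀.integrable_norm_pow (by norm_num)).const_mul _)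
        ((hrun m).integrable_norm_pow (by norm_num))]
    exact norm_integral_le_of_norm_le (((hφ₀.integrable_norm_pow (by norm_num)).const_mul _).add
      ((hrun m).integrable_norm_pow (by norm_num))) (Eventually.of_forall fun ω =>
        sys.norm_powerAt_sub_sum_ending_le S (fun l => hd_nonneg l ω) (hφ ω) ht m)
  have key := hB.norm_sub_heat_le (sq_nonneg ε) hstep ha_le he_le hlm hP
  rw [ha0, hq0] at key
  refine key.trans (le_of_eq ?_)
  ring

end DefectSystem

/-- Chebyshev's inequality for the sum of independent identically distributed variables. -/
lemma measureReal_le_abs_sum_sub_le {Ω : Type*} [MeasurableSpace Ω] {μ : Measure Ω}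
    [IsProbabilityMeasure μ] {d : ℕ → Ω → ℝ} (hd_indep : iIndepFun d μ)
    (hd_ident : ∀ l, IdentDistrib (d l) (d 0) μ μ) (hd : ∀ l, MemLp (d l) 2 μ) (n : ℕ) {c : ℝ}
    (hc : 0 < c) :
    μ.real {ω | c ≤ |∑ i ∈ Finset.range n, d i ω - n * ∫ ω, d 0 ω ∂μ|} ≤
      n * variance (d 0) μ / c ^ 2 := by
  have hX : MemLp (∑ i ∈ Finset.range n, d i) 2 μ := memLp_finsetSum' _ fun i _ => hd i
  have h := meas_ge_le_variance_div_sq hX hc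
  have hmean : ∫ ω, (∑ i ∈ Finset.range n, d i) ω ∂μ = n * ∫ ω, d 0 ω ∂μ := by
    simp only [Finset.sum_apply]
    rw [integral_finsetSum _ fun i _ => (hd i).integrable one_le_two]
    simp [fun i => (hd_ident i).integral_eq]
  have hvar : variance (∑ i ∈ Finset.range n, d i) μ = n * variance (d 0) μ := by
    rw [IndepFun.variance_sum (fun i _ => hd i)
      fun i _ j _ hij => hd_indep.indepFun hij]
    simp [fun i => (hd_ident i).variance_eq]
  rw [hmean, hvar] at h
  simp only [Finset.sum_apply] at h
  exact ENNReal.toReal_le_of_le_ofReal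
    (div_nonneg (mul_nonneg n.cast_nonneg (variance_nonneg _ _)) (sq_nonneg c)) h

/-! ### Concentration of the number of periods, and the diffusion limit. -/

namespace DefectSystem

variable {ι H Ω : Type*} [NormedAddCommGroup H] [InnerProductSpace ℂ H] [CompleteSpace H]
  (sys : DefectSystem ι H) [MeasurableSpace Ω] {μ : Measure Ω}
  [IsProbabilityMeasure μ] {d : ℕ → Ω → ℝ}

lemma measureReal_period_le (hd_indep : iIndepFun d μ)
    (hd_ident : ∀ l, IdentDistrib (d l) (d 0) μ μ) (hd : ∀ l, MemLp (d l) 2 μ) {n : ℕ} {t c : ℝ}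
    (hc : 0 < c) (h : t + c ≤ n * (sys.T + ∫ ω, d 0 ω ∂μ)) :
    μ.real {ω | sys.period (fun l => d l ω) n ≤ t} ≤ n * variance (d 0) μ / c ^ 2 := by
  refine le_trans (measureReal_mono fun ω hω => ?_)
    (measureReal_le_abs_sum_sub_le hd_indep hd_ident hd n hc)
  simp only [Set.mem_ofPred_eq, period, Finset.sum_add_distrib, Finset.sum_const,
    Finset.card_range, nsmul_eq_mul] at hω ⊢
  rw [abs_sub_comm]
  exact le_trans (by linarith) (le_abs_self _)

lemma one_sub_measureReal_period_le (hd_meas : ∀ l, Measurable (d l)) (hd_indep : iIndepFun d μ)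
    (hd_ident : ∀ l, IdentDistrib (d l) (d 0) μ μ) (hd : ∀ l, MemLp (d l) 2 μ) {n : ℕ} {t c : ℝ}
    (hc : 0 < c) (h : n * (sys.T + ∫ ω, d 0 ω ∂μ) + c ≤ t) :
    1 - μ.real {ω | sys.period (fun l => d l ω) n ≤ t} ≤ n * variance (d 0) μ / c ^ 2 := by
  have hm : MeasurableSet {ω | sys.period (fun l => d l ω) n ≤ t} :=
    measurableSet_le ((sys.measurable_period n).comp (measurable_pi_lambda _ hd_meas))
      measurable_const
  rw [← probReal_compl_eq_one_sub hm]
  refine le_trans (measureReal_mono fun ω hω => ?_)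
    (measureReal_le_abs_sum_sub_le hd_indep hd_ident hd n hc)
  simp only [Set.mem_compl_iff, Set.mem_ofPred_eq, period, Finset.sum_add_distrib,
    Finset.sum_const, Finset.card_range, nsmul_eq_mul, not_le] at hω ⊢
  exact le_trans (by linarith) (le_abs_self _)

variable [MeasurableSpace H] [BorelSpace H] [Countable ι] {φ₀ : Ω → H}

/-- With l = n - h and m = n + 1 + h around t/q, the window is about 2κε⁻² periods wide. It
contributes 4κ, and moving the diffusion time from ε²m to ε²t/q contributes 2κ; all other terms
vanish in the limit when |ε|³t → 0. -/
theorem norm_powerVec_sub_heat_le_add (hd_meas : ∀ l, Measurable (d l))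
    (hd_nonneg : ∀ l ω, 0 ≤ d l ω)
    (hd_indep : iIndepFun d μ) (hd_ident : ∀ l, IdentDistrib (d l) (d 0) μ μ)
    (hd_phase : ∀ (l : ℕ) (j k : ι), j ≠ k →
      ∫ ω, Complex.exp (Complex.I * ((sys.lam j - sys.lam k) * d l ω : ℝ)) ∂μ = 0)
    (hd : ∀ l, MemLp (d l) 2 μ) (hφ₀_meas : Measurable φ₀) (hφ₀ : MemLp φ₀ 2 μ)
    (hφ₀_indep : IndepFun φ₀ (fun ω l => d l ω) μ) {ε : ℝ} (hε : ε ≠ 0) {φ : Ω → ℝ → H}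
    (hφ : ∀ ω, sys.IsSolution ε (fun l => d l ω) (φ₀ ω) (φ ω)) {S : Set ι}
    (hS : sys.IsIrreducibleSubsystem S) {t : ℝ} (ht : 0 ≤ t) {κ q : ℝ} (hκ : 0 < κ)
    (hq : q = sys.T + ∫ ω, d 0 ω ∂μ) :
    ‖sys.powerVec μ (fun ω => φ ω t) S -
        IsDiffusion.heat (sys.B S) (ε ^ 2 * t / q) (sys.powerVec μ φ₀ S)‖ ≤
      (6 * κ + (4 * |ε| + 10 * ε ^ 2 +
        (4 + 4 * |ε| + 4 * variance (d 0) μ / (κ * q) ^ 2 * |ε|) *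
          (|ε| ^ 3 * t / q + 2 * |ε| ^ 3 + κ * |ε|))) * ∫ ω, ‖φ₀ ω‖ ^ 2 ∂μ := by
  have hB := sys.isDiffusion hS
  have hq0 : 0 < q := by
    rw [hq]
    exact add_pos_of_pos_of_nonneg sys.T_pos (integral_nonneg fun ω => hd_nonneg 0 ω)
  set N : ℝ := ∫ ω, ‖φ₀ ω‖ ^ 2 ∂μ with hN
  have hN0 : 0 ≤ N := integral_nonneg fun _ => sq_nonneg _
  set v := variance (d 0) μ with hv
  have hv0 : 0 ≤ v := variance_nonneg _ _
  have hε2 : 0 < ε ^ 2 := by positivity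
  set h : ℕ := ⌈κ / ε ^ 2⌉₊ with hh
  set n : ℕ := ⌊t / q⌋₊ with hn
  have hh1 : κ / ε ^ 2 ≤ h := Nat.le_ceil _
  have hh2 : (h : ℝ) < κ / ε ^ 2 + 1 := Nat.ceil_lt_add_one (by positivity)
  have hh0 : (0 : ℝ) < h := lt_of_lt_of_le (by positivity) hh1
  have hn1 : (n : ℝ) ≤ t / q := Nat.floor_le (by positivity)
  have hn2 : t / q < n + 1 := Nat.lt_floor_add_one _
  have hκε : κ ≤ ε ^ 2 * h := by rwa [div_le_iff₀' hε2] at hh1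
  have hκε' : ε ^ 2 * h ≤ κ + ε ^ 2 := by
    have := mul_le_mul_of_nonneg_left hh2.le hε2.le
    rwa [mul_add, mul_div_cancel₀ _ hε2.ne', mul_one] at this
  set m : ℕ := n + 1 + h with hm
  have hmc : (m : ℝ) = n + 1 + h := by rw [hm]; push_cast; ring
  have htq : t = t / q * q := by field_simp
  have hc : 0 < h * q := by positivity
  -- Chebyshev with deviation hq: as h ≥ κ/ε², the probability is of order mε⁴ = |ε|·m|ε|³, small in
  -- the regime of interest.
  have hdiv : ∀ j : ℕ, j ≤ m → j * v / (h * q) ^ 2 ≤ m * v / (κ * q) ^ 2 * ε ^ 4 := fun j hj => by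
    have hj' : (j : ℝ) ≤ m := by exact_mod_cast hj
    rw [div_mul_eq_mul_div, div_le_div_iff₀ (by positivity) (by positivity)]
    have h1 : (κ * q) ^ 2 ≤ ε ^ 4 * (h * q) ^ 2 := by
      have := pow_le_pow_left₀ hκ.le hκε 2
      calc (κ * q) ^ 2 = κ ^ 2 * q ^ 2 := by ring
        _ ≤ (ε ^ 2 * h) ^ 2 * q ^ 2 := by gcongr
        _ = _ := by ring
    calc j * v * (κ * q) ^ 2 ≤ m * v * (ε ^ 4 * (h * q) ^ 2) := by gcongr
      _ = _ := by ring
  have hm1 : μ.real {ω | sys.period (fun l => d l ω) m ≤ t} ≤ m * v / (κ * q) ^ 2 * ε ^ 4 := by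
    refine (sys.measureReal_period_le hd_indep hd_ident hd hc ?_).trans (hdiv m le_rfl)
    rw [← hq, hmc]
    nlinarith
  have hl1 : 1 - μ.real {ω | sys.period (fun l => d l ω) (n - h) ≤ t} ≤
      m * v / (κ * q) ^ 2 * ε ^ 4 := by
    -- If n ≤ h, the truncated difference is 0 and the zeroth period end 0 ≤ t leaves no defect of
    -- probability.
    rcases le_total n h with hnh | hnh
    · have e : 1 - μ.real {ω | sys.period (fun l => d l ω) (n - h) ≤ t} = 0 := by
        simp [Nat.sub_eq_zero_of_le hnh, ht]
      rw [e]
      positivity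
    · refine (sys.one_sub_measureReal_period_le hd_meas hd_indep hd_ident hd hc ?_).trans
        (hdiv _ (by omega))
      rw [← hq, Nat.cast_sub hnh]
      nlinarith
  have key := sys.norm_powerVec_sub_heat_le hd_meas hd_nonneg hd_indep hd_phase hφ₀_meas hφ₀
    hφ₀_indep hφ hS ht (show n - h ≤ m by omega)
  have hml : ε ^ 2 * ((m : ℝ) - (n - h : ℕ)) ≤ 2 * κ + 3 * ε ^ 2 := by
    have : (n : ℝ) - h ≤ (n - h : ℕ) := by
      rw [sub_le_iff_le_add]
      exact_mod_cast (by omega : n ≤ n - h + h)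
    have h1 : (m : ℝ) - (n - h : ℕ) ≤ 1 + 2 * h := by rw [hmc]; linarith
    have := mul_le_mul_of_nonneg_left h1 hε2.le
    nlinarith
  have hheat : ‖(IsDiffusion.heat (sys.B S) (ε ^ 2 * m) -
      IsDiffusion.heat (sys.B S) (ε ^ 2 * t / q)) (sys.powerVec μ φ₀ S)‖ ≤
      2 * (κ + 2 * ε ^ 2) * N := by
    have h1 : ‖IsDiffusion.heat (sys.B S) (ε ^ 2 * m) -
        IsDiffusion.heat (sys.B S) (ε ^ 2 * t / q)‖ ≤ 2 * (κ + 2 * ε ^ 2) := by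
      refine (hB.norm_heat_sub_le (by positivity) (by positivity)).trans ?_
      have h2 : ε ^ 2 * m - ε ^ 2 * t / q = ε ^ 2 * (m - t / q) := by ring
      have h3 : 0 ≤ (m : ℝ) - t / q := by rw [hmc]; linarith
      rw [h2, abs_of_nonneg (by positivity)]
      have h4 : (m : ℝ) - t / q ≤ h + 1 := by rw [hmc]; linarith
      have := mul_le_mul_of_nonneg_left h4 hε2.le
      nlinarith
    refine (ContinuousLinearMap.le_of_opNorm_le _ h1 _).trans ?_
    refine mul_le_mul_of_nonneg_left ?_ (by positivity)
    rw [sys.powerVec_eq_integral hφ₀, hN]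
    exact norm_integral_le_of_norm_le (hφ₀.integrable_norm_pow (by norm_num))
      (Eventually.of_forall fun ω => sys.norm_powerAt_le S _)
  have hmε : m * |ε| ^ 3 ≤ |ε| ^ 3 * t / q + 2 * |ε| ^ 3 + κ * |ε| := by
    have h1 : (m : ℝ) ≤ t / q + 2 + κ / ε ^ 2 := by rw [hmc]; linarith
    have h2 : κ / ε ^ 2 * |ε| ^ 3 = κ * |ε| := by
      rw [← sq_abs ε]
      field_simp
    calc m * |ε| ^ 3 ≤ (t / q + 2 + κ / ε ^ 2) * |ε| ^ 3 := by gcongr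
      _ = |ε| ^ 3 * t / q + 2 * |ε| ^ 3 + κ / ε ^ 2 * |ε| ^ 3 := by ring
      _ = _ := by rw [h2]
  have hsum : 4 * |ε| + 2 * μ.real {ω | sys.period (fun l => d l ω) m ≤ t} +
        2 * (1 - μ.real {ω | sys.period (fun l => d l ω) (n - h) ≤ t}) +
        2 * (ε ^ 2 * (m - (n - h : ℕ))) + m * (4 * |ε| ^ 3 + 4 * ε ^ 4) +
        2 * (κ + 2 * ε ^ 2) ≤
      6 * κ + (4 * |ε| + 10 * ε ^ 2 + (4 + 4 * |ε| + 4 * v / (κ * q) ^ 2 * |ε|) *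
          (|ε| ^ 3 * t / q + 2 * |ε| ^ 3 + κ * |ε|)) := by
    have h1 : (4 + 4 * |ε| + 4 * v / (κ * q) ^ 2 * |ε|) * (m * |ε| ^ 3) ≤
        (4 + 4 * |ε| + 4 * v / (κ * q) ^ 2 * |ε|) *
          (|ε| ^ 3 * t / q + 2 * |ε| ^ 3 + κ * |ε|) :=
      mul_le_mul_of_nonneg_left hmε (by positivity)
    have h2 : (4 + 4 * |ε| + 4 * v / (κ * q) ^ 2 * |ε|) * (m * |ε| ^ 3) =
        m * (4 * |ε| ^ 3 + 4 * ε ^ 4) + 4 * (m * v / (κ * q) ^ 2 * ε ^ 4) := by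
      have : ε ^ 4 = |ε| ^ 4 := by rw [← abs_pow]; exact (abs_of_nonneg (by positivity)).symm
      rw [this]
      ring
    linarith
  refine le_trans ?_ (mul_le_mul_of_nonneg_right hsum hN0)
  rw [add_mul _ (2 * (κ + 2 * ε ^ 2)) N]
  refine le_trans ?_ (add_le_add key hheat)
  refine le_trans (le_of_eq ?_) (norm_add_le _ _)
  rw [sub_apply (IsDiffusion.heat (sys.B S) (ε ^ 2 * m))]
  congr 1
  abel

/-- For `t ≪ |ε|⁻³` the expected powers follow the diffusion. -/
theorem tendsto_powerVec_sub_heat (hd_meas : ∀ l, Measurable (d l))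
    (hd_nonneg : ∀ l ω, 0 ≤ d l ω)
    (hd_indep : iIndepFun d μ) (hd_ident : ∀ l, IdentDistrib (d l) (d 0) μ μ)
    (hd_phase : ∀ (l : ℕ) (j k : ι), j ≠ k →
      ∫ ω, Complex.exp (Complex.I * ((sys.lam j - sys.lam k) * d l ω : ℝ)) ∂μ = 0)
    (hd : ∀ l, MemLp (d l) 2 μ) (hφ₀_meas : Measurable φ₀) (hφ₀ : MemLp φ₀ 2 μ)
    (hφ₀_indep : IndepFun φ₀ (fun ω l => d l ω) μ) {φ : ℝ → Ω → ℝ → H}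
    (hφ : ∀ ε ω, sys.IsSolution ε (fun l => d l ω) (φ₀ ω) (φ ε ω)) {S : Set ι}
    (hS : sys.IsIrreducibleSubsystem S) {t : ℝ → ℝ} (ht : ∀ ε, 0 ≤ t ε)
    (htε : Tendsto (fun ε => |ε| ^ 3 * t ε) (𝓝[≠] 0) (𝓝 0)) :
    Tendsto (fun ε => sys.powerVec μ (fun ω => φ ε ω (t ε)) S -
      IsDiffusion.heat (sys.B S) (ε ^ 2 * t ε / (sys.T + ∫ ω, d 0 ω ∂μ))
        (sys.powerVec μ φ₀ S)) (𝓝[≠] 0) (𝓝 0) := by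
  set q := sys.T + ∫ ω, d 0 ω ∂μ with hq
  set N : ℝ := ∫ ω, ‖φ₀ ω‖ ^ 2 ∂μ with hN
  have hN0 : 0 ≤ N := integral_nonneg fun _ => sq_nonneg _
  refine Metric.tendsto_nhds.2 fun δ hδ => ?_
  -- Chosen so that the surviving term 6κN is below δ/2; N + 1 avoids division by zero.
  set κ : ℝ := δ / (12 * (N + 1)) with hκ
  have hκ0 : 0 < κ := by positivity
  have hlt : 6 * κ * N < δ := by
    have : 6 * κ * (N + 1) = δ / 2 := by rw [hκ]; field_simp; ring
    nlinarith
  have hε : Tendsto (fun ε : ℝ => |ε|) (𝓝[≠] 0) (𝓝 0) := by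
    have : Tendsto (fun ε : ℝ => |ε|) (𝓝 0) (𝓝 |0|) := continuous_abs.tendsto 0
    rw [abs_zero] at this
    exact this.mono_left nhdsWithin_le_nhds
  have hε2 : Tendsto (fun ε : ℝ => ε ^ 2) (𝓝[≠] 0) (𝓝 0) := by
    simpa using hε.pow 2
  have hR : Tendsto (fun ε => (6 * κ + (4 * |ε| + 10 * ε ^ 2 +
      (4 + 4 * |ε| + 4 * variance (d 0) μ / (κ * q) ^ 2 * |ε|) *
        (|ε| ^ 3 * t ε / q + 2 * |ε| ^ 3 + κ * |ε|))) * N) (𝓝[≠] 0) (𝓝 ((6 * κ + (4 * 0 +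
      10 * 0 + (4 + 4 * 0 + 4 * variance (d 0) μ / (κ * q) ^ 2 * 0) *
        (0 / q + 2 * 0 ^ 3 + κ * 0))) * N)) :=
    ((((hε.const_mul 4).add (hε2.const_mul 10)).add (((hε.const_mul 4).const_add 4 |>.add
      (hε.const_mul _)).mul (((htε.div_const q).add ((hε.pow 3).const_mul 2)).add
        (hε.const_mul κ)))).const_add (6 * κ)).mul_const N
  have hlim : (6 * κ + (4 * 0 + 10 * 0 + (4 + 4 * 0 +
      4 * variance (d 0) μ / (κ * q) ^ 2 * 0) * (0 / q + 2 * 0 ^ 3 + κ * 0))) * N =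
      6 * κ * N := by simp
  rw [hlim] at hR
  filter_upwards [hR.eventually_lt_const hlt, self_mem_nhdsWithin] with ε h1 h2
  rw [dist_zero_right]
  exact (sys.norm_powerVec_sub_heat_le_add hd_meas hd_nonneg hd_indep hd_ident hd_phase hd
    hφ₀_meas hφ₀ hφ₀_indep h2 (hφ ε) hS (ht ε) hκ0 hq).trans_lt h1

end DefectSystem

/-! ### Exact conservation by a reflection symmetry. -/

namespace DefectSystem

variable {ι H : Type*} [NormedAddCommGroup H] [InnerProductSpace ℂ H] [CompleteSpace H]
  (sys : DefectSystem ι H)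

open Classical in
/-- The reflection that changes the signs of the modes outside `S`. -/
noncomputable def reflection (S : Set ι) : H ≃ₗᵢ[ℂ] H :=
  sys.ψ.diagonal (fun k => if k ∈ S then 1 else -1) fun k => by split_ifs <;> simp

open Classical in
lemma inner_reflection (S : Set ι) (x : H) (k : ι) : inner ℂ (sys.ψ k) (sys.reflection S x) =
    (if k ∈ S then 1 else -1) * inner ℂ (sys.ψ k) x :=
  sys.ψ.inner_diagonal _ x k

lemma reflection_V (S : Set ι) (s : ℝ) (x : H) :
    sys.reflection S (sys.V s x) = sys.V s (sys.reflection S x) := by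
  refine sys.ψ.ext_inner fun k => ?_
  simp only [inner_reflection, inner_V]
  ring

/-- Adding its reflection to x doubles the modes in S and cancels the others. The power in S becomes
a norm, which isometries commuting with the reflection preserve. -/
lemma tsum_powerAt (S : Set ι) (x : H) :
    ∑' k, sys.powerAt S x k = ‖x + sys.reflection S x‖ ^ 2 / 4 := by
  classical
  have h := (sys.ψ.hasSum_norm_sq (x + sys.reflection S x)).div_const 4
  have e : ∀ k, ‖inner ℂ (sys.ψ k) (x + sys.reflection S x)‖ ^ 2 / 4 =
      S.indicator (fun k => ‖inner ℂ (sys.ψ k) x‖ ^ 2) k := fun k => by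
    rw [inner_add_right, inner_reflection]
    by_cases hk : k ∈ S
    · rw [if_pos hk, Set.indicator_of_mem hk, one_mul, ← two_mul, norm_mul, mul_pow]
      norm_num
    · simp [hk]
  simp only [e] at h
  rw [← h.tsum_eq, ← tsum_subtype]
  rfl

section

variable {S : Set ι} (hS : ∀ k ∈ S, ∀ j ∉ S, sys.α k j = 0)

include hS

/-- The matrix of β has no entries between S and its complement: those from S vanish by hypothesis,
the others by self-adjointness. -/
lemma reflection_β (x : H) : sys.reflection S (sys.β x) = sys.β (sys.reflection S x) := by
  classical
  have hβ : ∀ k y, HasSum (fun j => sys.α k j * inner ℂ (sys.ψ j) y)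
      (inner ℂ (sys.ψ k) (sys.β y)) := fun k y => by
    have h := sys.ψ.hasSum_inner_mul_inner (sys.β (sys.ψ k)) y
    have e : ∀ z, inner ℂ (sys.β (sys.ψ k)) z = inner ℂ (sys.ψ k) (sys.β z) := fun z => by
      rw [← ContinuousLinearMap.adjoint_inner_left, sys.β_selfAdjoint.adjoint_eq]
    rw [e] at h
    simpa only [e, α] using h
  refine sys.ψ.ext_inner fun k => ?_
  rw [inner_reflection]
  refine ((hβ k x).mul_left _).unique ((hβ k (sys.reflection S x)).congr_fun fun j => ?_)
  rw [inner_reflection]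
  by_cases hk : k ∈ S <;> by_cases hj : j ∈ S
  · simp [hk, hj]
  · simp [hS k hk j hj]
  · have : sys.α k j = 0 := by rw [← norm_eq_zero, sys.norm_α_symm, hS j hj k hk, norm_zero]
    simp [this]
  · simp [hk, hj]

/-- The reflected trajectory solves the same equation with the reflected initial state, so
uniqueness applies. -/
lemma reflection_propagator (ε t : ℝ) (x : H) :
    sys.reflection S (sys.propagator ε t x) = sys.propagator ε t (sys.reflection S x) := by
  rcases le_total t 0 with ht | ht
  · rw [sys.propagator_of_nonpos ε ht, sys.propagator_of_nonpos ε ht]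
  set w : ℝ → H := fun s => sys.reflection S (sys.trajectory ε x s) with hw
  have hw0 : w 0 = sys.reflection S x := by simp only [hw, sys.trajectory_of_nonpos ε x le_rfl]
  have hwc : Continuous w :=
    (sys.reflection S).continuous.comp (sys.trajectory ε x).continuous
  have h := sys.eq_trajectory ε hwc le_rfl (b := t) (fun s hs => ?_) (Set.right_mem_Icc.2 ht)
  · rwa [hw0] at h
  · have hi : IntervalIntegrable
        (fun s => ((ε * sys.g₀ s : ℝ) : ℂ) • sys.A s (sys.trajectory ε x s)) volume 0 s :=
      sys.intervalIntegrable_smul_A (sys.intervalIntegrable_ε_g₀ ε 0 s)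
        (sys.trajectory ε x).continuous
    have hc : sys.reflection S (∫ r in (0 : ℝ)..s,
          ((ε * sys.g₀ r : ℝ) : ℂ) • sys.A r (sys.trajectory ε x r)) = ∫ r in (0 : ℝ)..s,
          sys.reflection S (((ε * sys.g₀ r : ℝ) : ℂ) • sys.A r (sys.trajectory ε x r)) :=
      (((sys.reflection S).toContinuousLinearEquiv : H →L[ℂ] H).intervalIntegral_comp_comm hi).symm
    rw [hw0]
    simp only [hw]
    rw [trajectory_apply, map_sub, map_smul, hc]
    simp only [map_smul, A, sys.reflection_V, sys.reflection_β hS]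

lemma tsum_powerAt_propagator (ε t : ℝ) (x : H) :
    ∑' k, sys.powerAt S (sys.propagator ε t x) k = ∑' k, sys.powerAt S x k := by
  rw [tsum_powerAt, tsum_powerAt, sys.reflection_propagator hS, ← map_add, norm_propagator]

lemma tsum_powerAt_state (ε : ℝ) (x : H) (d : ℕ → ℝ) (n : ℕ) :
    ∑' k, sys.powerAt S (sys.state ε x d n) k = ∑' k, sys.powerAt S x k := by
  induction n with
  | zero => rfl
  | succ n ih => rw [state, powerAt_V, sys.tsum_powerAt_propagator hS, powerAt_V, ih]

/-- Without coupling of `S` to the other modes, the power in `S` is conserved. -/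
lemma tsum_powerAt_solution {d : ℕ → ℝ} (hd : ∀ n, 0 ≤ d n) {ε : ℝ} {u₀ : H} {u : ℝ → H}
    (hu : sys.IsSolution ε d u₀ u) {t : ℝ} (ht : 0 ≤ t) :
    ∑' k, sys.powerAt S (u t) k = ∑' k, sys.powerAt S u₀ k := by
  obtain ⟨n, hn, hn'⟩ := sys.exists_mem_period hd ht
  rw [sys.isSolution_eq_stateAt hd hu ⟨hn, hn'.le⟩, stateAt, powerAt_V,
    sys.tsum_powerAt_propagator hS, powerAt_V, sys.tsum_powerAt_state hS]

end

lemma tsum_powerVec {Ω : Type*} [MeasurableSpace Ω] {μ : Measure Ω} {X : Ω → H}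
    (hX : MemLp X 2 μ) (S : Set ι) :
    ∑' k, sys.powerVec μ X S k = ∫ ω, ∑' k, sys.powerAt S (X ω) k ∂μ := by
  rw [sys.powerVec_eq_integral hX]
  exact ((ellOneSum S).integral_comp_comm (sys.integrable_powerAt hX S)).symm

end DefectSystem

/-! ### The limits in the different time regimes. -/

lemma tendsto_tsum_notMem {σ α : Type*} {l : Filter α} {v : α → ℓ¹(σ, ℝ)} {E : ℝ} (F : Finset σ)
    (hE : Tendsto (fun a => ∑' k, v a k) l (𝓝 E))
    (hF : Tendsto (fun a => ∑ k ∈ F, v a k) l (𝓝 0)) :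
    Tendsto (fun a => ∑' k : {k : σ // k ∉ F}, v a k) l (𝓝 E) := by
  have h := hE.sub hF
  rw [sub_zero] at h
  refine h.congr fun a => ?_
  have := (ellOne_summable (v a)).sum_add_tsum_subtype_compl F
  linarith

theorem corollary3p3 {ι H Ω : Type*} [Countable ι]
    [NormedAddCommGroup H] [InnerProductSpace ℂ H] [CompleteSpace H]
    [MeasurableSpace H] [BorelSpace H] [MeasurableSpace Ω]
    (sys : DefectSystem ι H)
    (μ : Measure Ω) [IsProbabilityMeasure μ]
    -- the gaps between the defects
    (d : ℕ → Ω → ℝ) (hd_meas : ∀ l, Measurable (d l)) (hd_nonneg : ∀ l ω, 0 ≤ d l ω)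
    (hd_indep : iIndepFun d μ) (hd_ident : ∀ l, IdentDistrib (d l) (d 0) μ μ)
    (hd_phase : ∀ (l : ℕ) (j k : ι), j ≠ k →
      ∫ ω, Complex.exp (Complex.I * ((sys.lam j - sys.lam k) * d l ω : ℝ)) ∂μ = 0)
    (hd_moment : ∀ l, MemLp (d l) 3 μ)
    -- the initial state, deterministic or random and independent of the gaps
    (φ₀ : Ω → H) (hφ₀_meas : Measurable φ₀) (hφ₀ : MemLp φ₀ 2 μ)
    (hφ₀_indep : IndepFun φ₀ (fun ω l => d l ω) μ)
    -- the solution for perturbation size `ε`, realization `ω` and time `t`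
    (φ : ℝ → Ω → ℝ → H)
    (hφ : ∀ ε ω, sys.IsSolution ε (fun l => d l ω) (φ₀ ω) (φ ε ω))
    -- the subsystem
    (S : Set ι) (hS : sys.IsIrreducibleSubsystem S) :
    let M : ℝ := ∫ ω, d 0 ω ∂μ
    let P : ℝ → ℝ → ℓ¹(S, ℝ) := fun ε t => sys.powerVec μ (fun ω => φ ε ω t) S
    let P₀ : ℓ¹(S, ℝ) := sys.powerVec μ φ₀ S
    let E : ℝ := ∑' k : S, P₀ k
    -- all expectations below are those of integrable functions
    (∀ ε t, 0 ≤ t → MemLp (fun ω => φ ε ω t) 2 μ) ∧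
    -- exact conservation when `β` does not couple `S` to the other modes
    ((∀ k ∈ S, ∀ j ∉ S, sys.α k j = 0) → ∀ ε t, 0 ≤ t → HasSum (fun k : S => P ε t k) E) ∧
    ∀ t : ℝ → ℝ, (∀ ε, 0 ≤ t ε) →
      -- conservation, in general
      (Tendsto (fun ε => |ε| ^ 3 * t ε) (𝓝[≠] 0) (𝓝 0) →
        Tendsto (fun ε => ∑' k : S, P ε (t ε) k) (𝓝[≠] 0) (𝓝 E)) ∧
      -- `t ≪ ε⁻²`
      (Tendsto (fun ε => ε ^ 2 * t ε) (𝓝[≠] 0) (𝓝 0) →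
        Tendsto (fun ε => P ε (t ε)) (𝓝[≠] 0) (𝓝 P₀)) ∧
      -- `t ∼ τ ε⁻²`
      (∀ τ : ℝ, 0 < τ → Tendsto (fun ε => ε ^ 2 * t ε) (𝓝[≠] 0) (𝓝 τ) →
        Tendsto (fun ε => P ε (t ε)) (𝓝[≠] 0)
          (𝓝 (NormedSpace.exp (-(τ / (sys.T + M)) • sys.B S) P₀))) ∧
      -- `ε⁻² ≪ t ≪ |ε|⁻³`
      (Tendsto (fun ε => ε ^ 2 * t ε) (𝓝[≠] 0) atTop →
        Tendsto (fun ε => |ε| ^ 3 * t ε) (𝓝[≠] 0) (𝓝 0) →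
        -- finitely many modes: equidistribution
        (S.Finite → ∀ k : S, Tendsto (fun ε => P ε (t ε) k) (𝓝[≠] 0) (𝓝 (E / S.ncard))) ∧
        -- infinitely many modes: loss to the high modes
        (S.Infinite →
          Tendsto (fun ε => ∑' k : S, (P ε (t ε) k) ^ 2) (𝓝[≠] 0) (𝓝 0) ∧
          (0 < E → ¬ ∃ Q : ℓ¹(S, ℝ), Tendsto (fun ε => P ε (t ε)) (𝓝[≠] 0) (𝓝 Q)) ∧
          ∀ F : Finset S,
            Tendsto (fun ε => ∑ k ∈ F, P ε (t ε) k) (𝓝[≠] 0) (𝓝 0) ∧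
            Tendsto (fun ε => ∑' k : {k : S // k ∉ F}, P ε (t ε) k) (𝓝[≠] 0) (𝓝 E))) := by
  intro M P P₀ E
  have hB := sys.isDiffusion hS
  have hP_memLp : ∀ ε t, 0 ≤ t → MemLp (fun ω => φ ε ω t) 2 μ := fun ε t ht =>
    sys.memLp_solution hd_meas hd_nonneg hφ₀_meas hφ₀ (hφ ε) ht
  refine ⟨hP_memLp, fun hα ε t ht => ?_, fun t ht => ?_⟩
  · have h : ∑' k, P ε t k = E := by
      simp only [P, E, P₀]
      rw [sys.tsum_powerVec (hP_memLp ε t ht), sys.tsum_powerVec hφ₀]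
      exact integral_congr_ae (Eventually.of_forall fun ω =>
        sys.tsum_powerAt_solution hα (fun l => hd_nonneg l ω) (hφ ε ω) ht)
    rw [← h]
    exact (ellOne_summable (P ε t)).hasSum
  have hq : 0 < sys.T + M :=
    add_pos_of_pos_of_nonneg sys.T_pos (integral_nonneg fun ω => hd_nonneg 0 ω)
  set D : ℝ → ℓ¹(S, ℝ) := fun ε => IsDiffusion.heat (sys.B S) (ε ^ 2 * t ε / (sys.T + M)) P₀ with hD
  have hdiff : Tendsto (fun ε => |ε| ^ 3 * t ε) (𝓝[≠] 0) (𝓝 0) →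
      Tendsto (fun ε => P ε (t ε) - D ε) (𝓝[≠] 0) (𝓝 0) :=
    sys.tendsto_powerVec_sub_heat hd_meas hd_nonneg hd_indep hd_ident hd_phase
      (fun l => (hd_moment l).mono_exponent (by norm_num)) hφ₀_meas hφ₀ hφ₀_indep hφ hS ht
  -- If ε²t converges, then |ε|³t = |ε|·ε²t tends to zero, so the comparison with the diffusion
  -- applies.
  have hcube : ∀ τ : ℝ, Tendsto (fun ε => ε ^ 2 * t ε) (𝓝[≠] 0) (𝓝 τ) →
      Tendsto (fun ε => |ε| ^ 3 * t ε) (𝓝[≠] 0) (𝓝 0) := fun τ hτ => by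
    have hε : Tendsto (fun ε : ℝ => |ε|) (𝓝[≠] 0) (𝓝 0) := by
      have : Tendsto (fun ε : ℝ => |ε|) (𝓝 0) (𝓝 |0|) := continuous_abs.tendsto 0
      rw [abs_zero] at this
      exact this.mono_left nhdsWithin_le_nhds
    have h := hε.mul hτ
    rw [zero_mul] at h
    refine h.congr fun ε => ?_
    rw [← sq_abs ε]
    ring
  have hlim : ∀ τ : ℝ, Tendsto (fun ε => ε ^ 2 * t ε) (𝓝[≠] 0) (𝓝 τ) →
      Tendsto (fun ε => P ε (t ε)) (𝓝[≠] 0)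
        (𝓝 (IsDiffusion.heat (sys.B S) (τ / (sys.T + M)) P₀)) := fun τ hτ => by
    have h1 : Continuous fun s => IsDiffusion.heat (sys.B S) s P₀ :=
      IsDiffusion.continuous_heat.clm_apply continuous_const
    have h2 := (hdiff (hcube τ hτ)).add ((h1.tendsto _).comp (hτ.div_const (sys.T + M)))
    rw [zero_add] at h2
    exact h2.congr fun ε => sub_add_cancel _ _
  have hsum : Tendsto (fun ε => |ε| ^ 3 * t ε) (𝓝[≠] 0) (𝓝 0) →
      Tendsto (fun ε => ∑' k : S, P ε (t ε) k) (𝓝[≠] 0) (𝓝 E) := fun h => by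
    have h1 := (((ellOneSum S).continuous.tendsto 0).comp (hdiff h)).add_const E
    rw [map_zero, zero_add] at h1
    refine h1.congr fun ε => ?_
    have h2 : ellOneSum S (D ε) = E := hB.sum_heat P₀ _
    simp only [Function.comp_apply]
    rw [map_sub, h2, sub_add_cancel]
    rfl
  refine ⟨hsum, fun h => ?_, fun τ _ hτ => hlim τ hτ, fun hinf h3 => ?_⟩
  · simpa using hlim 0 h
  have hs : Tendsto (fun ε => ε ^ 2 * t ε / (sys.T + M)) (𝓝[≠] 0) atTop :=
    hinf.atTop_div_const hq
  have hcoord : ∀ {y : S → ℝ} (k : S), Tendsto (fun ε => D ε k) (𝓝[≠] 0) (𝓝 (y k)) →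
      Tendsto (fun ε => P ε (t ε) k) (𝓝[≠] 0) (𝓝 (y k)) := fun k hk => by
    have h1 := (((lp.evalCLM ℝ (fun _ : S => ℝ) 1 k).continuous.tendsto 0).comp (hdiff h3)).add hk
    rw [map_zero, zero_add] at h1
    refine h1.congr fun ε => ?_
    exact sub_add_cancel (P ε (t ε) k) (D ε k)
  refine ⟨fun hfin k => ?_, fun hSinf => ?_⟩
  · have : Finite S := hfin
    have h := (hB.tendsto_heat_of_finite (sys.irreducible_W hS) P₀ k).comp hs
    rw [Nat.card_coe_set_eq] at h
    exact hcoord (y := fun _ => E / S.ncard) k h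
  have : Infinite S := hSinf.to_subtype
  -- The comparison holds in ℓ¹, hence in ℓ², where the diffusion tends to zero.
  have hJ : Tendsto (fun ε => ellOneTwo S (P ε (t ε))) (𝓝[≠] 0) (𝓝 0) := by
    have h1 := (((ellOneTwo S).continuous.tendsto 0).comp (hdiff h3)).add
      ((hB.tendsto_heat_of_infinite (sys.irreducible_W hS) P₀).comp hs)
    rw [map_zero, zero_add] at h1
    refine h1.congr fun ε => ?_
    simp only [Function.comp_apply]
    rw [map_sub]
    exact sub_add_cancel _ _
  have hsq : Tendsto (fun ε => ∑' k : S, (P ε (t ε) k) ^ 2) (𝓝[≠] 0) (𝓝 0) := by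
    have h1 := (hJ.norm).pow 2
    simp only [norm_zero, ellOneTwo_norm_sq] at h1
    simpa using h1
  have hzero : ∀ k : S, Tendsto (fun ε => P ε (t ε) k) (𝓝[≠] 0) (𝓝 0) := fun k => by
    refine squeeze_zero_norm (fun ε => ?_) (by simpa using hsq.sqrt)
    refine Real.le_sqrt_of_sq_le ?_
    rw [Real.norm_eq_abs, sq_abs]
    exact (ellOne_summable_sq (P ε (t ε))).le_tsum k fun _ _ => sq_nonneg _
  have hF : ∀ F : Finset S, Tendsto (fun ε => ∑ k ∈ F, P ε (t ε) k) (𝓝[≠] 0) (𝓝 0) := fun F => by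
    simpa using tendsto_finsetSum F fun k _ => hzero k
  refine ⟨hsq, ?_, fun F => ⟨hF F, tendsto_tsum_notMem F (hsum h3) (hF F)⟩⟩
  rintro hE ⟨Q, hQ⟩
  -- An ℓ¹ limit would have all coordinates zero, yet its sum would be E, because the sum is
  -- continuous on ℓ¹.
  have hQ0 : Q = 0 := by
    ext k
    exact tendsto_nhds_unique
      (((lp.evalCLM ℝ (fun _ : S => ℝ) 1 k).continuous.tendsto Q).comp hQ) (hzero k)
  have h1 := tendsto_nhds_unique (((ellOneSum S).continuous.tendsto Q).comp hQ) (hsum h3)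
  rw [hQ0, map_zero] at h1
  exact hE.ne h1
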